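/- Consider the Zabolotskaya–Khokhlov (ZK) equation $u_{xt}-(uu_x)_x-u_{yy}=0$ for real $u(t,x,y)$, and the vector fields $$\mathbf v_0=2x\partial_x+y\partial_y+2u\partial_u,\quad \mathbf x_{(g)}=g\,\partial_x-g'\partial_u,\quad \mathbf y_{(h)}=\tfrac12yh'\partial_x+h\,\partial_y-\tfrac12yh''\partial_u,$$ $$\mathbf z_{(f)}=f\partial_t+\tfrac16(2xf'+y^2f'')\partial_x+\tfrac{2y}{3}f'\partial_y+\tfrac16(-4uf'-2xf''-y^2f''')\partial_u$$ with $f,g,h$ functions of $t$. For real parameters $k_0,k_1,c_1,c_2,c_3$ let $\mathscr L_{2,j}$ be the span of 1. $\mathbf v_0,\ k_0\mathbf v_0+\mathbf z_{(1)}$; 2. $k_1\mathbf v_0+\mathbf z_{(1)},\ k_0\mathbf v_0+\mathbf x_{(c_1e^{2k_1t})}+\mathbf y_{(c_2e^{k_1t})}+\mathbf z_{(c_3)}$; 3. $\mathbf x_{(1)},\ \mathbf x_{(g)}$; 4. $\mathbf x_{(1)},\ \mathbf y_{(h)}$; 5. $\mathbf x_{(1)},\ k_0\mathbf v_0+\mathbf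 z_{(6k_0t+c_3)}$, $(k_0,c_3)\neq(0,0)$; 6. $\mathbf y_{(1)},\ \mathbf x_{(g)}+\mathbf y_{(c_2)}$; 7. $\mathbf y_{(1)},\ k_0\mathbf v_0+\mathbf y_{(c_2)}+\mathbf z_{(-\frac32(k_0t+c_3))}$, $(k_0,c_3)\ne(0,0)$; 8. $\mathbf z_{(1)},\ k_0\mathbf v_0+\mathbf x_{(c_1)}+\mathbf y_{(c_2)}+\mathbf z_{(t+c_3)}$; 9. $\mathbf x_{(1)},\ \mathbf v_0$; 10. $\mathbf x_{(1)},\ k_0\mathbf v_0+\mathbf z_{((3-6k_0)t+c_3)}$, $(k_0,c_3)\neq(\frac12,0)$; 11. $\mathbf y_{(1)},\ \mathbf v_0+\mathbf y_{(c_2)}$; 12. $\mathbf y_{(1)},\ k_0\mathbf v_0+\mathbf y_{(c_2)}+\mathbf z_{(\frac32(1-k_0)t+c_3)}$, $(k_0,c_3)\ne(1,0)$. A function $u$ is invariant under $\mathscr L$ near a point if every $\tau\partial_t+\xi\partial_x+\eta\partial_y+\varphi\partial_u\in\mathscr L$ is tangent to its graph near that point: $\tau u_t+\xi u_x+\eta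 u_y=\varphi$ along the graph. We say that a formula $u=U(t,x,y,w(z))$, $z=z(t,x,y)$, is a *reduction on $D$ to the equation $R(z,w,w',w'')=0$* if (i) for every $p\in D$, a function $u$ that is $C^2$ at $p$ is invariant near $p$ if and only if $u=U(t,x,y,w(z))$ near $p$ for some $w$ that is $C^2$ at $z(p)$; and (ii) for every $p\in D$ and $w$ that is $C^2$ at $z(p)$, the function $u=U(t,x,y,w(z))$ satisfies the ZK equation at $p$ if and only if $R=0$ at $z(p)$. Then the following hold. (Where the base of a real power is positive, the absolute values and the factor $\operatorname{sgn}$ below can be dropped.) **1.** $u=xw(z)$, $z=y^2/x$ is a reduction on $\{x\ne0,\,y\ne0\}$, with (ii) on all of $\{x\neq0\}$, to $$(\ast)\quad -w^2+2(wz-1)w'-z^2w'^2-(4z+wz^2)w''=0.$$ **2.** Let $\kappa=k_0-c_3k_1$. (a) Let $c_2\ne0$, $D=c_2e^{tk_1}+y\kappa$, $N=4c_1c_2e^{tk_1}y+2c_1y^2\kappa+c_2^2(-4x+y^2k_1)$ and $\varepsilon\in\{1,-1\}$. On $\{D\neq0,\ -\varepsilon N>0\}$ a reduction is $$z=\frac{\sqrt{-\varepsilon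 N}}{2D},\qquad u=\frac{-yk_1\big(c_2^2yk_1+4c_1(2c_2e^{tk_1}+y\kappa)\big)+4D^2w(z)}{4c_2^2},$$ to $$\begin{aligned}&-8wz^3\kappa^2+2z^3k_1(4c_1\kappa+c_2^2k_1)+\big(c_1^2+c_2^2w+8z^4\kappa^2+3\varepsilon z^2(c_2^2k_1+2c_1\kappa)\big)w'-c_2^2zw'^2\\&+\big((-c_1^2-c_2^2w)z-4z^5\kappa^2-2\varepsilon z^3(2c_1\kappa+c_2^2k_1)\big)w''=0.\end{aligned}$$ (b) If $c_2=0$, $\kappa\ne0$, put $X=x+c_1e^{2k_1t}/(2\kappa)$: $u=c_1k_1e^{2k_1t}/\kappa+Xw(z)$, $z=y^2/X$ is a reduction on $\{X\neq0,y\ne0\}$, with (ii) on all of $\{X\ne0\}$, to $(\ast)$. (c) If $c_2=0$, $\kappa=0$, $c_1\neq0$: $u=-2k_1x+e^{2k_1t}w(z)$, $z=e^{-k_1t}y$ is a reduction on $\mathbb R^3$ to $w''+4k_1^2=0$. **3.** Let $g$ be smooth near $t_0$, $g'(t_0)\ne0$. Near each point with $t=t_0$, a $C^1$ function $F(t,x,y,u)$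 satisfies $VF=0$ for all $V\in\mathscr L_{2,3}$ if and only if it depends on $t,y$ only. No $C^2$ function $u(t,x,y)$ is invariant near such a point: there is no reduction. **4.** Let $h$ be smooth near $t_0$, $h(t_0)\neq0$; consider points with $t=t_0$. If $h''(t_0)\ne0$, then (i) holds for $z=t$, $u=(w(z)-y^2)h''/(4h)$. Whether or not $h''(t_0)\neq0$, this $u$ (with $w$ of class $C^2$) satisfies the ZK equation at the point if and only if $h''(t_0)=0$, and satisfies it near the point if and only if $h''=0$ near $t_0$; in that case this $u$ is $0$ near the point. Altogether, a $C^2$ function $u$ is an invariant solution near the point if and only if $h''=0$ near $t_0$ and $u=w(t)$ locally for some $C^2$ function $w$. **5.** If $k_0\ne0$, put $T=c_3+6k_0t$: $z=T^5/y^6$, $u=w(z)/|T|^{1/3}$ is a reduction on $\{T\ne0,y\ne0\}$ to $7w'+6zw''=0$. If $k_0=0$: $z=y$, $u=w(z)$ is a reduction on $\mathbb R^3$ to $w''=0$. **6.** Let $g$ be smooth near $t_0$, $g(t_0)\ne0$; consider points with $t=t_0$. If $g'(t_0)\neq0$, then (i) holds for $z=t$, $u=g'(w(z)-x/g)$. Whether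 or not $g'(t_0)\ne0$, this $u$ satisfies the ZK equation at the point if and only if $g''(t_0)=0$. If $g'(t_0)\ne0$, the invariant $C^2$ solutions near the point are exactly the functions $u=\alpha\left(w(t)-\frac{x}{\alpha t+\beta}\right)$, where $g=\alpha t+\beta$ near $t_0$ and $w$ is $C^2$ (there are none if $g$ is not affine near $t_0$). Without the assumption $g'(t_0)\neq0$ they are exactly the functions $u=w(t)-\frac{\alpha x}{\alpha t+\beta}$ with $g=\alpha t+\beta$ near $t_0$ and $w$ of class $C^2$. **7.** $z=x(c_3+k_0t)$, $u=w(z)/(c_3+k_0t)^2$ is a reduction on $\{c_3+k_0t\ne0\}$ to $k_0w'+w'^2+(w-zk_0)w''=0$. **8.** (a) If $k_0\ne-\frac16,-\frac23$, let $X=(6k_0+1)x+3c_1$, $Y=(3k_0+2)y+3c_2$, $s=\frac{6k_0+1}{3k_0+2}$, $r=\frac{6k_0-2}{6k_0+1}$: $z=|X|/|Y|^s$, $u=|X|^rw(z)$ is a reduction on $\{X\ne0,Y\neq0\}$ to $$\begin{aligned}&-r(-1+2r)w^2z^r(1+6k_0)^2+\big(-s(1+s)z^3(2+3k_0)^2-4rwz^{r+1}(1+6k_0)^2\big)w'\\&-z^{r+2}(1+6k_0)^2w'^2+\big(-s^2z^4(2+3k_0)^2-wz^{r+2}(1+6k_0)^2\big)w''=0.\end{aligned}$$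 (b) If $k_0=-\frac16$, $c_1\ne0$: $z=e^{x/c_1}/(y+2c_2)^2$, $u=w(z)/e^{x/c_1}$ is a reduction on $\{y+2c_2\ne0\}$ to $-2w^2+(3wz-6c_1^2z^2)w'-z^2w'^2+(-wz^2-4c_1^2z^3)w''=0$; if $k_0=-\frac16$, $c_1=0$: $z=x$, $u=w(z)/(y+2c_2)^2$ is one on the same set to $6w+w'^2+ww''=0$. (c) If $k_0=-\frac23$, $c_2\neq0$: $z=(c_1-x)e^{y/c_2}$, $u=(c_1-x)^2w(z)$ is a reduction on $\{x\neq c_1\}$ to $-6c_2^2w^2-(z+8c_2^2wz)w'-c_2^2z^2w'^2-(z^2+c_2^2wz^2)w''=0$; if $k_0=-\frac23$, $c_2=0$: $z=y$, $u=(c_1-x)^2w(z)$ is one on the same set to $6w^2+w''=0$. **9.** $z=t$, $u=y^2w(z)$ is a reduction on $\{y\ne0\}$, with (ii) on all of $\mathbb R^3$, to $w=0$; the only invariant $C^2$ solution near a point with $y\ne0$ is $u=0$. **10.** (a) If $k_0\ne\frac12,\frac23$, let $T=c_3+(3-6k_0)t$, $r=\frac{3-6k_0}{2-3k_0}$, $s=\frac{6k_0-2}{3-6k_0}$: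 $z=|T|/|y|^r$, $u=|T|^sw(z)$ is a reduction on $\{T\neq0,y\ne0\}$ to $(-5+9k_0)w'+3z(-1+2k_0)w''=0$. (b) If $k_0=\frac23$: $z=y$, $u=w(z)/(c_3-t)^2$ is a reduction on $\{t\ne c_3\}$ to $w''=0$. (c) If $k_0=\frac12$: $z=e^{-t/(2c_3)}y$, $u=e^{t/c_3}w(z)$ is a reduction on $\mathbb R^3$ to $w''=0$. **11.** $z=t$, $u=xw(z)$ is a reduction on $\{x\ne0\}$ to $w^2-w'=0$. **12.** (a) If $k_0\neq1,-\frac13$, let $T=3(1-k_0)t+2c_3$, $s=\frac{3(1-k_0)}{1+3k_0}$, $r=\frac{2(3k_0-1)}{3(1-k_0)}$: $z=|T|/|x|^s$, $u=\operatorname{sgn}(Tx)|T|^rw(z)$ is a reduction on $\{T\neq0,x\ne0\}$ to $$\big((-1-s)wz^{1+r}+3(1+r)(k_0-1)\big)w'-sz^{2+r}w'^2+\big(-swz^{2+r}+3z(k_0-1)\big)w''=0.$$ (b) If $k_0=1$: $z=e^{2t/c_3}/x$, $u=e^{2t/c_3}w(z)$ is a reduction on $\{x\ne0\}$ to $(4+2c_3wz)w'+c_3z^2w'^2+z(2+c_3wz)w''=0$.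 (c) If $k_0=-\frac13$: $z=x$, $u=w(z)/(c_3+2t)$ is a reduction on $\{c_3+2t\neq0\}$ to $2w'+w'^2+ww''=0$. Every reduced ordinary differential equation above (that is, in all items except 3, 4, 6, 9) has the form $A_1+A_2w'+A_3w'^2+A_4w''=0$, where the $A_j$ are polynomials in $w$ with coefficients depending on $z$. Moreover all of them except those in 2(c) and in 8(b) with $c_1=0$ have $$\begin{aligned}A_1&=\alpha_1w^2+\alpha_2w^2z^r+\alpha_3wz^3+\alpha_4z^3,& A_2&=\beta_1wz^{r+1}+\beta_2wz+\beta_3w+P_4(z),\\ A_3&=\gamma_1z^{r+2}+P_2(z),& A_4&=\delta_1wz^{r+2}+\delta_2wz^2+\delta_3wz+\delta_4w+P_5(z)\end{aligned}$$ with real constants $\alpha_j,\beta_j,\gamma_1,\delta_j,r$ and polynomials $P_n$ of degree at most $n$. -/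

import Mathlib

open Filter Topology Polynomial
open scoped ContDiff

noncomputable section

namespace ZK

/-- The Zabolotskaya-Khokhlov operator `u_{xt} - (u u_x)_x - u_{yy}` at the point `(t, x, y)`. -/
def zkOp (u : ℝ → ℝ → ℝ → ℝ) (t x y : ℝ) : ℝ :=
  deriv (fun t₁ => deriv (fun x₁ => u t₁ x₁ y) x) t
    - deriv (fun x₁ => u t x₁ y * deriv (fun x₂ => u t x₂ y) x₁) x
    - deriv (fun y₁ => deriv (fun y₂ => u t x y₂) y₁) y

/-- Vector fields on the space of `(t, x, y, u)`; the value lists the coefficients of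
`∂_t, ∂_x, ∂_y, ∂_u`. -/
abbrev VField : Type := ℝ → ℝ → ℝ → ℝ → ℝ × ℝ × ℝ × ℝ

/-- `v₀ = 2x ∂_x + y ∂_y + 2u ∂_u`. -/
def v0 : VField := fun _ x y u => (0, 2 * x, y, 2 * u)

/-- `x(g) = g ∂_x - g' ∂_u`. -/
def genX (g : ℝ → ℝ) : VField := fun t _ _ _ => (0, g t, 0, - deriv g t)

/-- `y(h) = (1/2) y h' ∂_x + h ∂_y - (1/2) y h'' ∂_u`. -/
def genY (h : ℝ → ℝ) : VField := fun t _ y _ =>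
  (0, (1 / 2) * y * deriv h t, h t, - ((1 / 2) * y * deriv (deriv h) t))

/-- `z(f) = f ∂_t + (1/6)(2x f' + y² f'') ∂_x + (2y/3) f' ∂_y
+ (1/6)(-4u f' - 2x f'' - y² f''') ∂_u`. -/
def genZ (f : ℝ → ℝ) : VField := fun t x y u =>
  (f t,
    (1 / 6) * (2 * x * deriv f t + y ^ 2 * deriv (deriv f) t),
    (2 * y / 3) * deriv f t,
    (1 / 6) * (-4 * u * deriv f t - 2 * x * deriv (deriv f) t
      - y ^ 2 * deriv (deriv (deriv f)) t))

/-! The twelve canonical algebras, as spans of their generators. -/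

def L1 (k₀ : ℝ) : Submodule ℝ VField :=
  Submodule.span ℝ {v0, k₀ • v0 + genZ (fun _ => 1)}

def L2 (k₀ k₁ c₁ c₂ c₃ : ℝ) : Submodule ℝ VField :=
  Submodule.span ℝ {k₁ • v0 + genZ (fun _ => 1),
    k₀ • v0 + genX (fun t => c₁ * Real.exp (2 * k₁ * t))
      + genY (fun t => c₂ * Real.exp (k₁ * t)) + genZ (fun _ => c₃)}

def L3 (g : ℝ → ℝ) : Submodule ℝ VField :=
  Submodule.span ℝ {genX (fun _ => 1), genX g}

def L4 (h : ℝ → ℝ) : Submodule ℝ VField :=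
  Submodule.span ℝ {genX (fun _ => 1), genY h}

def L5 (k₀ c₃ : ℝ) : Submodule ℝ VField :=
  Submodule.span ℝ {genX (fun _ => 1), k₀ • v0 + genZ (fun t => 6 * k₀ * t + c₃)}

def L6 (g : ℝ → ℝ) (c₂ : ℝ) : Submodule ℝ VField :=
  Submodule.span ℝ {genY (fun _ => 1), genX g + genY (fun _ => c₂)}

def L7 (k₀ c₂ c₃ : ℝ) : Submodule ℝ VField :=
  Submodule.span ℝ {genY (fun _ => 1),
    k₀ • v0 + genY (fun _ => c₂) + genZ (fun t => (-3 / 2) * (k₀ * t + c₃))}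

def L8 (k₀ c₁ c₂ c₃ : ℝ) : Submodule ℝ VField :=
  Submodule.span ℝ {genZ (fun _ => 1),
    k₀ • v0 + genX (fun _ => c₁) + genY (fun _ => c₂) + genZ (fun t => t + c₃)}

def L9 : Submodule ℝ VField :=
  Submodule.span ℝ {genX (fun _ => 1), v0}

def L10 (k₀ c₃ : ℝ) : Submodule ℝ VField :=
  Submodule.span ℝ {genX (fun _ => 1), k₀ • v0 + genZ (fun t => (3 - 6 * k₀) * t + c₃)}

def L11 (c₂ : ℝ) : Submodule ℝ VField :=
  Submodule.span ℝ {genY (fun _ => 1), v0 + genY (fun _ => c₂)}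

def L12 (k₀ c₂ c₃ : ℝ) : Submodule ℝ VField :=
  Submodule.span ℝ {genY (fun _ => 1),
    k₀ • v0 + genY (fun _ => c₂) + genZ (fun t => (3 / 2) * (1 - k₀) * t + c₃)}

/-- `u` is of class `C²` near `(t, x, y)`. -/
def C2At (u : ℝ → ℝ → ℝ → ℝ) (t x y : ℝ) : Prop :=
  ContDiffAt ℝ 2 (fun p : ℝ × ℝ × ℝ => u p.1 p.2.1 p.2.2) (t, x, y)

/-- The property `P` of points holds near `(t, x, y)`. -/
def Near (t x y : ℝ) (P : ℝ → ℝ → ℝ → Prop) : Prop :=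
  ∀ᶠ p in 𝓝 ((t, x, y) : ℝ × ℝ × ℝ), P p.1 p.2.1 p.2.2

/-- `V` is tangent to the graph of `u` above `(t, x, y)`: for
`V = τ ∂_t + ξ ∂_x + η ∂_y + φ ∂_u` one has `τ u_t + ξ u_x + η u_y = φ` there. -/
def Tangent (V : VField) (u : ℝ → ℝ → ℝ → ℝ) (t x y : ℝ) : Prop :=
  (V t x y (u t x y)).1 * deriv (fun t₁ => u t₁ x y) t
    + (V t x y (u t x y)).2.1 * deriv (fun x₁ => u t x₁ y) x
    + (V t x y (u t x y)).2.2.1 * deriv (fun y₁ => u t x y₁) y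
    = (V t x y (u t x y)).2.2.2

/-- Near `(t, x, y)`, the function `u` is invariant under the (local) group generated by `A`. -/
def InvariantNear (A : Submodule ℝ VField) (u : ℝ → ℝ → ℝ → ℝ) (t x y : ℝ) : Prop :=
  ∀ V ∈ A, Near t x y (Tangent V u)

/-- Near `(t, x, y)`, the function `u` solves the ZK equation. -/
def SolvesNear (u : ℝ → ℝ → ℝ → ℝ) (t x y : ℝ) : Prop :=
  Near t x y (fun t₁ x₁ y₁ => zkOp u t₁ x₁ y₁ = 0)

/-- `F(t, x, y, u)` is, near a point, an invariant of the local group generated by `A`. -/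
def IsInvariantFunNear (A : Submodule ℝ VField) (F : ℝ × ℝ × ℝ × ℝ → ℝ)
    (q : ℝ × ℝ × ℝ × ℝ) : Prop :=
  ∀ V ∈ A, ∀ᶠ p in 𝓝 q, fderiv ℝ F p (V p.1 p.2.1 p.2.2.1 p.2.2.2) = 0

/-- On the domain `dom` the reduction formula `u = U(t, x, y, w(z))`, `z = z(t, x, y)`
describes, locally, exactly the `C²` functions invariant under `A`. -/
def IsInvariantForm (A : Submodule ℝ VField) (dom : ℝ → ℝ → ℝ → Prop)
    (z : ℝ → ℝ → ℝ → ℝ) (U : ℝ → ℝ → ℝ → ℝ → ℝ) : Prop :=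
  ∀ t x y : ℝ, dom t x y → ∀ u : ℝ → ℝ → ℝ → ℝ, C2At u t x y →
    (InvariantNear A u t x y ↔
      ∃ w : ℝ → ℝ, ContDiffAt ℝ 2 w (z t x y) ∧
        Near t x y (fun t₁ x₁ y₁ => u t₁ x₁ y₁ = U t₁ x₁ y₁ (w (z t₁ x₁ y₁))))

/-- At each point of `dom`, the function `u = U(t, x, y, w(z))` satisfies the ZK equation if and
only if `R(z, w, w', w'') = 0` at the corresponding value of `z`. -/
def ReducesTo (dom : ℝ → ℝ → ℝ → Prop) (z : ℝ → ℝ → ℝ → ℝ) (U : ℝ → ℝ → ℝ → ℝ → ℝ)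
    (R : ℝ → ℝ → ℝ → ℝ → ℝ) : Prop :=
  ∀ t x y : ℝ, dom t x y → ∀ w : ℝ → ℝ, ContDiffAt ℝ 2 w (z t x y) →
    (zkOp (fun t₁ x₁ y₁ => U t₁ x₁ y₁ (w (z t₁ x₁ y₁))) t x y = 0 ↔
      R (z t x y) (w (z t x y)) (deriv w (z t x y)) (deriv (deriv w) (z t x y)) = 0)

/-- The equation `R(z, w, w', w'') = 0` has the form `A₁ + A₂ w' + A₃ w'² + A₄ w'' = 0`, where the
`A_j` are polynomials in `w` whose coefficients are functions of `z`. -/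
def HasForm (R : ℝ → ℝ → ℝ → ℝ → ℝ) : Prop :=
  ∃ A₁ A₂ A₃ A₄ : ℝ → ℝ[X], ∀ z w w₁ w₂ : ℝ,
    R z w w₁ w₂ = (A₁ z).eval w + (A₂ z).eval w * w₁ + (A₃ z).eval w * w₁ ^ 2
      + (A₄ z).eval w * w₂

/-- The equation `R(z, w, w', w'') = 0` belongs to the explicit family of such equations. -/
def InFamily (R : ℝ → ℝ → ℝ → ℝ → ℝ) : Prop :=
  ∃ (r α₁ α₂ α₃ α₄ β₁ β₂ β₃ γ₁ δ₁ δ₂ δ₃ δ₄ : ℝ) (P₂ P₄ P₅ : ℝ[X]),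
    P₂.natDegree ≤ 2 ∧ P₄.natDegree ≤ 4 ∧ P₅.natDegree ≤ 5 ∧
    ∀ z w w₁ w₂ : ℝ, R z w w₁ w₂ =
      (α₁ * w ^ 2 + α₂ * w ^ 2 * z ^ r + α₃ * w * z ^ 3 + α₄ * z ^ 3)
      + (β₁ * w * z ^ (r + 1) + β₂ * w * z + β₃ * w + P₄.eval z) * w₁
      + (γ₁ * z ^ (r + 2) + P₂.eval z) * w₁ ^ 2
      + (δ₁ * w * z ^ (r + 2) + δ₂ * w * z ^ 2 + δ₃ * w * z + δ₄ * w + P₅.eval z) * w₂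

/-- A reduction of the ZK equation by `A` to the ordinary differential equation
`R(z, w, w', w'') = 0`. -/
def IsReduction (A : Submodule ℝ VField) (dom : ℝ → ℝ → ℝ → Prop)
    (z : ℝ → ℝ → ℝ → ℝ) (U : ℝ → ℝ → ℝ → ℝ → ℝ) (R : ℝ → ℝ → ℝ → ℝ → ℝ) : Prop :=
  IsInvariantForm A dom z U ∧ ReducesTo dom z U R ∧ HasForm R

/-! The reduced equations, as functions of `z, w, w₁ = w', w₂ = w''`. -/

def red1 (z w w₁ w₂ : ℝ) : ℝ :=
  -w ^ 2 + 2 * (w * z - 1) * w₁ - z ^ 2 * w₁ ^ 2 - (4 * z + w * z ^ 2) * w₂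

/-- Here `ε` is `1` or `-1`, and `κ` stands for `k₀ - c₃ k₁`. -/
def red2 (ε κ k₁ c₁ c₂ z w w₁ w₂ : ℝ) : ℝ :=
  -8 * w * z ^ 3 * κ ^ 2 + 2 * z ^ 3 * k₁ * (4 * c₁ * κ + c₂ ^ 2 * k₁)
    + (c₁ ^ 2 + c₂ ^ 2 * w + 8 * z ^ 4 * κ ^ 2
        + 3 * ε * z ^ 2 * (c₂ ^ 2 * k₁ + 2 * c₁ * κ)) * w₁
    - c₂ ^ 2 * z * w₁ ^ 2
    + ((-c₁ ^ 2 - c₂ ^ 2 * w) * z - 4 * z ^ 5 * κ ^ 2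
        - 2 * ε * z ^ 3 * (2 * c₁ * κ + c₂ ^ 2 * k₁)) * w₂

def red5 (z _w w₁ w₂ : ℝ) : ℝ := 7 * w₁ + 6 * z * w₂

def redLin (_z _w _w₁ w₂ : ℝ) : ℝ := w₂

def red7 (k₀ z w w₁ w₂ : ℝ) : ℝ := k₀ * w₁ + w₁ ^ 2 + (w - z * k₀) * w₂

def red8 (k₀ r s z w w₁ w₂ : ℝ) : ℝ :=
  -r * (-1 + 2 * r) * w ^ 2 * z ^ r * (1 + 6 * k₀) ^ 2
    + (-s * (1 + s) * z ^ 3 * (2 + 3 * k₀) ^ 2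
        - 4 * r * w * z ^ (r + 1) * (1 + 6 * k₀) ^ 2) * w₁
    - z ^ (r + 2) * (1 + 6 * k₀) ^ 2 * w₁ ^ 2
    + (-s ^ 2 * z ^ 4 * (2 + 3 * k₀) ^ 2 - w * z ^ (r + 2) * (1 + 6 * k₀) ^ 2) * w₂

def red8b (c₁ z w w₁ w₂ : ℝ) : ℝ :=
  -2 * w ^ 2 + (3 * w * z - 6 * c₁ ^ 2 * z ^ 2) * w₁ - z ^ 2 * w₁ ^ 2
    + (-w * z ^ 2 - 4 * c₁ ^ 2 * z ^ 3) * w₂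

def red8c (c₂ z w w₁ w₂ : ℝ) : ℝ :=
  -6 * c₂ ^ 2 * w ^ 2 - (z + 8 * c₂ ^ 2 * w * z) * w₁ - c₂ ^ 2 * z ^ 2 * w₁ ^ 2
    - (z ^ 2 + c₂ ^ 2 * w * z ^ 2) * w₂

def red10 (k₀ z _w w₁ w₂ : ℝ) : ℝ := (-5 + 9 * k₀) * w₁ + 3 * z * (-1 + 2 * k₀) * w₂

def red11 (_z w w₁ _w₂ : ℝ) : ℝ := w ^ 2 - w₁

def red12 (k₀ r s z w w₁ w₂ : ℝ) : ℝ :=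
  ((-1 - s) * w * z ^ (1 + r) + 3 * (1 + r) * (k₀ - 1)) * w₁ - s * z ^ (2 + r) * w₁ ^ 2
    + (-s * w * z ^ (2 + r) + 3 * z * (k₀ - 1)) * w₂

def red12b (c₃ z w w₁ w₂ : ℝ) : ℝ :=
  (4 + 2 * c₃ * w * z) * w₁ + c₃ * z ^ 2 * w₁ ^ 2 + z * (2 + c₃ * w * z) * w₂

def red12c (_z w w₁ w₂ : ℝ) : ℝ := 2 * w₁ + w₁ ^ 2 + w * w₂

/-! The quantities entering the reduction formula of the second algebra (`κ = k₀ - c₃ k₁`). -/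

def den2 (κ k₁ c₂ t y : ℝ) : ℝ := c₂ * Real.exp (t * k₁) + y * κ

def num2 (κ k₁ c₁ c₂ t x y : ℝ) : ℝ :=
  4 * c₁ * c₂ * Real.exp (t * k₁) * y + 2 * c₁ * y ^ 2 * κ + c₂ ^ 2 * (-4 * x + y ^ 2 * k₁)

def U2 (κ k₁ c₁ c₂ t _x y w : ℝ) : ℝ :=
  (-y * k₁ * (c₂ ^ 2 * y * k₁ + 4 * c₁ * (2 * c₂ * Real.exp (t * k₁) + y * κ))
    + 4 * (den2 κ k₁ c₂ t y) ^ 2 * w) / (4 * c₂ ^ 2)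

end ZK

end

open ZK

namespace ZK

/-! Tangency to the graph is linear in the vector field, so invariance under a two-dimensional
algebra is tangency of its two generators (`invariantNear_span_pair`). In the cases treated by
ansatz each generator has the form τ ∂_t + ξ ∂_x + η ∂_y + (m u + n) ∂_u, with coefficients
depending on (t, x, y) only, so tangency is a linear first-order equation for u. Take z annihilated
by both horizontal parts, a particular solution a of the two equations, and a nonvanishing solution
b of the homogeneous ones. Then u = a + b v is invariant exactly when both horizontal parts
annihilate v. If these parts are linearly independent, the covectors of ℝ³ that they annihilate form
a line; so where dz ≠ 0, dv is a multiple of dz, and straightening z by the inverse function theorem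
gives v = w(z) with w of class C² (`exists_eventually_eq_comp`). This is `isInvariantForm_of`.

By the chain rule, the ZK operator applied to a + b w(z) is the polynomial `Jet.zkForm` in w, w',
w''. It is enough to write it as c R with c ≠ 0 (`reducesTo_of`). A calculus of jets supplies the
partial derivatives of z, a and b, so that each algebra leaves only algebraic identities to check.
In most cases z and b are read off from the rates at which a generator rescales the coordinates and
u: they are products of powers, and an exponential replaces a power when a rate vanishes and the
generator translates the coordinate instead.

Some algebras behave differently. For the third, the horizontal parts are parallel, and the two
tangency conditions contradict each other. For the fourth, sixth and ninth, no generator moves t,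
hence z = t, and the equation becomes a condition without derivatives of w: h'' = 0, g'' = 0 and w =
0 respectively. In the fourth and sixth the invariant functions are first written as w(t) minus a
fixed term, a form that survives the vanishing of h'' or g'; the other normalisation follows by
rescaling w. -/

theorem contDiffAt_deriv {f : ℝ → ℝ} {x : ℝ} {n : ℕ} (h : ContDiffAt ℝ (n + 1 : ℕ) f x) :
    ContDiffAt ℝ n (deriv f) x := by
  have h1 : ContDiffAt ℝ n (fderiv ℝ f) x := h.fderiv_right (by norm_cast)
  exact (h1.clm_apply (contDiffAt_const (c := (1 : ℝ)))).congr_of_eventuallyEq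
    (Eventually.of_forall fun y => fderiv_apply_one_eq_deriv.symm)

/-! ### Functions that factor through a submersion -/

section Factor

variable {E : Type*} [NormedAddCommGroup E] [NormedSpace ℝ E]

/-- On a ball, a function whose derivative kills `k` is unchanged by translation along `k`. -/
theorem eq_of_fderiv_apply_eq_zero {V : E → ℝ} {c : E} {r : ℝ}
    (hd : ∀ q ∈ Metric.ball c r, DifferentiableAt ℝ V q) {q q' : E} (hq : q ∈ Metric.ball c r)
    (hq' : q' ∈ Metric.ball c r) (h : ∀ s ∈ Metric.ball c r, fderiv ℝ V s (q' - q) = 0) :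
    V q' = V q := by
  have hseg : ∀ s ∈ Set.Icc (0 : ℝ) 1, q + s • (q' - q) ∈ Metric.ball c r := fun s hs =>
    (convex_ball c r).add_smul_sub_mem hq hq' hs
  have hder : ∀ s ∈ Set.Icc (0 : ℝ) 1,
      HasDerivAt (fun s : ℝ => V (q + s • (q' - q))) 0 s := by
    intro s hs
    have h1 : HasDerivAt (fun s : ℝ => q + s • (q' - q)) (q' - q) s := by
      simpa using ((hasDerivAt_id s).smul_const (q' - q)).const_add q
    have h2 := (hd _ (hseg s hs)).hasFDerivAt.comp_hasDerivAt s h1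
    rwa [h _ (hseg s hs)] at h2
  have := constant_of_has_deriv_right_zero
    (fun s hs => (hder s hs).continuousAt.continuousWithinAt)
    (fun s hs => (hder s ⟨hs.1, hs.2.le⟩).hasDerivWithinAt) 1 (by simp)
  simpa using this

/-- If `dz ≠ 0` at `p` and `dv` vanishes on the kernel of `dz` near `p`, then `v` is, near `p`, a
`C²` function of `z`. -/
theorem exists_eventually_eq_comp [CompleteSpace E] {v z : E → ℝ} {p e : E}
    (hv : ContDiffAt ℝ 2 v p) (hz : ContDiffAt ℝ 2 z p) (he : fderiv ℝ z p e ≠ 0)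
    (h : ∀ᶠ q in 𝓝 p, ∀ k, fderiv ℝ z q k = 0 → fderiv ℝ v q k = 0) :
    ∃ w : ℝ → ℝ, ContDiffAt ℝ 2 w (z p) ∧ ∀ᶠ q in 𝓝 p, v q = w (z q) := by
  set l := fderiv ℝ z p with hl
  obtain ⟨e, he⟩ : ∃ e, l e = 1 := ⟨(l e)⁻¹ • e, by simp [he]⟩
  -- Since l e = 1, this map satisfies l ∘ Φ = z, and its derivative at p is the identity: it is a
  -- local diffeomorphism that turns z into the linear functional l.
  let Φ : E → E := fun q => q + (z q - l q) • e
  have hΦ : ContDiffAt ℝ 2 Φ p :=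
    contDiffAt_id.add ((hz.sub l.contDiff.contDiffAt).smul contDiffAt_const)
  have hΦ' : HasFDerivAt Φ ((ContinuousLinearEquiv.refl ℝ E : E ≃L[ℝ] E) : E →L[ℝ] E) p := by
    have h1 := (hz.differentiableAt (by norm_num)).hasFDerivAt
    have h2 := (hasFDerivAt_id p).add ((h1.sub l.hasFDerivAt).smul_const e)
    have h3 : ContinuousLinearMap.id ℝ E + (fderiv ℝ z p - l).smulRight e
        = ((ContinuousLinearEquiv.refl ℝ E : E ≃L[ℝ] E) : E →L[ℝ] E) := by
      ext k
      simp [hl]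
    rw [h3] at h2
    exact h2
  have hlΦ : ∀ q, l (Φ q) = z q := fun q => by simp [Φ, he]
  let ψ := hΦ.toOpenPartialHomeomorph Φ hΦ' (by norm_num)
  have hψ : ∀ q, ψ q = Φ q := fun q => rfl
  have hpS : p ∈ ψ.source := hΦ.mem_toOpenPartialHomeomorph_source hΦ' (by norm_num)
  have hpT : Φ p ∈ ψ.target := hΦ.image_mem_toOpenPartialHomeomorph_target hΦ' (by norm_num)
  have hinv : ψ.symm (Φ p) = p := ψ.left_inv hpS
  have hs2 : ContDiffAt ℝ 2 ψ.symm (Φ p) := hΦ.to_localInverse hΦ' (by norm_num)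
  have hcont : Tendsto ψ.symm (𝓝 (Φ p)) (𝓝 p) := by
    simpa [hinv] using hs2.continuousAt.tendsto
  have hzs : ∀ᶠ q in 𝓝 (Φ p), z (ψ.symm q) = l q := by
    filter_upwards [ψ.open_target.mem_nhds hpT] with q hq
    rw [← hlΦ, ← hψ, ψ.right_inv hq]
  set V : E → ℝ := fun q => v (ψ.symm q) with hV
  have hV2 : ContDiffAt ℝ 2 V (Φ p) := ContDiffAt.comp (Φ p) (by rwa [hinv]) hs2
  have hVd : ∀ᶠ q in 𝓝 (Φ p), DifferentiableAt ℝ V q :=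
    (hV2.eventually (by simp)).mono fun q hq => hq.differentiableAt (by norm_num)
  -- Near Φ(p) one has z ∘ Φ⁻¹ = l, so DΦ⁻¹ maps ker l into ker dz, where dv vanishes by hypothesis.
  have hVk : ∀ᶠ q in 𝓝 (Φ p), ∀ k, l k = 0 → fderiv ℝ V q k = 0 := by
    filter_upwards [hcont.eventually h, hzs.eventually_nhds,
      (hs2.eventually (by simp)).mono fun q hq => hq.differentiableAt (by norm_num),
      hcont.eventually ((hv.eventually (by simp)).mono
        fun q hq => hq.differentiableAt (by norm_num)),
      hcont.eventually ((hz.eventually (by simp)).mono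
        fun q hq => hq.differentiableAt (by norm_num))] with q h1 h2 h3 h4 h5 k hk
    have h6 := (h4.hasFDerivAt.comp q h3.hasFDerivAt).fderiv
    have h7 := (h5.hasFDerivAt.comp q h3.hasFDerivAt).fderiv
    have h8 : fderiv ℝ (z ∘ ψ.symm) q = l := by
      rw [Filter.EventuallyEq.fderiv_eq (f₁ := z ∘ ψ.symm) (f := l) h2]
      exact l.fderiv
    rw [h8] at h7
    change fderiv ℝ (v ∘ ψ.symm) q k = 0
    rw [h6]
    refine h1 _ ?_
    rw [h7] at hk
    exact hk
  obtain ⟨r, hr, hball⟩ := Metric.eventually_nhds_iff_ball.1 (hVd.and hVk)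
  -- V depends on l only, so w is its restriction to the line through Φ(p) in direction e,
  -- parametrised by the value s of l.
  refine ⟨fun s => V (Φ p + (s - z p) • e), ?_, ?_⟩
  · refine ContDiffAt.comp (z p) (g := V) (f := fun s : ℝ => Φ p + (s - z p) • e)
      (by simpa only [sub_self, zero_smul, add_zero] using hV2) ?_
    exact contDiffAt_const.add ((contDiffAt_id.sub contDiffAt_const).smul contDiffAt_const)
  · have hm1 : ∀ᶠ q in 𝓝 p, Φ q ∈ Metric.ball (Φ p) r :=
      hΦ.continuousAt.eventually (Metric.ball_mem_nhds _ hr)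
    have hm2 : ∀ᶠ q in 𝓝 p, Φ p + (z q - z p) • e ∈ Metric.ball (Φ p) r := by
      have : ContinuousAt (fun q => Φ p + (z q - z p) • e) p :=
        continuousAt_const.add ((hz.continuousAt.sub continuousAt_const).smul continuousAt_const)
      exact this.eventually (by
        simp only [sub_self, zero_smul, add_zero]
        exact Metric.ball_mem_nhds _ hr)
    filter_upwards [hm1, hm2, ψ.open_source.mem_nhds hpS] with q h1 h2 h3
    have h4 : v q = V (Φ q) := by simp only [hV]; rw [← hψ, ψ.left_inv h3]
    rw [h4]
    -- Φ(q) and the point of the line with parameter z(q) have the same value of l, so their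
    -- difference lies in ker l.
    refine eq_of_fderiv_apply_eq_zero (fun s hs => (hball s hs).1) h2 h1 fun s hs => ?_
    refine (hball s hs).2 _ ?_
    simp [map_sub, hlΦ, he]

end Factor

/-! ### Jets of functions of `(t, x, y)` -/

/-- A function of `(t, x, y)` together with formulas for the partial derivatives that enter the
equation. -/
structure Jet where
  f : ℝ → ℝ → ℝ → ℝ
  ft : ℝ → ℝ → ℝ → ℝ
  fx : ℝ → ℝ → ℝ → ℝ
  fy : ℝ → ℝ → ℝ → ℝ
  fxx : ℝ → ℝ → ℝ → ℝ
  fxt : ℝ → ℝ → ℝ → ℝ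
  fyy : ℝ → ℝ → ℝ → ℝ

namespace Jet

/-- On `D`, the function is of class `C²` and its partial derivatives are the given ones. -/
structure Valid (J : Jet) (D : ℝ → ℝ → ℝ → Prop) : Prop where
  c2 : ∀ {t x y}, D t x y → C2At J.f t x y
  ht : ∀ {t x y}, D t x y → HasDerivAt (fun s => J.f s x y) (J.ft t x y) t
  hx : ∀ {t x y}, D t x y → HasDerivAt (fun s => J.f t s y) (J.fx t x y) x
  hy : ∀ {t x y}, D t x y → HasDerivAt (fun s => J.f t x s) (J.fy t x y) y
  hxx : ∀ {t x y}, D t x y → HasDerivAt (fun s => J.fx t s y) (J.fxx t x y) x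
  hxt : ∀ {t x y}, D t x y → HasDerivAt (fun s => J.fx s x y) (J.fxt t x y) t
  hyy : ∀ {t x y}, D t x y → HasDerivAt (fun s => J.fy t x s) (J.fyy t x y) y

variable {D D' : ℝ → ℝ → ℝ → Prop} {J K : Jet}

theorem Valid.mono (h : J.Valid D) (hD : ∀ {t x y}, D' t x y → D t x y) : J.Valid D' where
  c2 hq := h.c2 (hD hq)
  ht hq := h.ht (hD hq)
  hx hq := h.hx (hD hq)
  hy hq := h.hy (hD hq)
  hxx hq := h.hxx (hD hq)
  hxt hq := h.hxt (hD hq)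
  hyy hq := h.hyy (hD hq)

/-! ### Jets of constants and coordinates. -/

@[simps]
def const (c : ℝ) : Jet where
  f _ _ _ := c
  ft _ _ _ := 0
  fx _ _ _ := 0
  fy _ _ _ := 0
  fxx _ _ _ := 0
  fxt _ _ _ := 0
  fyy _ _ _ := 0

theorem valid_const (c : ℝ) : (const c).Valid D where
  c2 _ := contDiffAt_const
  ht _ := hasDerivAt_const _ _
  hx _ := hasDerivAt_const _ _
  hy _ := hasDerivAt_const _ _
  hxx _ := hasDerivAt_const _ _
  hxt _ := hasDerivAt_const _ _
  hyy _ := hasDerivAt_const _ _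

@[simps]
def coordT : Jet where
  f t _ _ := t
  ft _ _ _ := 1
  fx _ _ _ := 0
  fy _ _ _ := 0
  fxx _ _ _ := 0
  fxt _ _ _ := 0
  fyy _ _ _ := 0

theorem valid_coordT : coordT.Valid D where
  c2 _ := contDiffAt_fst
  ht _ := hasDerivAt_id _
  hx _ := hasDerivAt_const _ _
  hy _ := hasDerivAt_const _ _
  hxx _ := hasDerivAt_const _ _
  hxt _ := hasDerivAt_const _ _
  hyy _ := hasDerivAt_const _ _

@[simps]
def coordX : Jet where
  f _ x _ := x
  ft _ _ _ := 0
  fx _ _ _ := 1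
  fy _ _ _ := 0
  fxx _ _ _ := 0
  fxt _ _ _ := 0
  fyy _ _ _ := 0

theorem valid_coordX : coordX.Valid D where
  c2 _ := contDiffAt_fst.comp _ contDiffAt_snd
  ht _ := hasDerivAt_const _ _
  hx _ := hasDerivAt_id _
  hy _ := hasDerivAt_const _ _
  hxx _ := hasDerivAt_const _ _
  hxt _ := hasDerivAt_const _ _
  hyy _ := hasDerivAt_const _ _

@[simps]
def coordY : Jet where
  f _ _ y := y
  ft _ _ _ := 0
  fx _ _ _ := 0
  fy _ _ _ := 1
  fxx _ _ _ := 0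
  fxt _ _ _ := 0
  fyy _ _ _ := 0

theorem valid_coordY : coordY.Valid D where
  c2 _ := contDiffAt_snd.comp _ contDiffAt_snd
  ht _ := hasDerivAt_const _ _
  hx _ := hasDerivAt_const _ _
  hy _ := hasDerivAt_id _
  hxx _ := hasDerivAt_const _ _
  hxt _ := hasDerivAt_const _ _
  hyy _ := hasDerivAt_const _ _

instance : Add Jet where
  add J K :=
  { f := fun t x y => J.f t x y + K.f t x y
    ft := fun t x y => J.ft t x y + K.ft t x y
    fx := fun t x y => J.fx t x y + K.fx t x y
    fy := fun t x y => J.fy t x y + K.fy t x y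
    fxx := fun t x y => J.fxx t x y + K.fxx t x y
    fxt := fun t x y => J.fxt t x y + K.fxt t x y
    fyy := fun t x y => J.fyy t x y + K.fyy t x y }

@[simp] theorem add_f (J K : Jet) (t x y : ℝ) : (J + K).f t x y =
    J.f t x y + K.f t x y := rfl

@[simp] theorem add_ft (J K : Jet) (t x y : ℝ) : (J + K).ft t x y =
    J.ft t x y + K.ft t x y := rfl

@[simp] theorem add_fx (J K : Jet) (t x y : ℝ) : (J + K).fx t x y =
    J.fx t x y + K.fx t x y := rfl

@[simp] theorem add_fy (J K : Jet) (t x y : ℝ) : (J + K).fy t x y =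
    J.fy t x y + K.fy t x y := rfl

@[simp] theorem add_fxx (J K : Jet) (t x y : ℝ) : (J + K).fxx t x y =
    J.fxx t x y + K.fxx t x y := rfl

@[simp] theorem add_fxt (J K : Jet) (t x y : ℝ) : (J + K).fxt t x y =
    J.fxt t x y + K.fxt t x y := rfl

@[simp] theorem add_fyy (J K : Jet) (t x y : ℝ) : (J + K).fyy t x y =
    J.fyy t x y + K.fyy t x y := rfl

/-- The second-order entries are left as the product rule produces them, so that `Valid.mul` needs
no rewriting. -/
instance : Mul Jet where
  mul J K :=
  { f := fun t x y => J.f t x y * K.f t x y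
    ft := fun t x y => J.ft t x y * K.f t x y + J.f t x y * K.ft t x y
    fx := fun t x y => J.fx t x y * K.f t x y + J.f t x y * K.fx t x y
    fy := fun t x y => J.fy t x y * K.f t x y + J.f t x y * K.fy t x y
    fxx := fun t x y => J.fxx t x y * K.f t x y + J.fx t x y * K.fx t x y
      + (J.fx t x y * K.fx t x y + J.f t x y * K.fxx t x y)
    fxt := fun t x y => J.fxt t x y * K.f t x y + J.fx t x y * K.ft t x y
      + (J.ft t x y * K.fx t x y + J.f t x y * K.fxt t x y)
    fyy := fun t x y => J.fyy t x y * K.f t x y + J.fy t x y * K.fy t x y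
      + (J.fy t x y * K.fy t x y + J.f t x y * K.fyy t x y) }

@[simp] theorem mul_f (J K : Jet) (t x y : ℝ) : (J * K).f t x y =
    J.f t x y * K.f t x y := rfl

@[simp] theorem mul_ft (J K : Jet) (t x y : ℝ) : (J * K).ft t x y =
    J.ft t x y * K.f t x y + J.f t x y * K.ft t x y := rfl

@[simp] theorem mul_fx (J K : Jet) (t x y : ℝ) : (J * K).fx t x y =
    J.fx t x y * K.f t x y + J.f t x y * K.fx t x y := rfl

@[simp] theorem mul_fy (J K : Jet) (t x y : ℝ) : (J * K).fy t x y =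
    J.fy t x y * K.f t x y + J.f t x y * K.fy t x y := rfl

@[simp] theorem mul_fxx (J K : Jet) (t x y : ℝ) : (J * K).fxx t x y =
    J.fxx t x y * K.f t x y + J.fx t x y * K.fx t x y
      + (J.fx t x y * K.fx t x y + J.f t x y * K.fxx t x y) := rfl

@[simp] theorem mul_fxt (J K : Jet) (t x y : ℝ) : (J * K).fxt t x y =
    J.fxt t x y * K.f t x y + J.fx t x y * K.ft t x y
      + (J.ft t x y * K.fx t x y + J.f t x y * K.fxt t x y) := rfl

@[simp] theorem mul_fyy (J K : Jet) (t x y : ℝ) : (J * K).fyy t x y =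
    J.fyy t x y * K.f t x y + J.fy t x y * K.fy t x y
      + (J.fy t x y * K.fy t x y + J.f t x y * K.fyy t x y) := rfl

theorem Valid.add (hJ : J.Valid D) (hK : K.Valid D) : (J + K).Valid D where
  c2 hq := (hJ.c2 hq).add (hK.c2 hq)
  ht hq := (hJ.ht hq).add (hK.ht hq)
  hx hq := (hJ.hx hq).add (hK.hx hq)
  hy hq := (hJ.hy hq).add (hK.hy hq)
  hxx hq := (hJ.hxx hq).add (hK.hxx hq)
  hxt hq := (hJ.hxt hq).add (hK.hxt hq)
  hyy hq := (hJ.hyy hq).add (hK.hyy hq)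

theorem Valid.mul (hJ : J.Valid D) (hK : K.Valid D) : (J * K).Valid D where
  c2 hq := (hJ.c2 hq).mul (hK.c2 hq)
  ht hq := (hJ.ht hq).mul (hK.ht hq)
  hx hq := (hJ.hx hq).mul (hK.hx hq)
  hy hq := (hJ.hy hq).mul (hK.hy hq)
  hxx hq := ((hJ.hxx hq).mul (hK.hx hq)).add ((hJ.hx hq).mul (hK.hxx hq))
  hxt hq := ((hJ.hxt hq).mul (hK.ht hq)).add ((hJ.ht hq).mul (hK.hxt hq))
  hyy hq := ((hJ.hyy hq).mul (hK.hy hq)).add ((hJ.hy hq).mul (hK.hyy hq))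

/-- Composition with a function `φ` of one variable, given formulas for `φ'` and `φ''`. -/
@[simps]
def comp (J : Jet) (φ φ' φ'' : ℝ → ℝ) : Jet where
  f t x y := φ (J.f t x y)
  ft t x y := φ' (J.f t x y) * J.ft t x y
  fx t x y := φ' (J.f t x y) * J.fx t x y
  fy t x y := φ' (J.f t x y) * J.fy t x y
  fxx t x y := φ'' (J.f t x y) * J.fx t x y * J.fx t x y + φ' (J.f t x y) * J.fxx t x y
  fxt t x y := φ'' (J.f t x y) * J.ft t x y * J.fx t x y + φ' (J.f t x y) * J.fxt t x y
  fyy t x y := φ'' (J.f t x y) * J.fy t x y * J.fy t x y + φ' (J.f t x y) * J.fyy t x y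

theorem Valid.comp {φ φ' φ'' : ℝ → ℝ} (hJ : J.Valid D)
    (h : ∀ {t x y}, D t x y → ContDiffAt ℝ 2 φ (J.f t x y))
    (h' : ∀ {t x y}, D t x y → HasDerivAt φ (φ' (J.f t x y)) (J.f t x y))
    (h'' : ∀ {t x y}, D t x y → HasDerivAt φ' (φ'' (J.f t x y)) (J.f t x y)) :
    (J.comp φ φ' φ'').Valid D where
  c2 {t x y} hq := ContDiffAt.comp (t, x, y) (h hq) (hJ.c2 hq)
  ht {t _ _} hq := (h' hq).comp t (hJ.ht hq)
  hx {_ x _} hq := (h' hq).comp x (hJ.hx hq)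
  hy {_ _ y} hq := (h' hq).comp y (hJ.hy hq)
  hxx {_ x _} hq := ((h'' hq).comp x (hJ.hx hq)).mul (hJ.hxx hq)
  hxt {t _ _} hq := ((h'' hq).comp t (hJ.ht hq)).mul (hJ.hxt hq)
  hyy {_ _ y} hq := ((h'' hq).comp y (hJ.hy hq)).mul (hJ.hyy hq)

/-- Composition with a `C²` function. -/
@[simp]
noncomputable def compC2 (J : Jet) (φ : ℝ → ℝ) : Jet :=
  J.comp φ (deriv φ) (deriv (deriv φ))

theorem Valid.compC2 {φ : ℝ → ℝ} (hJ : J.Valid D)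
    (h : ∀ {t x y}, D t x y → ContDiffAt ℝ 2 φ (J.f t x y)) : (J.compC2 φ).Valid D :=
  hJ.comp h
    (fun hq => ((h hq).differentiableAt (by norm_num)).hasDerivAt)
    (fun hq => ((contDiffAt_deriv (n := 1) (h hq)).differentiableAt (by norm_num)).hasDerivAt)

/-! ### Jets of inverses, powers, exponentials, roots and signs. -/

@[simp]
noncomputable def inv (J : Jet) : Jet :=
  J.comp (fun s => s⁻¹) (fun s => -(s ^ 2)⁻¹) (fun s => 2 * (s ^ 3)⁻¹)

theorem Valid.inv (hJ : J.Valid D) (h : ∀ {t x y}, D t x y → J.f t x y ≠ 0) :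
    J.inv.Valid D :=
  hJ.comp (fun hq => contDiffAt_inv ℝ (h hq))
    (fun hq => hasDerivAt_inv (h hq))
    (fun {t x y} hq => by
      have h0 := h hq
      have h1 := hasDerivAt_pow 2 (J.f t x y)
      refine (h1.fun_inv (pow_ne_zero 2 h0)).neg.congr_deriv ?_
      field_simp
      norm_num
      ring)

@[simp]
def pow (J : Jet) (n : ℕ) : Jet :=
  J.comp (fun s => s ^ n) (fun s => n * s ^ (n - 1)) (fun s => n * ((n - 1 : ℕ) * s ^ (n - 1 - 1)))

theorem Valid.pow (hJ : J.Valid D) (n : ℕ) : (J.pow n).Valid D :=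
  hJ.comp (fun _ => contDiffAt_id.pow n) (fun _ => hasDerivAt_pow n _)
    (fun _ => (hasDerivAt_pow (n - 1) _).const_mul _)

@[simp]
noncomputable def exp (J : Jet) : Jet :=
  J.comp Real.exp Real.exp Real.exp

theorem Valid.exp (hJ : J.Valid D) : J.exp.Valid D :=
  hJ.comp (fun _ => Real.contDiff_exp.contDiffAt) (fun _ => Real.hasDerivAt_exp _)
    (fun _ => Real.hasDerivAt_exp _)

/-- The derivative is written with |s| ^ r and s⁻¹ instead of |s| ^ (r - 1) and a sign. All
derivatives are then rational multiples of the single quantity |s| ^ r, which can later be treated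
as an indeterminate. -/
theorem hasDerivAt_abs_rpow (r : ℝ) {s : ℝ} (hs : s ≠ 0) :
    HasDerivAt (fun s : ℝ => |s| ^ r) (r * |s| ^ r * s⁻¹) s := by
  have h1 := (hasDerivAt_abs hs).rpow_const (p := r) (Or.inl (abs_ne_zero.2 hs))
  convert h1 using 1
  rw [Real.rpow_sub_one (abs_ne_zero.2 hs)]
  rcases lt_or_gt_of_ne hs with h | h
  · simp [abs_of_neg h, h]
    field_simp
  · simp [abs_of_pos h, h]
    field_simp

/-- The power `|J| ^ r`. -/
@[simp]
noncomputable def absPow (J : Jet) (r : ℝ) : Jet :=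
  J.comp (fun s => |s| ^ r) (fun s => r * |s| ^ r * s⁻¹)
    (fun s => r * (r - 1) * |s| ^ r * (s ^ 2)⁻¹)

theorem Valid.absPow (hJ : J.Valid D) (r : ℝ) (h : ∀ {t x y}, D t x y → J.f t x y ≠ 0) :
    (J.absPow r).Valid D :=
  hJ.comp (fun hq => (contDiffAt_abs (h hq)).rpow_const_of_ne (abs_ne_zero.2 (h hq)))
    (fun hq => hasDerivAt_abs_rpow r (h hq))
    (fun hq => by
      have h0 := h hq
      refine (((hasDerivAt_abs_rpow r h0).const_mul r).mul (hasDerivAt_inv h0)).congr_deriv ?_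
      field_simp
      ring)

@[simp]
noncomputable def sqrt (J : Jet) : Jet :=
  J.comp Real.sqrt (fun s => (2 * √s)⁻¹) (fun s => -(4 * √s ^ 3)⁻¹)

theorem Valid.sqrt (hJ : J.Valid D) (h : ∀ {t x y}, D t x y → 0 < J.f t x y) :
    J.sqrt.Valid D :=
  hJ.comp (fun hq => Real.contDiffAt_sqrt (h hq).ne')
    (fun hq => by simpa using Real.hasDerivAt_sqrt (h hq).ne')
    (fun hq => by
      have h0 := Real.sqrt_pos.2 (h hq)
      refine (((Real.hasDerivAt_sqrt (h hq).ne').const_mul 2).inv (by positivity)).congr_deriv ?_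
      field_simp
      norm_num)

@[simp]
noncomputable def sign (J : Jet) : Jet :=
  J.comp Real.sign (fun _ => 0) (fun _ => 0)

/-- The sign is locally constant away from 0. -/
theorem Valid.sign (hJ : J.Valid D) (h : ∀ {t x y}, D t x y → J.f t x y ≠ 0) :
    J.sign.Valid D := by
  have key : ∀ {t x y}, D t x y →
      ∀ᶠ s in 𝓝 (J.f t x y), Real.sign s = Real.sign (J.f t x y) := fun hq => by
    rcases lt_or_gt_of_ne (h hq) with h0 | h0
    · filter_upwards [eventually_lt_nhds h0] with s hs
      rw [Real.sign_of_neg hs, Real.sign_of_neg h0]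
    · filter_upwards [eventually_gt_nhds h0] with s hs
      rw [Real.sign_of_pos hs, Real.sign_of_pos h0]
  exact hJ.comp (fun hq => contDiffAt_const.congr_of_eventuallyEq (key hq))
    (fun hq => (hasDerivAt_const _ _).congr_of_eventuallyEq (key hq))
    (fun _ => hasDerivAt_const _ _)

end Jet

/-! ### Slices and points -/

theorem C2At.eventually {u : ℝ → ℝ → ℝ → ℝ} {t x y : ℝ} (h : C2At u t x y) :
    Near t x y (C2At u) :=
  ContDiffAt.eventually h (by simp)

theorem C2At.hasFDerivAt {u : ℝ → ℝ → ℝ → ℝ} {t x y : ℝ} (h : C2At u t x y) :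
    HasFDerivAt (fun p : ℝ × ℝ × ℝ => u p.1 p.2.1 p.2.2)
      (fderiv ℝ (fun p : ℝ × ℝ × ℝ => u p.1 p.2.1 p.2.2) (t, x, y)) (t, x, y) :=
  (ContDiffAt.differentiableAt h (by norm_num)).hasFDerivAt

theorem C2At.hasDerivAt_t {u : ℝ → ℝ → ℝ → ℝ} {t x y : ℝ} (h : C2At u t x y) :
    HasDerivAt (fun s => u s x y)
      (fderiv ℝ (fun p : ℝ × ℝ × ℝ => u p.1 p.2.1 p.2.2) (t, x, y) (1, 0, 0)) t :=
  h.hasFDerivAt.comp_hasDerivAt (f := fun s => (s, x, y)) t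
    ((hasDerivAt_id t).prodMk (hasDerivAt_const t (x, y)))

theorem C2At.hasDerivAt_x {u : ℝ → ℝ → ℝ → ℝ} {t x y : ℝ} (h : C2At u t x y) :
    HasDerivAt (fun s => u t s y)
      (fderiv ℝ (fun p : ℝ × ℝ × ℝ => u p.1 p.2.1 p.2.2) (t, x, y) (0, 1, 0)) x :=
  h.hasFDerivAt.comp_hasDerivAt (f := fun s => (t, s, y)) x
    ((hasDerivAt_const x t).prodMk ((hasDerivAt_id x).prodMk (hasDerivAt_const x y)))

theorem C2At.hasDerivAt_y {u : ℝ → ℝ → ℝ → ℝ} {t x y : ℝ} (h : C2At u t x y) :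
    HasDerivAt (fun s => u t x s)
      (fderiv ℝ (fun p : ℝ × ℝ × ℝ => u p.1 p.2.1 p.2.2) (t, x, y) (0, 0, 1)) y :=
  h.hasFDerivAt.comp_hasDerivAt (f := fun s => (t, x, s)) y
    ((hasDerivAt_const y t).prodMk ((hasDerivAt_const y x).prodMk (hasDerivAt_id y)))

theorem C2At.fderiv_apply {u : ℝ → ℝ → ℝ → ℝ} {t x y ut ux uy : ℝ} (h : C2At u t x y)
    (ht : HasDerivAt (fun s => u s x y) ut t) (hx : HasDerivAt (fun s => u t s y) ux x)
    (hy : HasDerivAt (fun s => u t x s) uy y) (k : ℝ × ℝ × ℝ) :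
    fderiv ℝ (fun p : ℝ × ℝ × ℝ => u p.1 p.2.1 p.2.2) (t, x, y) k
      = k.1 * ut + k.2.1 * ux + k.2.2 * uy := by
  obtain ⟨a, b, c⟩ := k
  have h1 : ((a, b, c) : ℝ × ℝ × ℝ) = a • (1, 0, 0) + b • (0, 1, 0) + c • (0, 0, 1) := by
    simp
  rw [h1, map_add, map_add, map_smul, map_smul, map_smul, h.hasDerivAt_t.unique ht,
    h.hasDerivAt_x.unique hx, h.hasDerivAt_y.unique hy]
  simp

theorem tendsto_slice_t (t x y : ℝ) :
    Tendsto (fun s : ℝ => ((s, x, y) : ℝ × ℝ × ℝ)) (𝓝 t) (𝓝 (t, x, y)) :=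
  Continuous.tendsto (by fun_prop) t

theorem tendsto_slice_x (t x y : ℝ) :
    Tendsto (fun s : ℝ => ((t, s, y) : ℝ × ℝ × ℝ)) (𝓝 x) (𝓝 (t, x, y)) :=
  Continuous.tendsto (f := fun s : ℝ => ((t, s, y) : ℝ × ℝ × ℝ)) (by fun_prop) x

theorem tendsto_slice_y (t x y : ℝ) :
    Tendsto (fun s : ℝ => ((t, x, s) : ℝ × ℝ × ℝ)) (𝓝 y) (𝓝 (t, x, y)) :=
  Continuous.tendsto (f := fun s : ℝ => ((t, x, s) : ℝ × ℝ × ℝ)) (by fun_prop) y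

theorem Near.t {t x y : ℝ} {P : ℝ → ℝ → ℝ → Prop} (h : Near t x y P) :
    ∀ᶠ s in 𝓝 t, P s x y := (tendsto_slice_t t x y).eventually h

theorem Near.x {t x y : ℝ} {P : ℝ → ℝ → ℝ → Prop} (h : Near t x y P) :
    ∀ᶠ s in 𝓝 x, P t s y := (tendsto_slice_x t x y).eventually h

theorem Near.y {t x y : ℝ} {P : ℝ → ℝ → ℝ → Prop} (h : Near t x y P) :
    ∀ᶠ s in 𝓝 y, P t x s := (tendsto_slice_y t x y).eventually h

theorem Near.self {t x y : ℝ} {P : ℝ → ℝ → ℝ → Prop} (h : Near t x y P) : P t x y :=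
  Eventually.self_of_nhds (p := fun p : ℝ × ℝ × ℝ => P p.1 p.2.1 p.2.2) h

theorem Near.near {t x y : ℝ} {P : ℝ → ℝ → ℝ → Prop} (h : Near t x y P) :
    Near t x y (fun t x y => Near t x y P) :=
  eventually_eventually_nhds.2 h

theorem near_of_eventually_t {t : ℝ} (x y : ℝ) {P : ℝ → Prop} (h : ∀ᶠ s in 𝓝 t, P s) :
    Near t x y (fun t _ _ => P t) :=
  (continuous_fst.tendsto ((t, x, y) : ℝ × ℝ × ℝ)).eventually h

theorem Near.deriv_eq {t x y : ℝ} {u v : ℝ → ℝ → ℝ → ℝ}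
    (h : Near t x y (fun t x y => u t x y = v t x y)) :
    deriv (fun s => u s x y) t = deriv (fun s => v s x y) t ∧
    deriv (fun s => u t s y) x = deriv (fun s => v t s y) x ∧
    deriv (fun s => u t x s) y = deriv (fun s => v t x s) y :=
  ⟨EventuallyEq.deriv_eq h.t, EventuallyEq.deriv_eq h.x, EventuallyEq.deriv_eq h.y⟩

theorem tangent_congr {V : VField} {t x y : ℝ} {u v : ℝ → ℝ → ℝ → ℝ}
    (h : Near t x y (fun t x y => u t x y = v t x y)) : Tangent V u t x y ↔ Tangent V v t x y := by
  obtain ⟨h1, h2, h3⟩ := h.deriv_eq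
  unfold Tangent
  rw [h1, h2, h3, h.self]

theorem invariantNear_congr {A : Submodule ℝ VField} {t x y : ℝ} {u v : ℝ → ℝ → ℝ → ℝ}
    (h : Near t x y (fun t x y => u t x y = v t x y)) :
    InvariantNear A u t x y ↔ InvariantNear A v t x y := by
  refine forall₂_congr fun V _ => eventually_congr ?_
  filter_upwards [h.near] with q hq
  exact tangent_congr hq

/-- Second derivatives need the inner first derivatives to agree on a neighbourhood, not only at the
point; `Near.near` provides this. -/
theorem zkOp_congr {t x y : ℝ} {u v : ℝ → ℝ → ℝ → ℝ}
    (h : Near t x y (fun t x y => u t x y = v t x y)) : zkOp u t x y = zkOp v t x y := by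
  have e1 : deriv (fun s => deriv (fun r => u s r y) x) t
      = deriv (fun s => deriv (fun r => v s r y) x) t :=
    EventuallyEq.deriv_eq (h.near.t.mono fun s hs => hs.deriv_eq.2.1)
  have e2 : deriv (fun s => u t s y * deriv (fun r => u t r y) s) x
      = deriv (fun s => v t s y * deriv (fun r => v t r y) s) x :=
    EventuallyEq.deriv_eq (h.near.x.mono fun s hs => by
      simp only [hs.deriv_eq.2.1, hs.self])
  have e3 : deriv (fun s => deriv (fun r => u t x r) s) y
      = deriv (fun s => deriv (fun r => v t x r) s) y :=
    EventuallyEq.deriv_eq (h.near.y.mono fun s hs => hs.deriv_eq.2.2)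
  unfold zkOp
  rw [e1, e2, e3]

theorem solvesNear_congr {t x y : ℝ} {u v : ℝ → ℝ → ℝ → ℝ}
    (h : Near t x y (fun t x y => u t x y = v t x y)) :
    SolvesNear u t x y ↔ SolvesNear v t x y := by
  refine eventually_congr ?_
  filter_upwards [h.near] with q hq
  rw [zkOp_congr hq]

/-! ### Invariance under a span -/

theorem tangent_add {V W : VField} {u : ℝ → ℝ → ℝ → ℝ} {t x y : ℝ} (hV : Tangent V u t x y)
    (hW : Tangent W u t x y) : Tangent (V + W) u t x y := by
  unfold Tangent at *
  simp only [Pi.add_apply, Prod.fst_add, Prod.snd_add]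
  linear_combination hV + hW

theorem tangent_smul {V : VField} (c : ℝ) {u : ℝ → ℝ → ℝ → ℝ} {t x y : ℝ}
    (hV : Tangent V u t x y) : Tangent (c • V) u t x y := by
  unfold Tangent at *
  simp only [Pi.smul_apply, Prod.smul_fst, Prod.smul_snd, smul_eq_mul]
  linear_combination c * hV

/-- Tangency is linear in the field, and the two neighbourhoods for the generators intersect in one
that serves the whole span. -/
theorem invariantNear_span_pair {V W : VField} {u : ℝ → ℝ → ℝ → ℝ} {t x y : ℝ} :
    InvariantNear (Submodule.span ℝ {V, W}) u t x y ↔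
      Near t x y (fun t x y => Tangent V u t x y ∧ Tangent W u t x y) := by
  constructor
  · intro h
    exact (h V (Submodule.subset_span (by simp))).and (h W (Submodule.subset_span (by simp)))
  · intro h Z hZ
    obtain ⟨a, b, rfl⟩ := Submodule.mem_span_pair.1 hZ
    filter_upwards [h] with q hq
    exact tangent_add (tangent_smul a hq.1) (tangent_smul b hq.2)

/-! ### Vector fields that are affine in `u` -/

/-- The vector field `τ ∂_t + ξ ∂_x + η ∂_y + (m u + n) ∂_u` with `τ, ξ, η, m, n` functions of
`(t, x, y)`. -/
structure AffField where
  τ : ℝ → ℝ → ℝ → ℝ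
  ξ : ℝ → ℝ → ℝ → ℝ
  η : ℝ → ℝ → ℝ → ℝ
  m : ℝ → ℝ → ℝ → ℝ
  n : ℝ → ℝ → ℝ → ℝ

namespace AffField

def toVField (V : AffField) : VField := fun t x y u =>
  (V.τ t x y, V.ξ t x y, V.η t x y, V.m t x y * u + V.n t x y)

/-- The horizontal part of the field, applied to a function with the given partial derivatives. -/
def app (V : AffField) (t x y pt px py : ℝ) : ℝ :=
  V.τ t x y * pt + V.ξ t x y * px + V.η t x y * py

/-- `z` is an invariant, and `a + b w` solves the characteristic equation for every constant `w`. -/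
def Fits (V : AffField) (z a b : Jet) (t x y : ℝ) : Prop :=
  V.app t x y (z.ft t x y) (z.fx t x y) (z.fy t x y) = 0 ∧
  V.app t x y (a.ft t x y) (a.fx t x y) (a.fy t x y) = V.m t x y * a.f t x y + V.n t x y ∧
  V.app t x y (b.ft t x y) (b.fx t x y) (b.fy t x y) = V.m t x y * b.f t x y

/-- The horizontal parts of the two fields are linearly independent. -/
def Indep (V W : AffField) (t x y : ℝ) : Prop :=
  V.τ t x y * W.ξ t x y - V.ξ t x y * W.τ t x y ≠ 0 ∨
  V.τ t x y * W.η t x y - V.η t x y * W.τ t x y ≠ 0 ∨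
  V.ξ t x y * W.η t x y - V.η t x y * W.ξ t x y ≠ 0

theorem tangent_toVField {V : AffField} {u : ℝ → ℝ → ℝ → ℝ} {t x y ut ux uy : ℝ}
    (ht : HasDerivAt (fun s => u s x y) ut t) (hx : HasDerivAt (fun s => u t s y) ux x)
    (hy : HasDerivAt (fun s => u t x s) uy y) :
    Tangent V.toVField u t x y ↔
      V.app t x y ut ux uy = V.m t x y * u t x y + V.n t x y := by
  unfold Tangent app
  rw [ht.deriv, hx.deriv, hy.deriv]
  rfl

/-- Two covectors annihilated by two independent vectors are proportional. -/
theorem Indep.exists_smul {V W : AffField} {t x y : ℝ} (h : V.Indep W t x y)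
    {a₁ a₂ a₃ b₁ b₂ b₃ : ℝ} (ha : a₁ ≠ 0 ∨ a₂ ≠ 0 ∨ a₃ ≠ 0)
    (h1 : V.app t x y a₁ a₂ a₃ = 0) (h2 : W.app t x y a₁ a₂ a₃ = 0)
    (h3 : V.app t x y b₁ b₂ b₃ = 0) (h4 : W.app t x y b₁ b₂ b₃ = 0) :
    ∃ l : ℝ, b₁ = l * a₁ ∧ b₂ = l * a₂ ∧ b₃ = l * a₃ := by
  unfold app at *
  obtain ⟨τ, ξ, η, m, n⟩ := V
  obtain ⟨τ', ξ', η', m', n'⟩ := W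
  simp only [Indep] at *
  generalize τ t x y = p at *
  generalize ξ t x y = q at *
  generalize η t x y = r at *
  generalize τ' t x y = p' at *
  generalize ξ' t x y = q' at *
  generalize η' t x y = r' at *
  rcases h with h | h | h
  -- Whichever 2 × 2 minor is nonzero, Cramer's rule expresses two components of each covector
  -- through the third, with the same coefficients. The third component of a is then nonzero, and l
  -- is the ratio of the third components.
  · have e1 : a₁ = a₃ * (q * r' - r * q') / (p * q' - q * p') := by
      rw [eq_div_iff h]; linear_combination q' * h1 - q * h2
    have e2 : a₂ = a₃ * (r * p' - p * r') / (p * q' - q * p') := by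
      rw [eq_div_iff h]; linear_combination p * h2 - p' * h1
    have e3 : b₁ = b₃ * (q * r' - r * q') / (p * q' - q * p') := by
      rw [eq_div_iff h]; linear_combination q' * h3 - q * h4
    have e4 : b₂ = b₃ * (r * p' - p * r') / (p * q' - q * p') := by
      rw [eq_div_iff h]; linear_combination p * h4 - p' * h3
    have h0 : a₃ ≠ 0 := by
      rintro rfl
      simp [e1, e2] at ha
    exact ⟨b₃ / a₃, by rw [e3, e1]; field_simp, by rw [e4, e2]; field_simp, by field_simp⟩
  · have e1 : a₁ = a₂ * (r * q' - q * r') / (p * r' - r * p') := by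
      rw [eq_div_iff h]; linear_combination r' * h1 - r * h2
    have e2 : a₃ = a₂ * (q * p' - p * q') / (p * r' - r * p') := by
      rw [eq_div_iff h]; linear_combination p * h2 - p' * h1
    have e3 : b₁ = b₂ * (r * q' - q * r') / (p * r' - r * p') := by
      rw [eq_div_iff h]; linear_combination r' * h3 - r * h4
    have e4 : b₃ = b₂ * (q * p' - p * q') / (p * r' - r * p') := by
      rw [eq_div_iff h]; linear_combination p * h4 - p' * h3
    have h0 : a₂ ≠ 0 := by
      rintro rfl
      simp [e1, e2] at ha
    exact ⟨b₂ / a₂, by rw [e3, e1]; field_simp, by field_simp, by rw [e4, e2]; field_simp⟩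
  · have e1 : a₂ = a₁ * (r * p' - p * r') / (q * r' - r * q') := by
      rw [eq_div_iff h]; linear_combination r' * h1 - r * h2
    have e2 : a₃ = a₁ * (p * q' - q * p') / (q * r' - r * q') := by
      rw [eq_div_iff h]; linear_combination q * h2 - q' * h1
    have e3 : b₂ = b₁ * (r * p' - p * r') / (q * r' - r * q') := by
      rw [eq_div_iff h]; linear_combination r' * h3 - r * h4
    have e4 : b₃ = b₁ * (p * q' - q * p') / (q * r' - r * q') := by
      rw [eq_div_iff h]; linear_combination q * h4 - q' * h3
    have h0 : a₁ ≠ 0 := by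
      rintro rfl
      simp [e1, e2] at ha
    exact ⟨b₁ / a₁, by field_simp, by rw [e3, e1]; field_simp, by rw [e4, e2]; field_simp⟩

end AffField

/-! ### Criteria for reductions -/

def OpenDom (D : ℝ → ℝ → ℝ → Prop) : Prop :=
  ∀ t x y : ℝ, D t x y → Near t x y D

theorem Jet.Valid.near_compDom {D : ℝ → ℝ → ℝ → Prop} {J : Jet} (hJ : J.Valid D)
    (hD : OpenDom D) {w : ℝ → ℝ}
    {t x y : ℝ} (hq : D t x y) (hw : ContDiffAt ℝ 2 w (J.f t x y)) :
    Near t x y (fun t x y => D t x y ∧ ContDiffAt ℝ 2 w (J.f t x y)) := by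
  have h1 : ContinuousAt (fun p : ℝ × ℝ × ℝ => J.f p.1 p.2.1 p.2.2) (t, x, y) :=
    ContDiffAt.continuousAt (hJ.c2 hq)
  exact (hD _ _ _ hq).and (h1.eventually (hw.eventually (by simp)))

/-- The jet of `a + b w(z)`. -/
noncomputable def Jet.ansatz (z a b : Jet) (w : ℝ → ℝ) : Jet := a + b * z.compC2 w

theorem Jet.Valid.ansatz {D : ℝ → ℝ → ℝ → Prop} {z a b : Jet} (hz : z.Valid D) (ha : a.Valid D)
    (hb : b.Valid D) (w : ℝ → ℝ) :
    (z.ansatz a b w).Valid (fun t x y => D t x y ∧ ContDiffAt ℝ 2 w (z.f t x y)) :=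
  (ha.mono fun h => h.1).add
    ((hb.mono fun h => h.1).mul ((hz.mono fun h => h.1).compC2 fun h => h.2))

/-- A criterion for the invariant functions to be those of the form `a + b w(z)`. -/
theorem isInvariantForm_of {V W : AffField} {D : ℝ → ℝ → ℝ → Prop} {z : ℝ → ℝ → ℝ → ℝ}
    {U : ℝ → ℝ → ℝ → ℝ → ℝ} {J a b : Jet} (hJ : J.Valid D) (ha : a.Valid D)
    (hb' : b.Valid D) (hD : OpenDom D)
    (hz : ∀ t x y, z t x y = J.f t x y)
    (hU : ∀ t x y w, U t x y w = a.f t x y + b.f t x y * w)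
    (hb : ∀ {t x y}, D t x y → b.f t x y ≠ 0)
    (hdz : ∀ {t x y}, D t x y → J.ft t x y ≠ 0 ∨ J.fx t x y ≠ 0 ∨ J.fy t x y ≠ 0)
    (hind : ∀ {t x y}, D t x y → V.Indep W t x y)
    (hV : ∀ {t x y}, D t x y → V.Fits J a b t x y)
    (hW : ∀ {t x y}, D t x y → W.Fits J a b t x y) :
    IsInvariantForm (Submodule.span ℝ {V.toVField, W.toVField}) D z U := by
  intro t x y hq u hu
  simp only [hz, hU]
  constructor
  · rw [invariantNear_span_pair]
    intro hinv
    -- Solving u = a + b v for v; the aim is that dv vanishes on ker dz.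
    let v : ℝ → ℝ → ℝ → ℝ := fun t x y => (u t x y - a.f t x y) / b.f t x y
    have hv : C2At v t x y := ContDiffAt.div (ContDiffAt.sub hu (ha.c2 hq)) (hb'.c2 hq) (hb hq)
    have hne : ∃ e, fderiv ℝ (fun p : ℝ × ℝ × ℝ => J.f p.1 p.2.1 p.2.2) (t, x, y) e ≠ 0 := by
      rcases hdz hq with h | h | h
      · exact ⟨(1, 0, 0), by
          rw [(hJ.c2 hq).fderiv_apply (hJ.ht hq) (hJ.hx hq) (hJ.hy hq)]; simpa using h⟩
      · exact ⟨(0, 1, 0), by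
          rw [(hJ.c2 hq).fderiv_apply (hJ.ht hq) (hJ.hx hq) (hJ.hy hq)]; simpa using h⟩
      · exact ⟨(0, 0, 1), by
          rw [(hJ.c2 hq).fderiv_apply (hJ.ht hq) (hJ.hx hq) (hJ.hy hq)]; simpa using h⟩
    obtain ⟨e, he⟩ := hne
    have key : ∀ t x y, Tangent V.toVField u t x y ∧ Tangent W.toVField u t x y → D t x y →
        C2At u t x y → C2At v t x y → ∀ k : ℝ × ℝ × ℝ,
        fderiv ℝ (fun p : ℝ × ℝ × ℝ => J.f p.1 p.2.1 p.2.2) (t, x, y) k = 0 →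
        fderiv ℝ (fun p : ℝ × ℝ × ℝ => v p.1 p.2.1 p.2.2) (t, x, y) k = 0 := by
      intro t x y ⟨hT1, hT2⟩ hq hu hv k hk
      rw [AffField.tangent_toVField hu.hasDerivAt_t hu.hasDerivAt_x hu.hasDerivAt_y] at hT1 hT2
      have hb0 := hb hq
      have huv : ∀ t x y, b.f t x y ≠ 0 → u t x y = a.f t x y + b.f t x y * v t x y := by
        intro t x y h
        simp only [v]
        field_simp
        ring
      have hcongr : Near t x y (fun t x y => u t x y = a.f t x y + b.f t x y * v t x y) :=
        (hD _ _ _ hq).mono fun p hp => huv _ _ _ (hb hp)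
      -- The partial derivatives of u are recomputed by the Leibniz rule from u = a + b v, which
      -- holds on a neighbourhood because b ≠ 0 on the open domain.
      have et := hu.hasDerivAt_t.unique
        (((ha.ht hq).add ((hb'.ht hq).mul hv.hasDerivAt_t)).congr_of_eventuallyEq hcongr.t)
      have ex := hu.hasDerivAt_x.unique
        (((ha.hx hq).add ((hb'.hx hq).mul hv.hasDerivAt_x)).congr_of_eventuallyEq hcongr.x)
      have ey := hu.hasDerivAt_y.unique
        (((ha.hy hq).add ((hb'.hy hq).mul hv.hasDerivAt_y)).congr_of_eventuallyEq hcongr.y)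
      rw [et, ex, ey, huv _ _ _ hb0] at hT1 hT2
      rw [hv.fderiv_apply hv.hasDerivAt_t hv.hasDerivAt_x hv.hasDerivAt_y]
      rw [(hJ.c2 hq).fderiv_apply (hJ.ht hq) (hJ.hx hq) (hJ.hy hq)] at hk
      obtain ⟨hV1, hV2, hV3⟩ := hV hq
      obtain ⟨hW1, hW2, hW3⟩ := hW hq
      generalize fderiv ℝ (fun p : ℝ × ℝ × ℝ => v p.1 p.2.1 p.2.2) (t, x, y) (1, 0, 0) = vt at *
      generalize fderiv ℝ (fun p : ℝ × ℝ × ℝ => v p.1 p.2.1 p.2.2) (t, x, y) (0, 1, 0) = vx at *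
      generalize fderiv ℝ (fun p : ℝ × ℝ × ℝ => v p.1 p.2.1 p.2.2) (t, x, y) (0, 0, 1) = vy at *
      -- The equations for a and b cancel everything in the tangency condition except b times the
      -- horizontal field applied to v.
      have hV4 : V.app t x y vt vx vy = 0 := by
        apply mul_left_cancel₀ hb0
        unfold AffField.app at *
        linear_combination hT1 - hV2 - v t x y * hV3
      have hW4 : W.app t x y vt vx vy = 0 := by
        apply mul_left_cancel₀ hb0
        unfold AffField.app at *
        linear_combination hT2 - hW2 - v t x y * hW3
      obtain ⟨l, h1, h2, h3⟩ := (hind hq).exists_smul (hdz hq) hV1 hW1 hV4 hW4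
      rw [h1, h2, h3]
      linear_combination l * hk
    obtain ⟨w, hw, hvw⟩ := exists_eventually_eq_comp hv (hJ.c2 hq) he (by
      filter_upwards [hinv, hD _ _ _ hq, hu.eventually, hv.eventually] with p h1 h2 h3 h4
      exact key _ _ _ h1 h2 h3 h4)
    refine ⟨w, hw, ?_⟩
    filter_upwards [hvw, hD _ _ _ hq] with p hp hq
    rw [← hp]
    have hb0 := hb hq
    simp only [v]
    field_simp
    ring
  · rintro ⟨w, hw, huw⟩
    rw [invariantNear_congr huw, invariantNear_span_pair]
    refine (hJ.near_compDom hD hq hw).mono fun p => ?_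
    generalize p.1 = t, p.2.1 = x, p.2.2 = y
    intro hq
    let K := J.ansatz a b w
    have hK := hJ.ansatz ha hb' w
    change Tangent V.toVField K.f t x y ∧ Tangent W.toVField K.f t x y
    obtain ⟨hV1, hV2, hV3⟩ := hV hq.1
    obtain ⟨hW1, hW2, hW3⟩ := hW hq.1
    rw [AffField.tangent_toVField (hK.ht hq) (hK.hx hq) (hK.hy hq),
      AffField.tangent_toVField (hK.ht hq) (hK.hx hq) (hK.hy hq)]
    simp only [Jet.ansatz, Jet.compC2, Jet.add_f, Jet.add_ft, Jet.add_fx, Jet.add_fy, Jet.mul_f,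
      Jet.mul_ft, Jet.mul_fx, Jet.mul_fy, Jet.comp_f, Jet.comp_ft, Jet.comp_fx, Jet.comp_fy]
    unfold AffField.app at *
    constructor
    · linear_combination hV2 + w (J.f t x y) * hV3 + b.f t x y * deriv w (J.f t x y) * hV1
    · linear_combination hW2 + w (J.f t x y) * hW3 + b.f t x y * deriv w (J.f t x y) * hW1

/-- The formulas for the first derivatives hold near the point, so they may be inserted before
differentiating a second time. -/
theorem Jet.Valid.zkOp_eq {D : ℝ → ℝ → ℝ → Prop} {J : Jet} (hJ : J.Valid D) {t x y : ℝ}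
    (hD : Near t x y D) :
    zkOp J.f t x y = J.fxt t x y - (J.fx t x y ^ 2 + J.f t x y * J.fxx t x y) - J.fyy t x y := by
  have hq := hD.self
  have e1 : deriv (fun s => deriv (fun r => J.f s r y) x) t = J.fxt t x y :=
    (EventuallyEq.deriv_eq (hD.t.mono fun s hs => (hJ.hx hs).deriv)).trans (hJ.hxt hq).deriv
  have e2 : deriv (fun s => J.f t s y * deriv (fun r => J.f t r y) s) x
      = J.fx t x y * J.fx t x y + J.f t x y * J.fxx t x y :=
    (EventuallyEq.deriv_eq (hD.x.mono fun s hs => by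
      simp only [(hJ.hx hs).deriv, Pi.mul_apply])).trans ((hJ.hx hq).mul (hJ.hxx hq)).deriv
  have e3 : deriv (fun s => deriv (fun r => J.f t x r) s) y = J.fyy t x y :=
    (EventuallyEq.deriv_eq (hD.y.mono fun s hs => (hJ.hy hs).deriv)).trans (hJ.hyy hq).deriv
  unfold zkOp
  rw [e1, e2, e3]
  ring

/-- The value of the equation on `a + b w(z)`, in terms of `w, w', w''`. -/
def Jet.zkForm (z a b : Jet) (t x y w w₁ w₂ : ℝ) : ℝ :=
  (a.fxt t x y + b.fxt t x y * w + b.fx t x y * w₁ * z.ft t x y + b.ft t x y * w₁ * z.fx t x y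
      + b.f t x y * (w₂ * z.fx t x y * z.ft t x y + w₁ * z.fxt t x y))
    - ((a.fx t x y + b.fx t x y * w + b.f t x y * w₁ * z.fx t x y) ^ 2
      + (a.f t x y + b.f t x y * w)
        * (a.fxx t x y + b.fxx t x y * w + 2 * b.fx t x y * w₁ * z.fx t x y
          + b.f t x y * (w₂ * z.fx t x y ^ 2 + w₁ * z.fxx t x y)))
    - (a.fyy t x y + b.fyy t x y * w + 2 * b.fy t x y * w₁ * z.fy t x y
      + b.f t x y * (w₂ * z.fy t x y ^ 2 + w₁ * z.fyy t x y))

/-- A criterion for `a + b w(z)` to turn the equation into `R = 0`: up to a non-zero factor `c`,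
the equation is `R`. -/
theorem reducesTo_of {D : ℝ → ℝ → ℝ → Prop} {z : ℝ → ℝ → ℝ → ℝ} {U R : ℝ → ℝ → ℝ → ℝ → ℝ}
    {J a b : Jet} (hJ : J.Valid D) (ha : a.Valid D)
    (hb : b.Valid D) (c : ℝ → ℝ → ℝ → ℝ) (hD : OpenDom D)
    (hz : ∀ t x y, z t x y = J.f t x y)
    (hU : ∀ t x y w, U t x y w = a.f t x y + b.f t x y * w)
    (hc : ∀ {t x y}, D t x y → c t x y ≠ 0)
    (hR : ∀ {t x y}, D t x y → ∀ w w₁ w₂,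
      J.zkForm a b t x y w w₁ w₂ = c t x y * R (J.f t x y) w w₁ w₂) :
    ReducesTo D z U R := by
  intro t x y hq w hw
  simp only [hz, hU] at hw ⊢
  have h1 := (hJ.ansatz ha hb w).zkOp_eq (hJ.near_compDom hD hq hw)
  have h2 : (J.ansatz a b w).f = fun t x y => a.f t x y + b.f t x y * w (J.f t x y) := rfl
  rw [h2] at h1
  have h3 := hR hq (w (J.f t x y)) (deriv w (J.f t x y)) (deriv (deriv w) (J.f t x y))
  rw [h1, ← mul_right_inj' (hc hq) (b := R _ _ _ _), ← h3, mul_zero]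
  refine Eq.congr_left ?_
  simp only [Jet.zkForm, Jet.ansatz, Jet.compC2, Jet.add_fx, Jet.add_fxx, Jet.add_fxt,
    Jet.add_fyy, Jet.mul_fx, Jet.mul_fxx, Jet.mul_fxt, Jet.mul_fyy, Jet.comp_f, Jet.comp_ft,
    Jet.comp_fx, Jet.comp_fy, Jet.comp_fxx, Jet.comp_fxt, Jet.comp_fyy]
  ring

open Jet

/-! ### Open domains -/

theorem openDom_true : OpenDom (fun _ _ _ => True) :=
  fun _ _ _ _ => Eventually.of_forall fun _ => trivial

theorem OpenDom.and {D D' : ℝ → ℝ → ℝ → Prop} (h : OpenDom D) (h' : OpenDom D') :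
    OpenDom (fun t x y => D t x y ∧ D' t x y) :=
  fun _ _ _ hq => (h _ _ _ hq.1).and (h' _ _ _ hq.2)

theorem openDom_ne {f : ℝ → ℝ → ℝ → ℝ}
    (hf : Continuous (fun p : ℝ × ℝ × ℝ => f p.1 p.2.1 p.2.2)) :
    OpenDom (fun t x y => f t x y ≠ 0) :=
  fun t x y hq => (hf.continuousAt (x := (t, x, y))).eventually_ne hq

theorem openDom_pos {f : ℝ → ℝ → ℝ → ℝ}
    (hf : Continuous (fun p : ℝ × ℝ × ℝ => f p.1 p.2.1 p.2.2)) :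
    OpenDom (fun t x y => 0 < f t x y) :=
  fun t x y hq => (hf.continuousAt (x := (t, x, y))).eventually (eventually_gt_nhds hq)

theorem isReduction_of {A : Submodule ℝ VField} {V W : AffField} {D : ℝ → ℝ → ℝ → Prop}
    {z : ℝ → ℝ → ℝ → ℝ} {U R : ℝ → ℝ → ℝ → ℝ → ℝ}
    (hA : A = Submodule.span ℝ {V.toVField, W.toVField})
    {J a b : Jet} (c : ℝ → ℝ → ℝ → ℝ) (hJ : J.Valid D) (ha : a.Valid D) (hb' : b.Valid D)
    (hD : OpenDom D)
    (hz : ∀ t x y, z t x y = J.f t x y)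
    (hU : ∀ t x y w, U t x y w = a.f t x y + b.f t x y * w)
    (hb : ∀ {t x y}, D t x y → b.f t x y ≠ 0)
    (hdz : ∀ {t x y}, D t x y → J.ft t x y ≠ 0 ∨ J.fx t x y ≠ 0 ∨ J.fy t x y ≠ 0)
    (hind : ∀ {t x y}, D t x y → V.Indep W t x y)
    (hV : ∀ {t x y}, D t x y → V.Fits J a b t x y)
    (hW : ∀ {t x y}, D t x y → W.Fits J a b t x y)
    (hc : ∀ {t x y}, D t x y → c t x y ≠ 0)
    (hR : ∀ {t x y}, D t x y → ∀ w w₁ w₂,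
      J.zkForm a b t x y w w₁ w₂ = c t x y * R (J.f t x y) w w₁ w₂)
    (hform : HasForm R) : IsReduction A D z U R := by
  subst hA
  exact ⟨isInvariantForm_of hJ ha hb' hD hz hU hb hdz hind hV hW,
    reducesTo_of hJ ha hb' c hD hz hU hc hR, hform⟩

/-! ### The shape of the reduced equations -/

/-- Real powers of z are harmless here: they go into the z-dependent coefficients of the polynomials
in w. -/
theorem InFamily.hasForm {R : ℝ → ℝ → ℝ → ℝ → ℝ} (h : InFamily R) : HasForm R := by
  obtain ⟨r, α₁, α₂, α₃, α₄, β₁, β₂, β₃, γ₁, δ₁, δ₂, δ₃, δ₄, P₂, P₄, P₅, -, -, -, h⟩ := h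
  refine ⟨fun z => C (α₁ + α₂ * z ^ r) * X ^ 2 + C (α₃ * z ^ 3) * X + C (α₄ * z ^ 3),
    fun z => C (β₁ * z ^ (r + 1) + β₂ * z + β₃) * X + C (P₄.eval z),
    fun z => C (γ₁ * z ^ (r + 2) + P₂.eval z),
    fun z => C (δ₁ * z ^ (r + 2) + δ₂ * z ^ 2 + δ₃ * z + δ₄) * X + C (P₅.eval z), ?_⟩
  intro z w w₁ w₂
  rw [h]
  simp only [eval_add, eval_mul, eval_C, eval_pow, eval_X]
  ring

theorem inFamily_red1 : InFamily red1 := by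
  -- The order of the witnesses is r, α₁ to α₄, β₁ to β₃, γ₁, δ₁ to δ₄, P₂, P₄, P₅. Here r is
  -- irrelevant, since the coefficients of its powers are 0.
  refine ⟨0, -1, 0, 0, 0, 0, 2, 0, 0, 0, -1, 0, 0, -X ^ 2, C (-2), C (-4) * X,
    by compute_degree!, by compute_degree!, by compute_degree!, fun z w w₁ w₂ => ?_⟩
  simp only [eval_neg, eval_mul, eval_C, eval_pow, eval_X, red1]
  ring

/-! ### The vector fields -/

theorem genX_const (c : ℝ) : genX (fun _ => c) = fun _ _ _ _ => (0, c, 0, 0) := by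
  funext t x y u
  simp [genX]

theorem genY_const (c : ℝ) : genY (fun _ => c) = fun _ _ _ _ => (0, 0, c, 0) := by
  funext t x y u
  simp [genY]

/-- For affine f the terms with f'' and f''' vanish. All the z(f) that occur in the algebras have
affine f; `hf` allows f to be given in any algebraically equal form. -/
theorem genZ_affine {f : ℝ → ℝ} (a c : ℝ) (hf : ∀ t, f t = a * t + c) : genZ f =
    fun t x y u => (a * t + c, a * x / 3, 2 * a * y / 3, -2 * a * u / 3) := by
  obtain rfl : f = fun t => a * t + c := funext hf
  have h1 : deriv (fun t => a * t + c) = fun _ => a := by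
    funext t
    simp
  funext t x y u
  simp only [genZ, h1, deriv_const', Prod.mk.injEq]
  refine ⟨trivial, ?_, ?_, ?_⟩ <;> ring

theorem genZ_const (c : ℝ) : genZ (fun _ => c) = fun _ _ _ _ => (c, 0, 0, 0) := by
  simpa using genZ_affine (f := fun _ => c) 0 c (by simp)

theorem span_pair_congr {V V' W W' : VField} (hV : V = V') (hW : W = W') :
    Submodule.span ℝ {V, W} = Submodule.span ℝ {V', W'} := by
  rw [hV, hW]

/-! ### The first algebra -/

/-- Here, as in the analogous lemmas for the other algebras, the derivatives of the coefficient
functions are evaluated and the generators are put in the affine form that the criteria require. -/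
theorem L1_eq (k₀ : ℝ) : L1 k₀ = Submodule.span ℝ
    {AffField.toVField ⟨fun _ _ _ => 0, fun _ x _ => 2 * x, fun _ _ y => y, fun _ _ _ => 2,
      fun _ _ _ => 0⟩,
    AffField.toVField ⟨fun _ _ _ => 1, fun _ x _ => k₀ * (2 * x), fun _ _ y => k₀ * y,
      fun _ _ _ => k₀ * 2, fun _ _ _ => 0⟩} := by
  rw [L1, genZ_const]
  congr! 2
  · funext t x y u
    simp [v0, AffField.toVField]
  · congr 1
    funext t x y u
    simp [v0, AffField.toVField]
    ring

/-- Modulo v₀ the second generator is ∂_t, so k₀ plays no role: t drops out, and v₀ scales x, y, u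
with weights 2, 1, 2. -/
theorem isInvariantForm_L1 (k₀ : ℝ) : IsInvariantForm (L1 k₀) (fun _ x y => x ≠ 0 ∧ y ≠ 0)
    (fun _ x y => y ^ 2 / x) (fun _ x _ w => x * w) := by
  rw [L1_eq]
  refine isInvariantForm_of ((valid_coordY.mul valid_coordY).mul
    (valid_coordX.inv fun hq => hq.1)) (valid_const 0) valid_coordX
    (.and (openDom_ne (by fun_prop)) (openDom_ne (by fun_prop))) ?_ ?_ ?_ ?_ ?_ ?_ ?_
  · intro t x y
    simp
    ring
  · intro t x y w
    simp
  · intro t x y hq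
    simpa using hq.1
  · rintro t x y ⟨hx, hy⟩
    simp [hx, hy]
  · rintro t x y ⟨hx, hy⟩
    simp [AffField.Indep, hx, hy]
  · rintro t x y ⟨hx, hy⟩
    simp [AffField.Fits, AffField.app]
    field_simp
    ring
  · rintro t x y ⟨hx, hy⟩
    simp [AffField.Fits, AffField.app]
    constructor
    · field_simp
      ring
    · ring

/-- The larger domain is possible because at y = 0 only the condition dz ≠ 0 fails, and substitution
into the equation does not need it. -/
theorem reducesTo_L1 : ReducesTo (fun _ x _ => x ≠ 0) (fun _ x y => y ^ 2 / x)
    (fun _ x _ w => x * w) red1 := by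
  refine reducesTo_of ((valid_coordY.mul valid_coordY).mul (valid_coordX.inv fun hq => hq))
    (valid_const 0) valid_coordX
    (fun _ _ _ => 1) (openDom_ne (by fun_prop)) ?_ ?_ ?_ ?_
  · intro t x y
    simp
    ring
  · intro t x y w
    simp
  · intro t x y hq
    simp
  · intro t x y hx w w₁ w₂
    simp [Jet.zkForm, red1]
    field_simp
    ring

/-! ### The fifth algebra -/

theorem L5_eq (k₀ c₃ : ℝ) : L5 k₀ c₃ = Submodule.span ℝ
    {AffField.toVField ⟨fun _ _ _ => 0, fun _ _ _ => 1, fun _ _ _ => 0, fun _ _ _ => 0,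
      fun _ _ _ => 0⟩,
    AffField.toVField ⟨fun t _ _ => c₃ + 6 * k₀ * t, fun _ x _ => 4 * k₀ * x,
      fun _ _ y => 5 * k₀ * y, fun _ _ _ => -2 * k₀, fun _ _ _ => 0⟩} := by
  rw [L5, genX_const, genZ_affine (6 * k₀) c₃ fun _ => rfl]
  refine span_pair_congr ?_ ?_ <;> funext t x y u <;> simp [v0, AffField.toVField]
  refine ⟨?_, ?_, ?_, ?_⟩ <;> ring

theorem inFamily_red5 : InFamily red5 := by
  refine ⟨0, 0, 0, 0, 0, 0, 0, 0, 0, 0, 0, 0, 0, 0, C 7, C 6 * X,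
    by compute_degree!, by compute_degree!, by compute_degree!, fun z w w₁ w₂ => ?_⟩
  simp only [eval_zero, eval_mul, eval_C, eval_X, red5]
  ring

theorem inFamily_redLin : InFamily redLin := by
  refine ⟨0, 0, 0, 0, 0, 0, 0, 0, 0, 0, 0, 0, 0, 0, 0, C 1,
    by compute_degree!, by compute_degree!, by compute_degree!, fun z w w₁ w₂ => ?_⟩
  simp only [eval_zero, eval_C, redLin]
  ring

/-- With T = c₃ + 6k₀t, the second generator scales T, y, u at the rates 6k₀, 5k₀, -2k₀. Translation
invariance makes u independent of x, so only u_yy survives and the reduced equation is linear. -/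
theorem isReduction_L5 {k₀ c₃ : ℝ} (hk : k₀ ≠ 0) :
    IsReduction (L5 k₀ c₃) (fun t _ y => c₃ + 6 * k₀ * t ≠ 0 ∧ y ≠ 0)
      (fun t _ y => (c₃ + 6 * k₀ * t) ^ 5 / y ^ 6)
      (fun t _ _ w => w / |c₃ + 6 * k₀ * t| ^ (1 / 3 : ℝ)) red5 := by
  have hT : (const c₃ + const (6 * k₀) * coordT).Valid (fun t _ y => c₃ + 6 * k₀ * t ≠ 0 ∧ y ≠ 0) :=
    (valid_const _).add ((valid_const _).mul valid_coordT)
  refine isReduction_of (L5_eq k₀ c₃)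
    (fun t _ y => -6 * |c₃ + 6 * k₀ * t| ^ (-(1 / 3) : ℝ) * (c₃ + 6 * k₀ * t) ^ 5 / y ^ 8)
    ((hT.pow 5).mul ((valid_coordY.pow 6).inv fun hq => pow_ne_zero 6 hq.2)) (valid_const 0)
    (hT.absPow (-(1 / 3)) fun hq => hq.1)
    (.and (openDom_ne (by fun_prop)) (openDom_ne (by fun_prop))) ?_ ?_ ?_ ?_ ?_ ?_ ?_ ?_ ?_
    inFamily_red5.hasForm
  · intro t x y
    simp [div_eq_mul_inv]
  · intro t x y w
    simp [div_eq_mul_inv, Real.rpow_neg]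
    ring
  · rintro t x y ⟨hT, hy⟩
    exact (Real.rpow_pos_of_pos (abs_pos.2 hT) _).ne'
  · rintro t x y ⟨hT, hy⟩
    simp [hT, hy, hk]
  · rintro t x y ⟨hT, hy⟩
    refine Or.inl fun h => hT ?_
    simp at h
    linarith
  · rintro t x y ⟨hT, hy⟩
    simp [AffField.Fits, AffField.app]
  · rintro t x y ⟨hT, hy⟩
    simp [AffField.Fits, AffField.app]
    constructor
    · field_simp
      ring
    · field_simp
      ring
  · rintro t x y ⟨hT, hy⟩
    simp [hT, hy, (Real.rpow_pos_of_pos (abs_pos.2 hT) _).ne']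
  · rintro t x y ⟨hT, hy⟩ w w₁ w₂
    simp [zkForm, red5]
    field_simp
    ring

theorem isReduction_L5_zero {c₃ : ℝ} (hc : c₃ ≠ 0) :
    IsReduction (L5 0 c₃) (fun _ _ _ => True) (fun _ _ y => y) (fun _ _ _ w => w) redLin := by
  refine isReduction_of (L5_eq 0 c₃) (fun _ _ _ => -1) valid_coordY (valid_const 0)
    (valid_const 1) openDom_true ?_ ?_ ?_ ?_ ?_ ?_ ?_ ?_ ?_ inFamily_redLin.hasForm
  all_goals simp [AffField.Fits, AffField.app, AffField.Indep, zkForm, redLin, hc]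

/-! ### The seventh algebra -/

theorem L7_eq (k₀ c₂ c₃ : ℝ) : L7 k₀ c₂ c₃ = Submodule.span ℝ
    {AffField.toVField ⟨fun _ _ _ => 0, fun _ _ _ => 0, fun _ _ _ => 1, fun _ _ _ => 0,
      fun _ _ _ => 0⟩,
    AffField.toVField ⟨fun t _ _ => -3 / 2 * (c₃ + k₀ * t), fun _ x _ => 3 / 2 * k₀ * x,
      fun _ _ _ => c₂, fun _ _ _ => 3 * k₀, fun _ _ _ => 0⟩} := by
  rw [L7, genY_const, genY_const, genZ_affine (-3 / 2 * k₀) (-3 / 2 * c₃) fun _ => by ring]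
  refine span_pair_congr ?_ ?_ <;> funext t x y u <;> simp [v0, AffField.toVField]
  refine ⟨?_, ?_, ?_, ?_⟩ <;> ring

theorem inFamily_red7 (k₀ : ℝ) : InFamily (red7 k₀) := by
  refine ⟨0, 0, 0, 0, 0, 0, 0, 0, 0, 0, 0, 0, 1, C 1, C k₀, C (-k₀) * X,
    by compute_degree!, by compute_degree!, by compute_degree!, fun z w w₁ w₂ => ?_⟩
  simp only [eval_mul, eval_C, eval_X, red7]
  ring

/-- With T = c₃ + k₀t, the rates of T, x, u are -3k₀/2, 3k₀/2, 3k₀, and u does not depend on y. -/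
theorem isReduction_L7 (k₀ c₂ c₃ : ℝ) :
    IsReduction (L7 k₀ c₂ c₃) (fun t _ _ => c₃ + k₀ * t ≠ 0)
      (fun t x _ => x * (c₃ + k₀ * t)) (fun t _ _ w => w / (c₃ + k₀ * t) ^ 2) (red7 k₀) := by
  have hT : (const c₃ + const k₀ * coordT).Valid (fun t _ _ => c₃ + k₀ * t ≠ 0) :=
    (valid_const _).add ((valid_const _).mul valid_coordT)
  refine isReduction_of (L7_eq k₀ c₂ c₃) (fun t _ _ => -((c₃ + k₀ * t) ^ 2)⁻¹)
    (valid_coordX.mul hT) (valid_const 0) ((hT.pow 2).inv fun hq => pow_ne_zero 2 hq)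
    (openDom_ne (by fun_prop)) ?_ ?_ ?_ ?_ ?_ ?_ ?_ ?_ ?_ (inFamily_red7 k₀).hasForm
  · intro t x y
    simp
  · intro t x y w
    simp
    ring
  · intro t x y hT
    simpa using hT
  · intro t x y hT
    simp [hT]
  · intro t x y hT
    simp [AffField.Indep, hT]
  · intro t x y hT
    simp [AffField.Fits, AffField.app]
  · intro t x y hT
    simp [AffField.Fits, AffField.app]
    constructor
    · ring
    · field_simp
  · intro t x y hT
    simp [hT]
  · intro t x y hT w w₁ w₂
    simp [zkForm, red7]
    field_simp
    ring

/-! ### The ninth algebra -/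

theorem L9_eq : L9 = Submodule.span ℝ
    {AffField.toVField ⟨fun _ _ _ => 0, fun _ _ _ => 1, fun _ _ _ => 0, fun _ _ _ => 0,
      fun _ _ _ => 0⟩,
    AffField.toVField ⟨fun _ _ _ => 0, fun _ x _ => 2 * x, fun _ _ y => y, fun _ _ _ => 2,
      fun _ _ _ => 0⟩} := by
  rw [L9, genX_const]
  refine span_pair_congr ?_ ?_ <;> funext t x y u <;> simp [v0, AffField.toVField]

theorem isInvariantForm_L9 :
    IsInvariantForm L9 (fun _ _ y => y ≠ 0) (fun t _ _ => t) (fun _ _ y w => y ^ 2 * w) := by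
  rw [L9_eq]
  refine isInvariantForm_of valid_coordT (valid_const 0) (valid_coordY.pow 2)
    (openDom_ne (by fun_prop)) ?_ ?_ ?_ ?_ ?_ ?_ ?_
  · simp
  · simp
  · simp
  · simp
  · simp [AffField.Indep]
  · simp [AffField.Fits, AffField.app]
  · intro t x y hy
    simp [AffField.Fits, AffField.app]
    ring

/-- Only -u_yy = -2w is left of the equation. At y = 0 the coefficient b = y² vanishes, which
matters for the invariant form but not for this substitution. -/
theorem reducesTo_L9 : ReducesTo (fun _ _ _ => True) (fun t _ _ => t) (fun _ _ y w => y ^ 2 * w)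
    (fun _ w _ _ => w) := by
  refine reducesTo_of valid_coordT (valid_const 0) (valid_coordY.pow 2) (fun _ _ _ => -2)
    openDom_true ?_ ?_ ?_ ?_
  all_goals simp [zkForm]

theorem zkOp_zero (t x y : ℝ) : zkOp (fun _ _ _ => 0) t x y = 0 := by
  simp [zkOp]

theorem invariantNear_L9_and_solvesNear_iff {t x y : ℝ} (hy : y ≠ 0) {u : ℝ → ℝ → ℝ → ℝ}
    (hu : C2At u t x y) :
    InvariantNear L9 u t x y ∧ SolvesNear u t x y ↔
      Near t x y (fun t₁ x₁ y₁ => u t₁ x₁ y₁ = 0) := by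
  rw [isInvariantForm_L9 t x y hy u hu]
  constructor
  · rintro ⟨⟨w, hw, huw⟩, hs⟩
    rw [solvesNear_congr huw] at hs
    filter_upwards [hs, huw, near_of_eventually_t x y (hw.eventually (by simp))] with p h1 h2 h3
    rw [reducesTo_L9 _ _ _ trivial w h3] at h1
    exact h2.trans (mul_eq_zero_of_right _ h1)
  · intro h
    refine ⟨⟨fun _ => 0, contDiffAt_const, by simpa using h⟩, ?_⟩
    rw [solvesNear_congr h]
    exact Eventually.of_forall fun p => zkOp_zero _ _ _

/-! ### The eleventh algebra -/

theorem L11_eq (c₂ : ℝ) : L11 c₂ = Submodule.span ℝ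
    {AffField.toVField ⟨fun _ _ _ => 0, fun _ _ _ => 0, fun _ _ _ => 1, fun _ _ _ => 0,
      fun _ _ _ => 0⟩,
    AffField.toVField ⟨fun _ _ _ => 0, fun _ x _ => 2 * x, fun _ _ y => y + c₂, fun _ _ _ => 2,
      fun _ _ _ => 0⟩} := by
  rw [L11, genY_const, genY_const]
  refine span_pair_congr ?_ ?_ <;> funext t x y u <;> simp [v0, AffField.toVField]

theorem inFamily_red11 : InFamily red11 := by
  refine ⟨0, 1, 0, 0, 0, 0, 0, 0, 0, 0, 0, 0, 0, 0, C (-1), 0,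
    by compute_degree!, by compute_degree!, by compute_degree!, fun z w w₁ w₂ => ?_⟩
  simp only [eval_zero, eval_C, red11]
  ring

theorem isReduction_L11 (c₂ : ℝ) : IsReduction (L11 c₂) (fun _ x _ => x ≠ 0) (fun t _ _ => t)
    (fun _ x _ w => x * w) red11 := by
  refine isReduction_of (L11_eq c₂) (fun _ _ _ => -1) valid_coordT (valid_const 0)
    valid_coordX (openDom_ne (by fun_prop)) ?_ ?_ ?_ ?_ ?_ ?_ ?_ ?_ ?_ inFamily_red11.hasForm
  · simp
  · simp
  · simp
  · simp
  · simp [AffField.Indep]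
  · simp [AffField.Fits, AffField.app]
  · simp [AffField.Fits, AffField.app]
  · simp
  · intro t x y hx w w₁ w₂
    simp [zkForm, red11]

/-! ### The eighth algebra -/

theorem L8_eq (k₀ c₁ c₂ c₃ : ℝ) : L8 k₀ c₁ c₂ c₃ = Submodule.span ℝ
    {AffField.toVField ⟨fun _ _ _ => 1, fun _ _ _ => 0, fun _ _ _ => 0, fun _ _ _ => 0,
      fun _ _ _ => 0⟩,
    AffField.toVField ⟨fun t _ _ => t + c₃, fun _ x _ => ((6 * k₀ + 1) * x + 3 * c₁) / 3,
      fun _ _ y => ((3 * k₀ + 2) * y + 3 * c₂) / 3, fun _ _ _ => 2 * k₀ - 2 / 3,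
      fun _ _ _ => 0⟩} := by
  rw [L8, genX_const, genY_const, genZ_const, genZ_affine 1 c₃ fun _ => by ring]
  refine span_pair_congr ?_ ?_ <;> funext t x y u <;> simp [v0, AffField.toVField]
  refine ⟨?_, ?_, ?_⟩ <;> ring

theorem inFamily_red8 (k₀ r s : ℝ) : InFamily (red8 k₀ r s) := by
  refine ⟨r, 0, -r * (-1 + 2 * r) * (1 + 6 * k₀) ^ 2, 0, 0, -4 * r * (1 + 6 * k₀) ^ 2, 0, 0,
    -(1 + 6 * k₀) ^ 2, -(1 + 6 * k₀) ^ 2, 0, 0, 0, 0,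
    C (-s * (1 + s) * (2 + 3 * k₀) ^ 2) * X ^ 3, C (-s ^ 2 * (2 + 3 * k₀) ^ 2) * X ^ 4,
    by compute_degree!, by compute_degree!, by compute_degree!, fun z w w₁ w₂ => ?_⟩
  simp only [eval_zero, eval_mul, eval_C, eval_X, eval_pow, red8]
  ring

/-- With X and Y the two affine expressions in x and y, the second generator scales X, Y, u at the
rates (6k₀ + 1)/3, (3k₀ + 2)/3, (6k₀ - 2)/3; s and r are the ratios of the first two and of the last
to the first. -/
theorem isReduction_L8 {k₀ r s : ℝ} (c₁ c₂ c₃ : ℝ) (h1 : k₀ ≠ -1 / 6) (h2 : k₀ ≠ -2 / 3)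
    (hs : s = (6 * k₀ + 1) / (3 * k₀ + 2)) (hr : r = (6 * k₀ - 2) / (6 * k₀ + 1)) :
    IsReduction (L8 k₀ c₁ c₂ c₃)
      (fun _ x y => (6 * k₀ + 1) * x + 3 * c₁ ≠ 0 ∧ (3 * k₀ + 2) * y + 3 * c₂ ≠ 0)
      (fun _ x y => |(6 * k₀ + 1) * x + 3 * c₁| / |(3 * k₀ + 2) * y + 3 * c₂| ^ s)
      (fun _ x _ w => |(6 * k₀ + 1) * x + 3 * c₁| ^ r * w) (red8 k₀ r s) := by
  have h1' : 6 * k₀ + 1 ≠ 0 := fun h => h1 (by linarith)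
  have h2' : 3 * k₀ + 2 ≠ 0 := fun h => h2 (by linarith)
  have hs' : s * (3 * k₀ + 2) = 6 * k₀ + 1 := by rw [hs, div_mul_cancel₀ _ h2']
  have hr' : r * (6 * k₀ + 1) = 6 * k₀ - 2 := by rw [hr, div_mul_cancel₀ _ h1']
  -- This relation balances the linear and the nonlinear terms: it turns z ^ r into |X| ^ r (|Y| ^
  -- (-s))² Y².
  have hsr : s * r = 2 * s - 2 :=
    mul_left_cancel₀ h2' (by linear_combination r * hs' + hr' - 2 * hs')
  have hX : (const (6 * k₀ + 1) * coordX + const (3 * c₁)).Valid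
      (fun _ x y => (6 * k₀ + 1) * x + 3 * c₁ ≠ 0 ∧ (3 * k₀ + 2) * y + 3 * c₂ ≠ 0) :=
    ((valid_const _).mul valid_coordX).add (valid_const _)
  have hY : (const (3 * k₀ + 2) * coordY + const (3 * c₂)).Valid
      (fun _ x y => (6 * k₀ + 1) * x + 3 * c₁ ≠ 0 ∧ (3 * k₀ + 2) * y + 3 * c₂ ≠ 0) :=
    ((valid_const _).mul valid_coordY).add (valid_const _)
  refine isReduction_of (L8_eq k₀ c₁ c₂ c₃)
    (fun _ x y => |(6 * k₀ + 1) * x + 3 * c₁| ^ r / (((6 * k₀ + 1) * x + 3 * c₁) ^ 2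
      * (|(3 * k₀ + 2) * y + 3 * c₂| ^ (-s)) ^ 2 * ((3 * k₀ + 2) * y + 3 * c₂) ^ 2))
    ((hX.absPow 1 fun hq => hq.1).mul (hY.absPow (-s) fun hq => hq.2)) (valid_const 0)
    (hX.absPow r fun hq => hq.1)
    (.and (openDom_ne (by fun_prop)) (openDom_ne (by fun_prop))) ?_ ?_ ?_ ?_ ?_ ?_ ?_ ?_ ?_
    (inFamily_red8 k₀ r s).hasForm
  · intro t x y
    simp [div_eq_mul_inv, Real.rpow_neg]
  · intro t x y w
    simp
  · rintro t x y ⟨hX, hY⟩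
    exact (Real.rpow_pos_of_pos (abs_pos.2 hX) _).ne'
  · rintro t x y ⟨hX, hY⟩
    refine Or.inr (Or.inl ?_)
    simp [hX, h1', (Real.rpow_pos_of_pos (abs_pos.2 hY) _).ne']
  · rintro t x y ⟨hX, hY⟩
    simp [AffField.Indep, hX]
  · rintro t x y ⟨hX, hY⟩
    simp [AffField.Fits, AffField.app]
  · rintro t x y ⟨hX, hY⟩
    simp [AffField.Fits, AffField.app]
    constructor
    · generalize |(3 * k₀ + 2) * y + 3 * c₂| ^ (-s) = Q
      generalize (3 * k₀ + 2) * y + 3 * c₂ = Y at hY ⊢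
      generalize (6 * k₀ + 1) * x + 3 * c₁ = X at hX ⊢
      field_simp
      linear_combination -(|X| * Q) * hs'
    · generalize |(6 * k₀ + 1) * x + 3 * c₁| ^ r = P
      generalize (6 * k₀ + 1) * x + 3 * c₁ = X at hX ⊢
      field_simp
      linear_combination P * hr'
  · rintro t x y ⟨hX, hY⟩
    simp [hX, hY, (Real.rpow_pos_of_pos (abs_pos.2 hX) _).ne',
      (Real.rpow_pos_of_pos (abs_pos.2 hY) _).ne']
  · rintro t x y ⟨hX, hY⟩ w w₁ w₂
    simp only [zkForm, red8, mul_f, mul_fx, mul_ft, mul_fy, mul_fxx, mul_fxt, mul_fyy, Jet.absPow,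
      comp_f, comp_fx, comp_ft, comp_fy, comp_fxx, comp_fxt, comp_fyy, add_f, add_fx, add_ft,
      add_fy, add_fxx, add_fxt, add_fyy, const_f, const_fx, const_fy, const_ft, const_fxx,
      const_fxt, const_fyy, coordX_f, coordX_fx, coordX_fy, coordX_ft, coordX_fxx,
      coordX_fxt, coordX_fyy, coordY_f, coordY_fx, coordY_fy, coordY_ft, coordY_fxx,
      coordY_fxt, coordY_fyy, Real.rpow_one]
    have hQ : 0 < |(3 * k₀ + 2) * y + 3 * c₂| ^ (-s) := Real.rpow_pos_of_pos (abs_pos.2 hY) _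
    have hz : (|(6 * k₀ + 1) * x + 3 * c₁| * |(3 * k₀ + 2) * y + 3 * c₂| ^ (-s)) ^ r =
        |(6 * k₀ + 1) * x + 3 * c₁| ^ r * ((|(3 * k₀ + 2) * y + 3 * c₂| ^ (-s)) ^ 2
          * ((3 * k₀ + 2) * y + 3 * c₂) ^ 2) := by
      rw [Real.mul_rpow (abs_nonneg _) hQ.le, ← Real.rpow_mul (abs_nonneg _),
        ← sq_abs ((3 * k₀ + 2) * y + 3 * c₂), ← Real.rpow_natCast, ← Real.rpow_natCast,
        ← Real.rpow_mul (abs_nonneg _), ← Real.rpow_add (abs_pos.2 hY)]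
      congr 2
      push_cast
      linear_combination -hsr
    have hz0 : 0 < |(6 * k₀ + 1) * x + 3 * c₁| * |(3 * k₀ + 2) * y + 3 * c₂| ^ (-s) :=
      mul_pos (abs_pos.2 hX) hQ
    rw [Real.rpow_add hz0, Real.rpow_add hz0, hz, Real.rpow_one, Real.rpow_two]
    have hQ' := hQ.ne'
    have hP : |(6 * k₀ + 1) * x + 3 * c₁| ^ r ≠ 0 := (Real.rpow_pos_of_pos (abs_pos.2 hX) _).ne'
    -- No power with exponent r or s is needed any longer: the identity is rational in P, Q, X, Y
    -- and |X|.
    generalize |(6 * k₀ + 1) * x + 3 * c₁| ^ r = P at hP ⊢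
    generalize |(3 * k₀ + 2) * y + 3 * c₂| ^ (-s) = Q at hQ' ⊢
    clear hz hz0 hQ
    generalize (3 * k₀ + 2) * y + 3 * c₂ = Y at hY ⊢
    generalize (6 * k₀ + 1) * x + 3 * c₁ = X at hX ⊢
    rcases abs_choice X with h | h
    · rw [h]
      field_simp
      ring
    · rw [h]
      field_simp
      ring

theorem inFamily_red8b (c₁ : ℝ) : InFamily (red8b c₁) := by
  refine ⟨0, -2, 0, 0, 0, 0, 3, 0, 0, 0, -1, 0, 0, -X ^ 2, C (-6 * c₁ ^ 2) * X ^ 2,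
    C (-4 * c₁ ^ 2) * X ^ 3,
    by compute_degree!, by compute_degree!, by compute_degree!, fun z w w₁ w₂ => ?_⟩
  simp only [eval_neg, eval_mul, eval_C, eval_X, eval_pow, red8b]
  ring

/-- For k₀ = -1/6 the rate of X vanishes and x is translated with speed c₁, so exp(x/c₁), of rate 1,
replaces the power of X. The rates of y + 2c₂ and u are 1/2 and -1. -/
theorem isReduction_L8b {c₁ : ℝ} (c₂ c₃ : ℝ) (hc : c₁ ≠ 0) :
    IsReduction (L8 (-1 / 6) c₁ c₂ c₃) (fun _ _ y => y + 2 * c₂ ≠ 0)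
      (fun _ x y => Real.exp (x / c₁) / (y + 2 * c₂) ^ 2)
      (fun _ x _ w => w / Real.exp (x / c₁)) (red8b c₁) := by
  have hY : (coordY + const (2 * c₂)).Valid (fun _ _ y => y + 2 * c₂ ≠ 0) :=
    valid_coordY.add (valid_const _)
  have hE : (const c₁⁻¹ * coordX).exp.Valid (fun _ _ y => y + 2 * c₂ ≠ 0) :=
    ((valid_const _).mul valid_coordX).exp
  refine isReduction_of (L8_eq _ c₁ c₂ c₃)
    (fun _ x _ => (Real.exp (c₁⁻¹ * x) ^ 2 * c₁ ^ 2)⁻¹)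
    (hE.mul ((hY.pow 2).inv fun hq => pow_ne_zero 2 hq)) (valid_const 0)
    (hE.inv fun _ => (Real.exp_pos _).ne') (openDom_ne (by fun_prop)) ?_ ?_ ?_ ?_ ?_ ?_ ?_ ?_ ?_
    (inFamily_red8b c₁).hasForm
  · intro t x y
    simp [div_eq_mul_inv, mul_comm]
  · intro t x y w
    simp [div_eq_mul_inv, mul_comm]
  · intro t x y hY
    simp
  · intro t x y hY
    simp [hY, hc]
  · intro t x y hY
    simp [AffField.Indep]
    norm_num [hc]
  · intro t x y hY
    simp [AffField.Fits, AffField.app]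
  · intro t x y hY
    simp [AffField.Fits, AffField.app]
    constructor
    · field_simp
      ring
    · field_simp
      ring
  · intro t x y hY
    simp [hc]
  · intro t x y hY w w₁ w₂
    simp [zkForm, red8b]
    have hE0 := (Real.exp_pos (c₁⁻¹ * x)).ne'
    generalize Real.exp (c₁⁻¹ * x) = E at hE0 ⊢
    field_simp
    ring

theorem isReduction_L8b_zero (c₂ c₃ : ℝ) :
    IsReduction (L8 (-1 / 6) 0 c₂ c₃) (fun _ _ y => y + 2 * c₂ ≠ 0)
      (fun _ x _ => x) (fun _ _ y w => w / (y + 2 * c₂) ^ 2)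
      (fun _ w w₁ w₂ => 6 * w + w₁ ^ 2 + w * w₂) := by
  have hY : (coordY + const (2 * c₂)).Valid (fun _ _ y => y + 2 * c₂ ≠ 0) :=
    valid_coordY.add (valid_const _)
  refine isReduction_of (L8_eq _ 0 c₂ c₃) (fun _ _ y => -((y + 2 * c₂) ^ 4)⁻¹)
    valid_coordX (valid_const 0) ((hY.pow 2).inv fun hq => pow_ne_zero 2 hq)
    (openDom_ne (by fun_prop)) ?_ ?_ ?_ ?_ ?_ ?_ ?_ ?_ ?_
    -- The form is exhibited directly: the term 6w does not occur in the explicit family, where w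
    -- appears linearly in A₁ only with the factor z³.
    ⟨fun _ => C 6 * X, fun _ => 0, fun _ => 1, fun _ => X, by simp⟩
  · simp
  · intro t x y w
    simp [div_eq_mul_inv, mul_comm]
  · intro t x y hY
    simpa using hY
  · simp
  · intro t x y hY
    refine Or.inr (Or.inl fun h => hY ?_)
    simp at h
    linarith
  · simp [AffField.Fits, AffField.app]
  · intro t x y hY
    simp [AffField.Fits, AffField.app]
    constructor
    · norm_num
    · field_simp
      ring
  · intro t x y hY
    simpa using hY
  · intro t x y hY w w₁ w₂
    simp [zkForm]
    field_simp
    ring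

theorem inFamily_red8c (c₂ : ℝ) : InFamily (red8c c₂) := by
  refine ⟨0, -6 * c₂ ^ 2, 0, 0, 0, 0, -8 * c₂ ^ 2, 0, 0, 0, -c₂ ^ 2, 0, 0, C (-c₂ ^ 2) * X ^ 2,
    -X, -X ^ 2,
    by compute_degree!, by compute_degree!, by compute_degree!, fun z w w₁ w₂ => ?_⟩
  simp only [eval_neg, eval_mul, eval_C, eval_X, eval_pow, red8c]
  ring

/-- For k₀ = -2/3 it is y that is translated, with speed c₂, while c₁ - x and u have the rates -1
and -2. -/
theorem isReduction_L8c {c₂ : ℝ} (c₁ c₃ : ℝ) (hc : c₂ ≠ 0) :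
    IsReduction (L8 (-2 / 3) c₁ c₂ c₃) (fun _ x _ => c₁ - x ≠ 0)
      (fun _ x y => (c₁ - x) * Real.exp (y / c₂))
      (fun _ x _ w => (c₁ - x) ^ 2 * w) (red8c c₂) := by
  have hX : (const c₁ + const (-1) * coordX).Valid (fun _ x _ => c₁ - x ≠ 0) :=
    (valid_const _).add ((valid_const _).mul valid_coordX)
  refine isReduction_of (L8_eq _ c₁ c₂ c₃) (fun _ x _ => (c₁ - x) ^ 2 / c₂ ^ 2)
    (hX.mul ((valid_const c₂⁻¹).mul valid_coordY).exp) (valid_const 0) (hX.pow 2)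
    (openDom_ne (by fun_prop)) ?_ ?_ ?_ ?_ ?_ ?_ ?_ ?_ ?_ (inFamily_red8c c₂).hasForm
  · intro t x y
    simp [div_eq_mul_inv, mul_comm, sub_eq_add_neg]
  · intro t x y w
    simp [sub_eq_add_neg]
  · intro t x y hX
    simpa [← sub_eq_add_neg] using hX
  · intro t x y hX
    simp
  · intro t x y hX
    refine Or.inl fun h => hX ?_
    simp at h
    linarith
  · intro t x y hX
    simp [AffField.Fits, AffField.app]
  · intro t x y hX
    simp [AffField.Fits, AffField.app]
    constructor
    · field_simp
      ring
    · ring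
  · intro t x y hX
    simp [hX, hc]
  · intro t x y hX w w₁ w₂
    simp [zkForm, red8c]
    generalize Real.exp (c₂⁻¹ * y) = E
    field_simp
    ring

theorem inFamily_red8c_zero : InFamily (fun _ w _ w₂ => 6 * w ^ 2 + w₂) := by
  refine ⟨0, 6, 0, 0, 0, 0, 0, 0, 0, 0, 0, 0, 0, 0, 0, C 1,
    by compute_degree!, by compute_degree!, by compute_degree!, fun z w w₁ w₂ => ?_⟩
  simp only [eval_zero, eval_C]
  ring

theorem isReduction_L8c_zero (c₁ c₃ : ℝ) :
    IsReduction (L8 (-2 / 3) c₁ 0 c₃) (fun _ x _ => c₁ - x ≠ 0)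
      (fun _ _ y => y) (fun _ x _ w => (c₁ - x) ^ 2 * w)
      (fun _ w _ w₂ => 6 * w ^ 2 + w₂) := by
  have hX : (const c₁ + const (-1) * coordX).Valid (fun _ x _ => c₁ - x ≠ 0) :=
    (valid_const _).add ((valid_const _).mul valid_coordX)
  refine isReduction_of (L8_eq _ c₁ 0 c₃) (fun _ x _ => -(c₁ - x) ^ 2)
    valid_coordY (valid_const 0) (hX.pow 2)
    (openDom_ne (by fun_prop)) ?_ ?_ ?_ ?_ ?_ ?_ ?_ ?_ ?_ inFamily_red8c_zero.hasForm
  · simp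
  · intro t x y w
    simp [sub_eq_add_neg]
  · intro t x y hX
    simpa [← sub_eq_add_neg] using hX
  · simp
  · intro t x y hX
    refine Or.inl fun h => hX ?_
    simp at h
    linarith
  · simp [AffField.Fits, AffField.app]
  · intro t x y hX
    simp [AffField.Fits, AffField.app]
    constructor
    · norm_num
    · ring
  · intro t x y hX
    simp [hX]
  · intro t x y hX w w₁ w₂
    simp [zkForm]
    ring

/-! ### The tenth algebra -/

theorem L10_eq (k₀ c₃ : ℝ) : L10 k₀ c₃ = Submodule.span ℝ
    {AffField.toVField ⟨fun _ _ _ => 0, fun _ _ _ => 1, fun _ _ _ => 0, fun _ _ _ => 0,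
      fun _ _ _ => 0⟩,
    AffField.toVField ⟨fun t _ _ => c₃ + (3 - 6 * k₀) * t, fun _ x _ => x,
      fun _ _ y => (2 - 3 * k₀) * y, fun _ _ _ => 6 * k₀ - 2, fun _ _ _ => 0⟩} := by
  rw [L10, genX_const, genZ_affine (3 - 6 * k₀) c₃ fun _ => rfl]
  refine span_pair_congr ?_ ?_ <;> funext t x y u <;> simp [v0, AffField.toVField]
  refine ⟨?_, ?_, ?_, ?_⟩ <;> ring

theorem inFamily_red10 (k₀ : ℝ) : InFamily (red10 k₀) := by
  refine ⟨0, 0, 0, 0, 0, 0, 0, 0, 0, 0, 0, 0, 0, 0, C (-5 + 9 * k₀), C (3 * (-1 + 2 * k₀)) * X,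
    by compute_degree!, by compute_degree!, by compute_degree!, fun z w w₁ w₂ => ?_⟩
  simp only [eval_zero, eval_mul, eval_C, eval_X, red10]
  ring

/-- With T = c₃ + (3 - 6k₀)t, the rates of T, y, u are 3 - 6k₀, 2 - 3k₀, 6k₀ - 2. As u does not
depend on x, the equation is again u_yy = 0. -/
theorem isReduction_L10 {k₀ r s : ℝ} (c₃ : ℝ) (h1 : k₀ ≠ 1 / 2) (h2 : k₀ ≠ 2 / 3)
    (hr : r = (3 - 6 * k₀) / (2 - 3 * k₀)) (hs : s = (6 * k₀ - 2) / (3 - 6 * k₀)) :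
    IsReduction (L10 k₀ c₃) (fun t _ y => c₃ + (3 - 6 * k₀) * t ≠ 0 ∧ y ≠ 0)
      (fun t _ y => |c₃ + (3 - 6 * k₀) * t| / |y| ^ r)
      (fun t _ _ w => |c₃ + (3 - 6 * k₀) * t| ^ s * w) (red10 k₀) := by
  have h1' : 3 - 6 * k₀ ≠ 0 := fun h => h1 (by linarith)
  have h2' : 2 - 3 * k₀ ≠ 0 := fun h => h2 (by linarith)
  have hr' : r * (2 - 3 * k₀) = 3 - 6 * k₀ := by rw [hr, div_mul_cancel₀ _ h2']
  have hs' : s * (3 - 6 * k₀) = 6 * k₀ - 2 := by rw [hs, div_mul_cancel₀ _ h1']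
  have hr0 : r ≠ 0 := by
    rintro rfl
    exact h1' (by linarith)
  have hT : (const c₃ + const (3 - 6 * k₀) * coordT).Valid
      (fun t _ y => c₃ + (3 - 6 * k₀) * t ≠ 0 ∧ y ≠ 0) :=
    (valid_const _).add ((valid_const _).mul valid_coordT)
  refine isReduction_of (L10_eq k₀ c₃)
    (fun t _ y => |c₃ + (3 - 6 * k₀) * t| ^ s * r * (|c₃ + (3 - 6 * k₀) * t| * |y| ^ (-r))
      / (y ^ 2 * (2 - 3 * k₀)))
    ((hT.absPow 1 fun hq => hq.1).mul (valid_coordY.absPow (-r) fun hq => hq.2)) (valid_const 0)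
    (hT.absPow s fun hq => hq.1)
    (.and (openDom_ne (by fun_prop)) (openDom_ne (by fun_prop))) ?_ ?_ ?_ ?_ ?_ ?_ ?_ ?_ ?_
    (inFamily_red10 k₀).hasForm
  · intro t x y
    simp [div_eq_mul_inv, Real.rpow_neg]
  · intro t x y w
    simp
  · rintro t x y ⟨hT, hy⟩
    exact (Real.rpow_pos_of_pos (abs_pos.2 hT) _).ne'
  · rintro t x y ⟨hT, hy⟩
    refine Or.inl ?_
    simp [hT, h1', (Real.rpow_pos_of_pos (abs_pos.2 hy) _).ne']
  · rintro t x y ⟨hT, hy⟩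
    refine Or.inl fun h => hT ?_
    simp at h
    linarith
  · rintro t x y ⟨hT, hy⟩
    simp [AffField.Fits, AffField.app]
  · rintro t x y ⟨hT, hy⟩
    simp [AffField.Fits, AffField.app]
    constructor
    · generalize |y| ^ (-r) = Q
      generalize c₃ + (3 - 6 * k₀) * t = T at hT ⊢
      field_simp
      linear_combination -(|T| * Q) * hr'
    · generalize |c₃ + (3 - 6 * k₀) * t| ^ s = P
      generalize c₃ + (3 - 6 * k₀) * t = T at hT ⊢
      field_simp
      linear_combination P * hs'
  · rintro t x y ⟨hT, hy⟩
    simp [hT, hy, hr0, h2', (Real.rpow_pos_of_pos (abs_pos.2 hT) _).ne',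
      (Real.rpow_pos_of_pos (abs_pos.2 hy) _).ne']
  · rintro t x y ⟨hT, hy⟩ w w₁ w₂
    simp [zkForm, red10]
    generalize |y| ^ (-r) = Q
    generalize |c₃ + (3 - 6 * k₀) * t| ^ s = P
    generalize |c₃ + (3 - 6 * k₀) * t| = T
    -- Both coefficients of the reduced equation are multiples of 2 - 3k₀ with factors in r, which
    -- is how they arise from differentiating |y| ^ (-r) twice.
    have e1 : -5 + 9 * k₀ = -((r + 1) * (2 - 3 * k₀)) := by linear_combination hr'
    have e2 : 3 * (-1 + 2 * k₀) = -(r * (2 - 3 * k₀)) := by linear_combination hr'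
    have e3 : 3 * (T * Q) * (-1 + 2 * k₀) = -(r * (2 - 3 * k₀)) * (T * Q) := by rw [← e2]; ring
    rw [e1, e3]
    generalize 2 - 3 * k₀ = d at h2' ⊢
    field_simp
    ring

theorem isReduction_L10_two_thirds (c₃ : ℝ) :
    IsReduction (L10 (2 / 3) c₃) (fun t _ _ => c₃ - t ≠ 0)
      (fun _ _ y => y) (fun t _ _ w => w / (c₃ - t) ^ 2) redLin := by
  have hT : (const c₃ + const (-1) * coordT).Valid (fun t _ _ => c₃ - t ≠ 0) :=
    (valid_const _).add ((valid_const _).mul valid_coordT)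
  have hT0 : ∀ {t : ℝ}, c₃ - t ≠ 0 → c₃ + -1 * t ≠ 0 := fun h => by
    rwa [neg_one_mul, ← sub_eq_add_neg]
  refine isReduction_of (L10_eq _ c₃) (fun t _ _ => -((c₃ - t) ^ 2)⁻¹) valid_coordY
    (valid_const 0) ((hT.pow 2).inv fun hq => pow_ne_zero 2 (hT0 hq)) (openDom_ne (by fun_prop))
    ?_ ?_ ?_ ?_ ?_ ?_ ?_ ?_ ?_ inFamily_redLin.hasForm
  · simp
  · intro t x y w
    simp [div_eq_mul_inv, mul_comm, sub_eq_add_neg]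
  · intro t x y hT
    exact inv_ne_zero (pow_ne_zero 2 (hT0 hT))
  · simp
  · intro t x y hT
    refine Or.inl fun h => hT ?_
    simp at h
    linarith
  · simp [AffField.Fits, AffField.app]
  · intro t x y hT
    simp [AffField.Fits, AffField.app, ← sub_eq_add_neg]
    constructor
    · norm_num
    · field_simp
      ring
  · intro t x y hT
    simpa using hT
  · intro t x y hT w w₁ w₂
    simp [zkForm, redLin, sub_eq_add_neg]

/-- For k₀ = 1/2 the generator translates t with speed c₃, while y and u have the rates 1/2 and 1.
-/
theorem isReduction_L10_half {c₃ : ℝ} (hc : c₃ ≠ 0) :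
    IsReduction (L10 (1 / 2) c₃) (fun _ _ _ => True)
      (fun t _ y => Real.exp (-t / (2 * c₃)) * y)
      (fun t _ _ w => Real.exp (t / c₃) * w) redLin := by
  refine isReduction_of (L10_eq _ c₃)
    (fun t _ _ => -(Real.exp (c₃⁻¹ * t) * Real.exp (-(2 * c₃)⁻¹ * t) ^ 2))
    (((valid_const (-(2 * c₃)⁻¹)).mul valid_coordT).exp.mul valid_coordY) (valid_const 0)
    ((valid_const c₃⁻¹).mul valid_coordT).exp openDom_true
    ?_ ?_ ?_ ?_ ?_ ?_ ?_ ?_ ?_ inFamily_redLin.hasForm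
  · intro t x y
    simp only [Jet.exp, mul_f, comp_f, const_f, coordT_f, coordY_f]
    congr 2
    ring
  · intro t x y w
    simp only [Jet.exp, mul_f, comp_f, const_f, coordT_f, zero_add]
    congr 2
    ring
  · intro t x y _
    exact (Real.exp_pos _).ne'
  · intro t x y _
    simp
  · intro t x y _
    refine Or.inl fun h => hc ?_
    simp at h
    norm_num at h
    exact h
  · simp [AffField.Fits, AffField.app]
  · intro t x y hT
    simp [AffField.Fits, AffField.app]
    constructor
    · field_simp
      ring
    · field_simp
      ring
  · intro t x y _
    simp
  · intro t x y _ w w₁ w₂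
    simp [zkForm, redLin]
    ring

/-! ### The twelfth algebra -/

theorem L12_eq (k₀ c₂ c₃ : ℝ) : L12 k₀ c₂ c₃ = Submodule.span ℝ
    {AffField.toVField ⟨fun _ _ _ => 0, fun _ _ _ => 0, fun _ _ _ => 1, fun _ _ _ => 0,
      fun _ _ _ => 0⟩,
    AffField.toVField ⟨fun t _ _ => (3 * (1 - k₀) * t + 2 * c₃) / 2,
      fun _ x _ => (1 + 3 * k₀) / 2 * x, fun _ _ y => y + c₂, fun _ _ _ => 3 * k₀ - 1,
      fun _ _ _ => 0⟩} := by
  rw [L12, genY_const, genY_const, genZ_affine (3 / 2 * (1 - k₀)) c₃ fun _ => rfl]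
  refine span_pair_congr ?_ ?_ <;> funext t x y u <;> simp [v0, AffField.toVField]
  refine ⟨?_, ?_, ?_, ?_⟩ <;> ring

theorem inFamily_red12 (k₀ r s : ℝ) : InFamily (red12 k₀ r s) := by
  refine ⟨r, 0, 0, 0, 0, -1 - s, 0, 0, -s, -s, 0, 0, 0, 0,
    C (3 * (1 + r) * (k₀ - 1)), C (3 * (k₀ - 1)) * X,
    by compute_degree!, by compute_degree!, by compute_degree!, fun z w w₁ w₂ => ?_⟩
  simp only [eval_zero, eval_mul, eval_C, eval_X, red12, add_comm _ r]
  ring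

/-- With T = 3(1 - k₀)t + 2c₃, the rates of T, x, u are 3(1 - k₀)/2, (1 + 3k₀)/2, 3k₀ - 1.
Reflecting T or x reverses the sign of u_xt but not of the quadratic term (u u_x)_x; the locally
constant factor sgn(Tx) compensates for this, so that one equation serves all four quadrants. -/
theorem isReduction_L12 {k₀ r s : ℝ} (c₂ c₃ : ℝ) (h1 : k₀ ≠ 1) (h2 : k₀ ≠ -1 / 3)
    (hs : s = 3 * (1 - k₀) / (1 + 3 * k₀)) (hr : r = 2 * (3 * k₀ - 1) / (3 * (1 - k₀))) :
    IsReduction (L12 k₀ c₂ c₃) (fun t x _ => 3 * (1 - k₀) * t + 2 * c₃ ≠ 0 ∧ x ≠ 0)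
      (fun t x _ => |3 * (1 - k₀) * t + 2 * c₃| / |x| ^ s)
      (fun t x _ w => Real.sign ((3 * (1 - k₀) * t + 2 * c₃) * x)
        * |3 * (1 - k₀) * t + 2 * c₃| ^ r * w) (red12 k₀ r s) := by
  have h1' : 3 * (1 - k₀) ≠ 0 := fun h => h1 (by linarith)
  have h2' : 1 + 3 * k₀ ≠ 0 := fun h => h2 (by linarith)
  have hs' : s * (1 + 3 * k₀) = 3 * (1 - k₀) := by rw [hs, div_mul_cancel₀ _ h2']
  have hr' : r * (3 * (1 - k₀)) = 2 * (3 * k₀ - 1) := by rw [hr, div_mul_cancel₀ _ h1']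
  have hs0 : s ≠ 0 := by
    rintro rfl
    exact h1' (by linarith)
  -- Hence z ^ (1 + r) = |T| ^ (1 + r) / |x|, which removes the real power of z from the reduced
  -- equation.
  have hsr : s * (1 + r) = 1 := mul_left_cancel₀ h2' (by linear_combination (1 + r) * hs' + hr')
  have hT : (const (3 * (1 - k₀)) * coordT + const (2 * c₃)).Valid
      (fun t x _ => 3 * (1 - k₀) * t + 2 * c₃ ≠ 0 ∧ x ≠ 0) :=
    ((valid_const _).mul valid_coordT).add (valid_const _)
  refine isReduction_of (L12_eq k₀ c₂ c₃)
    (fun t x _ => Real.sign ((3 * (1 - k₀) * t + 2 * c₃) * x)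
      * |3 * (1 - k₀) * t + 2 * c₃| ^ r * s * (|3 * (1 - k₀) * t + 2 * c₃| * |x| ^ (-s))
      / (x * (3 * (1 - k₀) * t + 2 * c₃)))
    ((hT.absPow 1 fun hq => hq.1).mul (valid_coordX.absPow (-s) fun hq => hq.2)) (valid_const 0)
    (((hT.mul valid_coordX).sign fun hq => mul_ne_zero hq.1 hq.2).mul
      (hT.absPow r fun hq => hq.1))
    (.and (openDom_ne (by fun_prop)) (openDom_ne (by fun_prop))) ?_ ?_ ?_ ?_ ?_ ?_ ?_ ?_ ?_
    (inFamily_red12 k₀ r s).hasForm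
  · intro t x y
    simp [div_eq_mul_inv, Real.rpow_neg]
  · intro t x y w
    simp
  · rintro t x y ⟨hT, hx⟩
    exact mul_ne_zero (Real.sign_eq_zero_iff.not.2 (mul_ne_zero hT hx))
      (Real.rpow_pos_of_pos (abs_pos.2 hT) _).ne'
  · rintro t x y ⟨hT, hx⟩
    refine Or.inl ?_
    simp [hT, sub_ne_zero.2 h1.symm, (Real.rpow_pos_of_pos (abs_pos.2 hx) _).ne']
  · rintro t x y ⟨hT, hx⟩
    refine Or.inr (Or.inl fun h => hT ?_)
    simp at h
    linarith
  · rintro t x y ⟨hT, hx⟩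
    simp [AffField.Fits, AffField.app]
  · rintro t x y ⟨hT, hx⟩
    simp [AffField.Fits, AffField.app]
    constructor
    · generalize |x| ^ (-s) = Q
      generalize 3 * (1 - k₀) * t + 2 * c₃ = T at hT ⊢
      field_simp
      linear_combination -(|T| * Q) * hs'
    · generalize |3 * (1 - k₀) * t + 2 * c₃| ^ r = P
      generalize 3 * (1 - k₀) * t + 2 * c₃ = T at hT ⊢
      field_simp
      linear_combination P * hr'
  · rintro t x y ⟨hT, hx⟩
    simp [hT, hx, hs0, Real.sign_eq_zero_iff, (Real.rpow_pos_of_pos (abs_pos.2 hT) _).ne',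
      (Real.rpow_pos_of_pos (abs_pos.2 hx) _).ne']
  · rintro t x y ⟨hT, hx⟩ w w₁ w₂
    simp [zkForm, red12]
    have hQ : 0 < |x| ^ (-s) := Real.rpow_pos_of_pos (abs_pos.2 hx) _
    have hz0 : 0 < |3 * (1 - k₀) * t + 2 * c₃| * |x| ^ (-s) := mul_pos (abs_pos.2 hT) hQ
    have hz : (|3 * (1 - k₀) * t + 2 * c₃| * |x| ^ (-s)) ^ (1 + r) =
        |3 * (1 - k₀) * t + 2 * c₃| * |3 * (1 - k₀) * t + 2 * c₃| ^ r * |x|⁻¹ := by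
      rw [Real.mul_rpow (abs_nonneg _) hQ.le, ← Real.rpow_mul (abs_nonneg _),
        Real.rpow_add (abs_pos.2 hT), Real.rpow_one, neg_mul, hsr, Real.rpow_neg_one]
    have hz2 := Real.rpow_add hz0 1 (1 + r)
    rw [hz, ← add_assoc, one_add_one_eq_two, Real.rpow_one] at hz2
    rw [hz, hz2]
    have hQ' := hQ.ne'
    have hP : |3 * (1 - k₀) * t + 2 * c₃| ^ r ≠ 0 := (Real.rpow_pos_of_pos (abs_pos.2 hT) _).ne'
    generalize |3 * (1 - k₀) * t + 2 * c₃| ^ r = P at hP ⊢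
    generalize |x| ^ (-s) = Q at hQ' ⊢
    clear hz hz2 hz0 hQ
    generalize 3 * (1 - k₀) * t + 2 * c₃ = T at hT ⊢
    rcases lt_or_gt_of_ne hT with h | h <;> rcases lt_or_gt_of_ne hx with h' | h'
    · rw [abs_of_neg h, abs_of_neg h', Real.sign_of_pos (mul_pos_of_neg_of_neg h h')]
      field_simp
      ring
    · rw [abs_of_neg h, abs_of_pos h', Real.sign_of_neg (mul_neg_of_neg_of_pos h h')]
      field_simp
      ring
    · rw [abs_of_pos h, abs_of_neg h', Real.sign_of_neg (mul_neg_of_pos_of_neg h h')]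
      field_simp
      ring
    · rw [abs_of_pos h, abs_of_pos h', Real.sign_of_pos (mul_pos h h')]
      field_simp
      ring

theorem inFamily_red12b (c₃ : ℝ) : InFamily (red12b c₃) := by
  refine ⟨0, 0, 0, 0, 0, 0, 2 * c₃, 0, 0, 0, c₃, 0, 0, C c₃ * X ^ 2, C 4, C 2 * X,
    by compute_degree!, by compute_degree!, by compute_degree!, fun z w w₁ w₂ => ?_⟩
  simp only [eval_mul, eval_C, eval_X, eval_pow, red12b]
  ring

theorem isReduction_L12_one (c₂ : ℝ) {c₃ : ℝ} (hc : c₃ ≠ 0) :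
    IsReduction (L12 1 c₂ c₃) (fun _ x _ => x ≠ 0)
      (fun t x _ => Real.exp (2 * t / c₃) / x)
      (fun t _ _ w => Real.exp (2 * t / c₃) * w) (red12b c₃) := by
  have hE : (const (2 / c₃) * coordT).exp.Valid (fun _ x _ => x ≠ 0) :=
    ((valid_const _).mul valid_coordT).exp
  refine isReduction_of (L12_eq _ c₂ c₃)
    (fun t x _ => -((Real.exp (2 / c₃ * t) * x⁻¹) ^ 2 / c₃))
    (hE.mul (valid_coordX.inv fun hq => hq)) (valid_const 0) hE
    (openDom_ne (by fun_prop)) ?_ ?_ ?_ ?_ ?_ ?_ ?_ ?_ ?_ (inFamily_red12b c₃).hasForm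
  · intro t x y
    simp [div_eq_mul_inv, mul_right_comm]
  · intro t x y w
    simp [div_eq_mul_inv, mul_right_comm]
  · intro t x y hx
    simp
  · intro t x y hx
    simp [hx, hc]
  · intro t x y hx
    simp [AffField.Indep, hc]
  · intro t x y hx
    simp [AffField.Fits, AffField.app]
  · intro t x y hx
    simp [AffField.Fits, AffField.app]
    constructor
    · field_simp
      ring
    · field_simp
      norm_num
  · intro t x y hx
    simp [hc, hx]
  · intro t x y hx w w₁ w₂
    simp [zkForm, red12b]
    generalize Real.exp (2 / c₃ * t) = E
    field_simp
    ring

theorem inFamily_red12c : InFamily red12c := by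
  refine ⟨0, 0, 0, 0, 0, 0, 0, 0, 0, 0, 0, 0, 1, C 1, C 2, 0,
    by compute_degree!, by compute_degree!, by compute_degree!, fun z w w₁ w₂ => ?_⟩
  simp only [eval_zero, eval_C, red12c]
  ring

theorem isReduction_L12_neg_third (c₂ c₃ : ℝ) :
    IsReduction (L12 (-1 / 3) c₂ c₃) (fun t _ _ => c₃ + 2 * t ≠ 0)
      (fun _ x _ => x) (fun t _ _ w => w / (c₃ + 2 * t)) red12c := by
  have hT : (const c₃ + const 2 * coordT).Valid (fun t _ _ => c₃ + 2 * t ≠ 0) :=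
    (valid_const _).add ((valid_const _).mul valid_coordT)
  refine isReduction_of (L12_eq _ c₂ c₃) (fun t _ _ => -((c₃ + 2 * t) ^ 2)⁻¹)
    valid_coordX (valid_const 0) (hT.inv fun hq => hq)
    (openDom_ne (by fun_prop)) ?_ ?_ ?_ ?_ ?_ ?_ ?_ ?_ ?_ inFamily_red12c.hasForm
  · simp
  · intro t x y w
    simp [div_eq_mul_inv, mul_comm]
  · intro t x y hT
    simpa using hT
  · simp
  · intro t x y hT
    refine Or.inr (Or.inl fun h => hT ?_)
    simp at h
    linarith
  · simp [AffField.Fits, AffField.app]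
  · intro t x y hT
    have h3 : (3 * (1 - -1 / 3) * t + 2 * c₃) / 2 = c₃ + 2 * t := by ring
    simp only [AffField.Fits, AffField.app, h3]
    simp
    constructor
    · norm_num
    · field_simp
      ring
  · intro t x y hT
    simpa using hT
  · intro t x y hT w w₁ w₂
    simp [zkForm, red12c]
    field_simp
    ring

/-! ### The second algebra -/

theorem deriv_mul_exp (c k : ℝ) :
    deriv (fun t => c * Real.exp (k * t)) = fun t => c * k * Real.exp (k * t) := by
  funext t
  have h := (((hasDerivAt_id t).const_mul k).exp.const_mul c).deriv
  simp only [id] at h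
  rw [h]
  ring

theorem L2_eq (k₀ k₁ c₁ c₂ c₃ : ℝ) : L2 k₀ k₁ c₁ c₂ c₃ = Submodule.span ℝ
    {AffField.toVField ⟨fun _ _ _ => 1, fun _ x _ => 2 * k₁ * x, fun _ _ y => k₁ * y,
      fun _ _ _ => 2 * k₁, fun _ _ _ => 0⟩,
    AffField.toVField ⟨fun _ _ _ => c₃,
      fun t x y => 2 * k₀ * x + c₁ * Real.exp (k₁ * t) ^ 2
        + 1 / 2 * y * (c₂ * k₁ * Real.exp (k₁ * t)),
      fun t _ y => k₀ * y + c₂ * Real.exp (k₁ * t), fun _ _ _ => 2 * k₀,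
      fun t _ y => -(2 * c₁ * k₁ * Real.exp (k₁ * t) ^ 2)
        - 1 / 2 * y * (c₂ * k₁ ^ 2 * Real.exp (k₁ * t))⟩} := by
  rw [L2, genZ_const, genZ_const]
  -- Writing e^{2k₁t} as a square leaves a single exponential in all formulas.
  have hE : ∀ t, Real.exp (2 * k₁ * t) = Real.exp (k₁ * t) ^ 2 := fun t => by
    rw [← Real.exp_nat_mul]
    congr 1
    push_cast
    ring
  have hX : genX (fun t => c₁ * Real.exp (2 * k₁ * t)) =
      fun t _ _ _ => (0, c₁ * Real.exp (k₁ * t) ^ 2, 0,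
        -(c₁ * (2 * k₁) * Real.exp (k₁ * t) ^ 2)) := by
    funext t x y u
    simp only [genX, deriv_mul_exp]
    simp only [hE]
  have hY : genY (fun t => c₂ * Real.exp (k₁ * t)) =
      fun t _ y _ => (0, 1 / 2 * y * (c₂ * k₁ * Real.exp (k₁ * t)), c₂ * Real.exp (k₁ * t),
        -(1 / 2 * y * (c₂ * k₁ * k₁ * Real.exp (k₁ * t)))) := by
    funext t x y u
    simp only [genY, deriv_mul_exp]
  rw [hX, hY]
  refine span_pair_congr ?_ ?_ <;> funext t x y u <;> simp [v0, AffField.toVField]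
  · exact ⟨by ring, by ring⟩
  · exact ⟨by ring, by ring⟩

theorem inFamily_red2 (ε κ k₁ c₁ c₂ : ℝ) : InFamily (red2 ε κ k₁ c₁ c₂) := by
  refine ⟨0, 0, 0, -8 * κ ^ 2, 2 * k₁ * (4 * c₁ * κ + c₂ ^ 2 * k₁), 0, 0, c₂ ^ 2, 0, 0, 0,
    -c₂ ^ 2, 0, C (-c₂ ^ 2) * X,
    C (c₁ ^ 2) + C (8 * κ ^ 2) * X ^ 4 + C (3 * ε * (c₂ ^ 2 * k₁ + 2 * c₁ * κ)) * X ^ 2,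
    C (-c₁ ^ 2) * X + C (-4 * κ ^ 2) * X ^ 5
      + C (-2 * ε * (2 * c₁ * κ + c₂ ^ 2 * k₁)) * X ^ 3,
    by compute_degree!, by compute_degree!, by compute_degree!, fun z w w₁ w₂ => ?_⟩
  simp only [eval_add, eval_mul, eval_C, eval_X, eval_pow, red2]
  ring

/-- The horizontal parts multiply `den2` by m and `num2` by 2m, with m = k₁ for the first generator
and m = k₀ for the second. So √|num2| / `den2` is invariant, and `den2`² solves the homogeneous
equations; the term without w in `U2` is a particular solution. -/
theorem isReduction_L2 {k₀ k₁ c₁ c₂ c₃ κ ε : ℝ} (hκ : κ = k₀ - c₃ * k₁) (hc : c₂ ≠ 0)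
    (hε : ε = 1 ∨ ε = -1) :
    IsReduction (L2 k₀ k₁ c₁ c₂ c₃)
      (fun t x y => den2 κ k₁ c₂ t y ≠ 0 ∧ 0 < ε * (-num2 κ k₁ c₁ c₂ t x y))
      (fun t x y => Real.sqrt (ε * (-num2 κ k₁ c₁ c₂ t x y)) / (2 * den2 κ k₁ c₂ t y))
      (U2 κ k₁ c₁ c₂) (red2 ε κ k₁ c₁ c₂) := by
  set Dom : ℝ → ℝ → ℝ → Prop :=
    fun t x y => den2 κ k₁ c₂ t y ≠ 0 ∧ 0 < ε * (-num2 κ k₁ c₁ c₂ t x y) with hDom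
  set E : Jet := (const k₁ * coordT).exp with hEdef
  have hE : E.Valid Dom := ((valid_const _).mul valid_coordT).exp
  set Dn : Jet := const c₂ * E + const κ * coordY with hDndef
  have hDn : Dn.Valid Dom := ((valid_const _).mul hE).add ((valid_const _).mul valid_coordY)
  set N : Jet := const (-ε) * (const (4 * c₁ * c₂) * E * coordY + const (2 * c₁ * κ) * coordY.pow 2
    + const (c₂ ^ 2) * (const (-4) * coordX + const k₁ * coordY.pow 2)) with hNdef
  have hN : N.Valid Dom := (valid_const _).mul
    (((((valid_const _).mul hE).mul valid_coordY).add ((valid_const _).mul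
      (valid_coordY.pow 2))).add
      ((valid_const _).mul (((valid_const _).mul valid_coordX).add
        ((valid_const _).mul (valid_coordY.pow 2)))))
  have hDnf : ∀ t x y, Dn.f t x y = den2 κ k₁ c₂ t y := fun t x y => by
    simp [hDndef, hEdef, den2, mul_comm]
  have hNf : ∀ t x y, N.f t x y = ε * (-num2 κ k₁ c₁ c₂ t x y) := fun t x y => by
    simp [hNdef, hEdef, num2, mul_comm t]
    ring
  have hD0 : ∀ {t x y}, Dom t x y → Dn.f t x y ≠ 0 := fun hq => (hDnf _ _ _).trans_ne hq.1
  have hN0 : ∀ {t x y}, Dom t x y → 0 < N.f t x y := fun hq => hq.2.trans_eq (hNf _ _ _).symm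
  have ha : (const (-k₁ / (4 * c₂ ^ 2)) * coordY * (const (c₂ ^ 2 * k₁) * coordY
      + const (4 * c₁) * (const (2 * c₂) * E + const κ * coordY))).Valid Dom :=
    ((valid_const _).mul valid_coordY).mul (((valid_const _).mul valid_coordY).add
      ((valid_const _).mul (((valid_const _).mul hE).add ((valid_const _).mul valid_coordY))))
  have hDt : ∀ t x y, Dn.ft t x y = c₂ * k₁ * Real.exp (k₁ * t) := fun t x y => by
    simp [hDndef, hEdef]
    ring
  have hDx : ∀ t x y, Dn.fx t x y = 0 := fun t x y => by simp [hDndef, hEdef]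
  have hDy : ∀ t x y, Dn.fy t x y = κ := fun t x y => by simp [hDndef, hEdef]
  have hDxx : ∀ t x y, Dn.fxx t x y = 0 := fun t x y => by simp [hDndef, hEdef]
  have hDxt : ∀ t x y, Dn.fxt t x y = 0 := fun t x y => by simp [hDndef, hEdef]
  have hDyy : ∀ t x y, Dn.fyy t x y = 0 := fun t x y => by simp [hDndef, hEdef]
  have hNt : ∀ t x y, N.ft t x y = -ε * (4 * c₁ * c₂ * k₁ * Real.exp (k₁ * t) * y) :=
    fun t x y => by
      simp only [hNdef, hEdef, mul_ft, add_ft, const_ft, Jet.exp, Jet.pow, comp_ft, coordT_ft,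
        coordX_ft, coordY_ft, mul_f, add_f, const_f, comp_f, coordT_f, coordX_f,
        coordY_f]
      norm_num1
      ring
  have hNx : ∀ t x y, N.fx t x y = 4 * ε * c₂ ^ 2 := fun t x y => by
    simp only [hNdef, hEdef, mul_fx, add_fx, const_fx, Jet.exp, Jet.pow, comp_fx, coordT_fx,
      coordX_fx, coordY_fx, mul_f, add_f, const_f, comp_f, coordT_f, coordX_f,
      coordY_f]
    norm_num1
    ring
  have hNy : ∀ t x y, N.fy t x y =
      -ε * (4 * c₁ * c₂ * Real.exp (k₁ * t) + 4 * c₁ * κ * y + 2 * c₂ ^ 2 * k₁ * y) :=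
    fun t x y => by
      simp only [hNdef, hEdef, mul_fy, add_fy, const_fy, Jet.exp, Jet.pow, comp_fy, coordT_fy,
        coordX_fy, coordY_fy, mul_f, add_f, const_f, comp_f, coordT_f, coordX_f,
        coordY_f]
      norm_num1
      ring
  have hNxx : ∀ t x y, N.fxx t x y = 0 := fun t x y => by simp [hNdef, hEdef]
  have hNxt : ∀ t x y, N.fxt t x y = 0 := fun t x y => by simp [hNdef, hEdef]
  have hNyy : ∀ t x y, N.fyy t x y = -ε * (4 * c₁ * κ + 2 * c₂ ^ 2 * k₁) := fun t x y => by
    simp only [hNdef, hEdef, mul_fyy, add_fyy, const_fyy, Jet.exp, Jet.pow, comp_fyy, coordT_fyy,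
      coordX_fyy, coordY_fyy, mul_f, add_f, const_f, comp_f, coordT_f, coordX_f,
      coordY_f, mul_fy, add_fy, const_fy, comp_fy, coordT_fy, coordX_fy, coordY_fy]
    norm_num1
    ring
  -- Weights 2m for N and m for the denominator cancel in √N / (2 Dn); this is used for both
  -- generators.
  have hz : ∀ {t x y : ℝ} {V : AffField} {m : ℝ}, Dom t x y →
      V.app t x y (N.ft t x y) (N.fx t x y) (N.fy t x y) = 2 * m * N.f t x y →
      V.app t x y (Dn.ft t x y) (Dn.fx t x y) (Dn.fy t x y) = m * Dn.f t x y →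
      V.app t x y ((N.sqrt * (const (1 / 2) * Dn.inv)).ft t x y)
        ((N.sqrt * (const (1 / 2) * Dn.inv)).fx t x y)
        ((N.sqrt * (const (1 / 2) * Dn.inv)).fy t x y) = 0 := by
    intro t x y V m hq h1 h2
    have h3 := (Real.sqrt_pos.2 (hN0 hq)).ne'
    have h4 := hD0 hq
    rw [← Real.sq_sqrt (hN0 hq).le] at h1
    calc _ = (2 * √(N.f t x y))⁻¹ * (1 / 2 * (Dn.f t x y)⁻¹)
            * V.app t x y (N.ft t x y) (N.fx t x y) (N.fy t x y)
          - √(N.f t x y) * (1 / 2) * (Dn.f t x y ^ 2)⁻¹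
            * V.app t x y (Dn.ft t x y) (Dn.fx t x y) (Dn.fy t x y) := by
          simp [AffField.app]
          ring
      _ = 0 := by
          rw [h1, h2]
          field_simp
          ring
  have hopen : OpenDom Dom := by
    refine .and (openDom_ne ?_) (openDom_pos ?_)
    · unfold den2
      fun_prop
    · unfold num2
      fun_prop
  refine isReduction_of (L2_eq k₀ k₁ c₁ c₂ c₃)
    (fun t x y => 2 * Dn.f t x y ^ 3 / (√(N.f t x y) ^ 3 * c₂ ^ 2))
    ((hN.sqrt hN0).mul ((valid_const (1 / 2)).mul (hDn.inv hD0))) ha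
    ((valid_const (1 / c₂ ^ 2)).mul (hDn.pow 2)) hopen ?_ ?_ ?_ ?_ ?_ ?_ ?_ ?_ ?_
    (inFamily_red2 ε κ k₁ c₁ c₂).hasForm
  · intro t x y
    simp only [Jet.sqrt, Jet.inv, mul_f, comp_f, const_f, hDnf, hNf]
    ring
  · intro t x y w
    simp [U2, hDnf, hEdef, mul_comm t]
    field_simp
  · intro t x y hq
    simpa [hc] using hD0 hq
  · intro t x y hq
    refine Or.inr (Or.inl ?_)
    have h0 := hD0 hq
    have h1 := Real.sqrt_pos.2 (hN0 hq)
    have hε0 : ε ≠ 0 := by rcases hε with rfl | rfl <;> norm_num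
    simp [hNx, hDx, hc, hε0, h0, h1.ne']
  · intro t x y hq
    -- The minor formed from the t- and y-components is exactly `den2`.
    refine Or.inr (Or.inl fun h => hD0 hq ?_)
    rw [hDnf, den2, hκ, mul_comm t]
    simp at h
    linear_combination h
  · intro t x y hq
    refine ⟨hz hq (m := k₁) ?_ ?_, ?_, ?_⟩
    · simp only [AffField.app, hNt, hNx, hNy, hNf, num2, mul_comm t]
      ring
    · simp only [AffField.app, hDt, hDx, hDy, hDnf, den2, mul_comm t]
      ring
    · simp [AffField.app, hEdef]
      field_simp
      ring
    · simp [AffField.app, hDt, hDx, hDy, hDnf, den2, mul_comm t]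
      field_simp
  · intro t x y hq
    refine ⟨hz hq (m := k₀) ?_ ?_, ?_, ?_⟩
    · simp only [AffField.app, hNt, hNx, hNy, hNf, num2, mul_comm t, hκ]
      ring
    · simp only [AffField.app, hDt, hDx, hDy, hDnf, den2, mul_comm t, hκ]
      ring
    · simp [AffField.app, hEdef, hκ]
      field_simp
      ring
    · simp [AffField.app, hDt, hDx, hDy, hDnf, den2, mul_comm t, hκ]
      field_simp
      ring
  · intro t x y hq
    have h1 := Real.sqrt_pos.2 (hN0 hq)
    have h0 := hD0 hq
    simp [hc, h0, h1.ne']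
  · intro t x y hq w w₁ w₂
    have h1 := (Real.sqrt_pos.2 (hN0 hq)).ne'
    have h0 := hD0 hq
    simp [zkForm, red2, hEdef, hDt, hDx, hDy, hDxx, hDxt, hDyy, hNt, hNx, hNy, hNxx, hNxt, hNyy]
    simp only [hDnf, den2, mul_comm t] at h0 ⊢
    generalize √(N.f t x y) = S at h1 ⊢
    generalize Real.exp (k₁ * t) = e at h0 ⊢
    clear_value Dom E Dn N
    rcases hε with rfl | rfl
    · field_simp
      ring
    · field_simp
      ring

/-- Subtracting c₃ times the first generator from the second leaves κ v₀ plus a shift in x by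
c₁e^{2k₁t}. Passing to X absorbs the shift, and the ansatz is that of the first algebra up to an
additive term. -/
theorem isInvariantForm_L2_zero {k₀ k₁ c₁ c₃ κ : ℝ} (hκ : κ = k₀ - c₃ * k₁) (hκ0 : κ ≠ 0) :
    IsInvariantForm (L2 k₀ k₁ c₁ 0 c₃)
      (fun t x y => x + c₁ * Real.exp (2 * k₁ * t) / (2 * κ) ≠ 0 ∧ y ≠ 0)
      (fun t x y => y ^ 2 / (x + c₁ * Real.exp (2 * k₁ * t) / (2 * κ)))
      (fun t x _ w => c₁ * k₁ * Real.exp (2 * k₁ * t) / κ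
        + (x + c₁ * Real.exp (2 * k₁ * t) / (2 * κ)) * w) := by
  rw [L2_eq]
  set Dom : ℝ → ℝ → ℝ → Prop :=
    fun t x y => x + c₁ * Real.exp (2 * k₁ * t) / (2 * κ) ≠ 0 ∧ y ≠ 0
  have hE : (const (2 * k₁) * coordT).exp.Valid Dom := ((valid_const _).mul valid_coordT).exp
  have hX : (coordX + const (c₁ / (2 * κ)) * (const (2 * k₁) * coordT).exp).Valid Dom :=
    valid_coordX.add ((valid_const _).mul hE)
  have hX0 : ∀ {t x y}, Dom t x y → x + c₁ / (2 * κ) * Real.exp (2 * k₁ * t) ≠ 0 := fun hq => by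
    rw [div_mul_eq_mul_div]
    exact hq.1
  have hexp : ∀ t, Real.exp (k₁ * t) ^ 2 = Real.exp (2 * k₁ * t) := fun t => by
    rw [← Real.exp_nat_mul]
    congr 1
    push_cast
    ring
  refine isInvariantForm_of ((valid_coordY.pow 2).mul (hX.inv hX0))
    ((valid_const (c₁ * k₁ / κ)).mul hE) hX
    (.and (openDom_ne (by fun_prop)) (openDom_ne (by fun_prop))) ?_ ?_ ?_ ?_ ?_ ?_ ?_
  · intro t x y
    simp
    ring
  · intro t x y w
    simp
    ring
  · intro t x y hq
    exact hX0 hq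
  · intro t x y hq
    have h0 := hX0 hq
    refine Or.inr (Or.inl ?_)
    simp [hq.2, h0]
  · intro t x y hq
    refine Or.inr (Or.inl fun h => mul_ne_zero hκ0 hq.2 ?_)
    simp at h
    rw [hκ]
    linear_combination h
  · intro t x y hq
    have h0 := hX0 hq
    simp [AffField.Fits, AffField.app]
    refine ⟨?_, ?_, ?_⟩
    · field_simp
      ring
    · ring
    · ring
  · intro t x y hq
    have h0 := hX0 hq
    obtain rfl : k₀ = κ + c₃ * k₁ := by rw [hκ]; ring
    simp [AffField.Fits, AffField.app, hexp]
    generalize Real.exp (2 * k₁ * t) = e at h0 ⊢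
    refine ⟨?_, ?_, ?_⟩
    -- With c₁ = 2κb the only remaining denominator is X = x + b e.
    · obtain ⟨b, rfl⟩ : ∃ b, c₁ = 2 * κ * b := ⟨c₁ / (2 * κ), by field_simp⟩
      rw [mul_div_cancel_left₀ _ (mul_ne_zero two_ne_zero hκ0)] at h0 ⊢
      field_simp
      ring
    · field_simp
      ring
    · field_simp
      ring

theorem reducesTo_L2_zero (k₁ c₁ κ : ℝ) : ReducesTo
    (fun t x _ => x + c₁ * Real.exp (2 * k₁ * t) / (2 * κ) ≠ 0)
    (fun t x y => y ^ 2 / (x + c₁ * Real.exp (2 * k₁ * t) / (2 * κ)))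
    (fun t x _ w => c₁ * k₁ * Real.exp (2 * k₁ * t) / κ
      + (x + c₁ * Real.exp (2 * k₁ * t) / (2 * κ)) * w) red1 := by
  set Dom : ℝ → ℝ → ℝ → Prop := fun t x y => x + c₁ * Real.exp (2 * k₁ * t) / (2 * κ) ≠ 0
  have hE : (const (2 * k₁) * coordT).exp.Valid Dom := ((valid_const _).mul valid_coordT).exp
  have hX : (coordX + const (c₁ / (2 * κ)) * (const (2 * k₁) * coordT).exp).Valid Dom :=
    valid_coordX.add ((valid_const _).mul hE)
  have hX0 : ∀ {t x y}, Dom t x y → x + c₁ / (2 * κ) * Real.exp (2 * k₁ * t) ≠ 0 := fun hq => by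
    rw [div_mul_eq_mul_div]
    exact hq
  refine reducesTo_of ((valid_coordY.pow 2).mul (hX.inv fun {_ _ y} hq => hX0 (y := y) hq))
    ((valid_const (c₁ * k₁ / κ)).mul hE) hX (fun _ _ _ => 1) (openDom_ne (by fun_prop)) ?_ ?_ ?_ ?_
  · intro t x y
    simp
    ring
  · intro t x y w
    simp
    ring
  · simp
  · intro t x y hq w w₁ w₂
    have h0 := hX0 (y := y) hq
    simp [zkForm, red1]
    -- This also holds for κ = 0, where both sides are 0 by the convention for division.
    have h3 : c₁ * k₁ / κ = 2 * k₁ * (c₁ / (2 * κ)) := by ring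
    rw [h3]
    generalize Real.exp (2 * k₁ * t) = e at h0 ⊢
    generalize c₁ / (2 * κ) = b at h0 ⊢
    field_simp
    ring

/-- Here the second generator minus c₃ times the first is c₁e^{2k₁t}(∂_x - 2k₁∂_u), which fixes u_x
= -2k₁; the first generator then supplies the scaling by exponentials of t. -/
theorem isReduction_L2_degenerate {k₀ k₁ c₁ c₃ : ℝ} (hκ : k₀ - c₃ * k₁ = 0) (hc : c₁ ≠ 0) :
    IsReduction (L2 k₀ k₁ c₁ 0 c₃) (fun _ _ _ => True)
      (fun t _ y => Real.exp (-(k₁ * t)) * y)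
      (fun t x _ w => -2 * k₁ * x + Real.exp (2 * k₁ * t) * w)
      (fun _ _ _ w₂ => w₂ + 4 * k₁ ^ 2) := by
  have hexp : ∀ t, Real.exp (k₁ * t) ^ 2 = Real.exp (2 * k₁ * t) := fun t => by
    rw [← Real.exp_nat_mul]
    congr 1
    push_cast
    ring
  have hexp' : ∀ t, Real.exp (2 * k₁ * t) * Real.exp (-k₁ * t) ^ 2 = 1 := fun t => by
    rw [← hexp, ← mul_pow, ← Real.exp_add]
    simp
  refine isReduction_of (L2_eq k₀ k₁ c₁ 0 c₃) (fun _ _ _ => -1)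
    (((valid_const (-k₁)).mul valid_coordT).exp.mul valid_coordY)
    ((valid_const (-2 * k₁)).mul valid_coordX)
    ((valid_const (2 * k₁)).mul valid_coordT).exp openDom_true
    ?_ ?_ ?_ ?_ ?_ ?_ ?_ ?_ ?_
    ⟨fun _ => C (4 * k₁ ^ 2), fun _ => 0, fun _ => 0, fun _ => 1, fun z w w₁ w₂ => by
      rw [eval_C]; simp; ring⟩
  · simp
  · simp
  · simp
  · simp
  · intro t x y _
    obtain rfl : k₀ = c₃ * k₁ := by linarith
    refine Or.inl fun h => mul_ne_zero hc (pow_ne_zero 2 (Real.exp_pos (k₁ * t)).ne') ?_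
    have h' : 1 * (2 * (c₃ * k₁) * x + c₁ * Real.exp (k₁ * t) ^ 2
        + 1 / 2 * y * (0 * k₁ * Real.exp (k₁ * t))) - 2 * k₁ * x * c₃ = 0 := h
    linear_combination h'
  · intro t x y _
    simp [AffField.Fits, AffField.app]
    refine ⟨?_, ?_, ?_⟩ <;> ring
  · intro t x y _
    obtain rfl : k₀ = c₃ * k₁ := by linarith
    simp [AffField.Fits, AffField.app]
    refine ⟨?_, ?_, ?_⟩ <;> ring
  · simp
  · intro t x y _ w w₁ w₂
    simp [zkForm]
    have := hexp' t
    simp at this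
    linear_combination (-w₂) * this

/-! ### The third algebra -/

theorem isInvariantFunNear_span_pair {V W : VField} {F : ℝ × ℝ × ℝ × ℝ → ℝ}
    {q : ℝ × ℝ × ℝ × ℝ} : IsInvariantFunNear (Submodule.span ℝ {V, W}) F q ↔
      ∀ᶠ p in 𝓝 q, fderiv ℝ F p (V p.1 p.2.1 p.2.2.1 p.2.2.2) = 0 ∧
        fderiv ℝ F p (W p.1 p.2.1 p.2.2.1 p.2.2.2) = 0 := by
  constructor
  · intro h
    exact (h V (Submodule.subset_span (by simp))).and (h W (Submodule.subset_span (by simp)))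
  · intro h Z hZ
    obtain ⟨a, b, rfl⟩ := Submodule.mem_span_pair.1 hZ
    filter_upwards [h] with p hp
    simp only [Pi.add_apply, Pi.smul_apply, map_add, map_smul, hp.1, hp.2, smul_zero, add_zero]

/-- As g' ≠ 0, the two generators span ∂_x and ∂_u at each nearby point, so invariance means that F
is constant in x and u. -/
theorem isInvariantFunNear_L3_iff {g : ℝ → ℝ} {t x y u : ℝ} (hg : ContDiffAt ℝ 2 g t)
    (hg' : deriv g t ≠ 0) {F : ℝ × ℝ × ℝ × ℝ → ℝ} (hF : ContDiffAt ℝ 1 F (t, x, y, u)) :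
    IsInvariantFunNear (L3 g) F (t, x, y, u) ↔
      ∃ Φ : ℝ → ℝ → ℝ, ∀ᶠ p in 𝓝 ((t, x, y, u) : ℝ × ℝ × ℝ × ℝ), F p = Φ p.1 p.2.2.1 := by
  have hFd : ∀ᶠ p in 𝓝 ((t, x, y, u) : ℝ × ℝ × ℝ × ℝ), DifferentiableAt ℝ F p :=
    (hF.eventually (by simp)).mono fun p hp => hp.differentiableAt (by norm_num)
  rw [L3, genX_const, isInvariantFunNear_span_pair]
  constructor
  · intro h
    have hne : ∀ᶠ p in 𝓝 ((t, x, y, u) : ℝ × ℝ × ℝ × ℝ), deriv g p.1 ≠ 0 :=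
      (continuous_fst.tendsto ((t, x, y, u) : ℝ × ℝ × ℝ × ℝ)).eventually
        ((contDiffAt_deriv (n := 1) hg).continuousAt.eventually_ne hg')
    obtain ⟨r, hr, hball⟩ := Metric.eventually_nhds_iff_ball.1 (h.and (hne.and hFd))
    -- Φ is F with x and u frozen at the base point; the displacement in x and u is decomposed along
    -- the two generators at every point of the segment.
    refine ⟨fun t y => F (t, x, y, u), ?_⟩
    filter_upwards [Metric.ball_mem_nhds _ hr] with p hp
    obtain ⟨t', x', y', u'⟩ := p
    refine eq_of_fderiv_apply_eq_zero (fun q hq => (hball q hq).2.2) (q := (t', x, y', u)) ?_ hp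
      fun s hs => ?_
    · simp only [Metric.mem_ball, Prod.dist_eq, sup_lt_iff, dist_self] at hp ⊢
      exact ⟨hp.1, hr, hp.2.2.1, hr⟩
    · obtain ⟨⟨h1, h2⟩, h3, -⟩ := hball s hs
      have e : ((t', x', y', u') - (t', x, y', u) : ℝ × ℝ × ℝ × ℝ) =
          (x' - x + (u' - u) * g s.1 / deriv g s.1) • ((0, 1, 0, 0) : ℝ × ℝ × ℝ × ℝ)
            + (-(u' - u) / deriv g s.1) • ((0, g s.1, 0, -deriv g s.1) : ℝ × ℝ × ℝ × ℝ) := by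
        simp only [Prod.mk_sub_mk, Prod.smul_mk, Prod.mk_add_mk, smul_eq_mul, Prod.mk.injEq]
        refine ⟨by ring, ?_, by ring, ?_⟩ <;> field_simp <;> ring
      rw [e, map_add, map_smul, map_smul, h1]
      simp only [genX] at h2
      rw [h2]
      simp
  · rintro ⟨Φ, h⟩
    have key : ∀ v : ℝ × ℝ × ℝ × ℝ, v.1 = 0 → v.2.2.1 = 0 →
        ∀ᶠ p in 𝓝 ((t, x, y, u) : ℝ × ℝ × ℝ × ℝ), fderiv ℝ F p v = 0 := by
      intro v hv1 hv2
      filter_upwards [h.eventually_nhds, hFd] with p hp hd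
      -- No regularity of Φ is known, so the derivative is taken along a line on which t and y, and
      -- hence Φ, are constant.
      rw [← hd.lineDeriv_eq_fderiv]
      have hc : Tendsto (fun s : ℝ => p + s • v) (𝓝 0) (𝓝 p) :=
        Continuous.tendsto' (by fun_prop) _ _ (by simp)
      have h1 : (fun s : ℝ => F (p + s • v)) =ᶠ[𝓝 0] fun _ => Φ p.1 p.2.2.1 := by
        filter_upwards [hc.eventually hp] with s hs
        rw [hs]
        simp [hv1, hv2]
      rw [lineDeriv, h1.deriv_eq, deriv_const]
    have hx := key (0, 1, 0, 0) rfl rfl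
    have hu := key (0, 0, 0, 1) rfl rfl
    filter_upwards [hx, hu] with p h1 h2
    refine ⟨h1, ?_⟩
    have e : genX g p.1 p.2.1 p.2.2.1 p.2.2.2 = g p.1 • ((0, 1, 0, 0) : ℝ × ℝ × ℝ × ℝ)
        + (-deriv g p.1) • ((0, 0, 0, 1) : ℝ × ℝ × ℝ × ℝ) := by
      simp [genX]
    rw [e, map_add, map_smul, map_smul, h1, h2]
    simp

/-- The first tangency condition is u_x = 0, the second g u_x = -g'; together they force g' = 0. -/
theorem not_invariantNear_L3 {g : ℝ → ℝ} {t x y : ℝ} (hg' : deriv g t ≠ 0)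
    (u : ℝ → ℝ → ℝ → ℝ) : ¬ InvariantNear (L3 g) u t x y := by
  rw [L3, genX_const, invariantNear_span_pair]
  intro h
  obtain ⟨h1, h2⟩ := h.self
  simp only [Tangent, genX] at h1 h2
  apply hg'
  linear_combination h2 - g t * h1

/-! ### The fourth algebra -/

theorem contDiffAt_deriv_deriv_div {h : ℝ → ℝ} {t : ℝ} (hh : ContDiffAt ℝ 4 h t) (h0 : h t ≠ 0) :
    ContDiffAt ℝ 2 (fun s => deriv (deriv h) s / (4 * h s)) t :=
  (contDiffAt_deriv (n := 2) (contDiffAt_deriv (n := 3) hh)).div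
    (contDiffAt_const.mul (hh.of_le (by norm_num))) (mul_ne_zero four_ne_zero h0)

theorem eventually_contDiffAt_and_ne {n : ℕ} {f : ℝ → ℝ} {t : ℝ} (h : ContDiffAt ℝ n f t)
    (h0 : f t ≠ 0) : ∀ᶠ s in 𝓝 t, ContDiffAt ℝ n f s ∧ f s ≠ 0 :=
  (h.eventually (by simp)).and (h.continuousAt.eventually_ne h0)

/-- The order is finite because smoothness at a point gives neighbourhoods that may shrink as the
order grows. Orders 4 for h and 3 for g suffice to make h''/(4h) and g'/g of class C². -/
theorem openDom_contDiffAt_and_ne (n : ℕ) (f : ℝ → ℝ) :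
    OpenDom (fun t _ _ => ContDiffAt ℝ n f t ∧ f t ≠ 0) :=
  fun _ x y hq => near_of_eventually_t x y (eventually_contDiffAt_and_ne hq.1 hq.2)

theorem L4_eq (h : ℝ → ℝ) : L4 h = Submodule.span ℝ
    {AffField.toVField ⟨fun _ _ _ => 0, fun _ _ _ => 1, fun _ _ _ => 0, fun _ _ _ => 0,
      fun _ _ _ => 0⟩,
    AffField.toVField ⟨fun _ _ _ => 0, fun t _ y => 1 / 2 * y * deriv h t, fun t _ _ => h t,
      fun _ _ _ => 0, fun t _ y => -(1 / 2 * y * deriv (deriv h) t)⟩} := by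
  rw [L4, genX_const]
  refine span_pair_congr ?_ ?_ <;> funext t x y u <;> simp [genY, AffField.toVField]

/-- This normalisation, unlike (w - y²)h''/(4h), still describes all invariant functions where h''
vanishes. -/
theorem isInvariantForm_L4_add (h : ℝ → ℝ) : IsInvariantForm (L4 h)
    (fun t _ _ => ContDiffAt ℝ (4 : ℕ) h t ∧ h t ≠ 0)
    (fun t _ _ => t) (fun t _ y w => w - y ^ 2 * (deriv (deriv h) t / (4 * h t))) := by
  rw [L4_eq]
  refine isInvariantForm_of valid_coordT (((valid_const (-1)).mul (valid_coordY.pow 2)).mul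
    (valid_coordT.compC2 fun hq => contDiffAt_deriv_deriv_div hq.1 hq.2)) (valid_const 1)
    (openDom_contDiffAt_and_ne 4 h) ?_ ?_ ?_ ?_ ?_ ?_ ?_
  · intro t x y
    simp
  · intro t x y w
    simp
    ring
  · intro t x y hq
    simp
  · intro t x y hq
    simp
  · intro t x y hq
    exact Or.inr (Or.inr (by simpa using hq.2))
  · intro t x y hq
    simp [AffField.Fits, AffField.app]
  · intro t x y hq
    have h0 := hq.2
    simp [AffField.Fits, AffField.app]
    field_simp
    ring

theorem reducesTo_L4_add (h : ℝ → ℝ) : ReducesTo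
    (fun t _ _ => ContDiffAt ℝ (4 : ℕ) h t ∧ h t ≠ 0)
    (fun t _ _ => t) (fun t _ y w => w - y ^ 2 * (deriv (deriv h) t / (4 * h t)))
    (fun z _ _ _ => deriv (deriv h) z) := by
  refine reducesTo_of valid_coordT (((valid_const (-1)).mul (valid_coordY.pow 2)).mul
    (valid_coordT.compC2 fun hq => contDiffAt_deriv_deriv_div hq.1 hq.2)) (valid_const 1)
    (fun t _ _ => 1 / (2 * h t)) (openDom_contDiffAt_and_ne 4 h) ?_ ?_ ?_ ?_
  · intro t x y
    simp
  · intro t x y w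
    simp
    ring
  · intro t x y hq
    simpa using hq.2
  · intro t x y hq w w₁ w₂
    have h0 := hq.2
    simp [zkForm]
    field_simp
    ring

/-- The pointwise criterion holds at all nearby points and involves t alone. -/
theorem solvesNear_L4_add {h : ℝ → ℝ} {t : ℝ} (x y : ℝ) (hh : ContDiffAt ℝ (4 : ℕ) h t)
    (h0 : h t ≠ 0) {w : ℝ → ℝ} (hw : ContDiffAt ℝ 2 w t) :
    SolvesNear (fun t _ y => w t - y ^ 2 * (deriv (deriv h) t / (4 * h t))) t x y ↔
      ∀ᶠ s in 𝓝 t, deriv (deriv h) s = 0 := by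
  have key : Near t x y fun t x y =>
      zkOp (fun t _ y => w t - y ^ 2 * (deriv (deriv h) t / (4 * h t))) t x y = 0 ↔
        deriv (deriv h) t = 0 := by
    filter_upwards [near_of_eventually_t x y (eventually_contDiffAt_and_ne hh h0),
      near_of_eventually_t x y (hw.eventually (by simp))] with p h1 h2
    exact reducesTo_L4_add h _ _ _ h1 w h2
  refine (eventually_congr key).trans ⟨fun h2 => ?_, fun h2 => ?_⟩
  · exact Near.t (P := fun t _ _ => deriv (deriv h) t = 0) h2
  · exact near_of_eventually_t x y h2

theorem L4_ansatz_eq (h w : ℝ → ℝ) (t y : ℝ) : (w t - y ^ 2) * deriv (deriv h) t / (4 * h t) =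
    w t * (deriv (deriv h) t / (4 * h t)) - y ^ 2 * (deriv (deriv h) t / (4 * h t)) := by
  ring

theorem isInvariantForm_L4 (h : ℝ → ℝ) : IsInvariantForm (L4 h)
    (fun t _ _ => ContDiffAt ℝ ∞ h t ∧ h t ≠ 0 ∧ deriv (deriv h) t ≠ 0)
    (fun t _ _ => t) (fun t _ y w => (w - y ^ 2) * deriv (deriv h) t / (4 * h t)) := by
  rintro t x y ⟨hh, h0, h2⟩ u hu
  have hh' : ContDiffAt ℝ (4 : ℕ) h t := contDiffAt_infty.1 hh 4
  have hq := contDiffAt_deriv_deriv_div hh' h0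
  have hq0 : deriv (deriv h) t / (4 * h t) ≠ 0 := div_ne_zero h2 (mul_ne_zero four_ne_zero h0)
  rw [isInvariantForm_L4_add h t x y ⟨hh', h0⟩ u hu]
  constructor
  · rintro ⟨w, hw, hu⟩
    -- The two normalisations differ by the factor h''/(4h) in w, which may be divided out because
    -- h'' ≠ 0.
    refine ⟨fun s => w s / (deriv (deriv h) s / (4 * h s)), hw.div hq hq0, ?_⟩
    filter_upwards [hu, near_of_eventually_t x y (hq.continuousAt.eventually_ne hq0)] with p h1 h2
    rw [h1, L4_ansatz_eq h fun s => w s / (deriv (deriv h) s / (4 * h s)), div_mul_cancel₀ _ h2]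
  · rintro ⟨w, hw, hu⟩
    refine ⟨fun s => w s * (deriv (deriv h) s / (4 * h s)), hw.mul hq, ?_⟩
    filter_upwards [hu] with p h1
    rw [h1, L4_ansatz_eq]

theorem reducesTo_L4 (h : ℝ → ℝ) : ReducesTo (fun t _ _ => ContDiffAt ℝ ∞ h t ∧ h t ≠ 0)
    (fun t _ _ => t) (fun t _ y w => (w - y ^ 2) * deriv (deriv h) t / (4 * h t))
    (fun z _ _ _ => deriv (deriv h) z) := by
  rintro t x y ⟨hh, h0⟩ w hw
  have hh' : ContDiffAt ℝ (4 : ℕ) h t := contDiffAt_infty.1 hh 4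
  simp only [L4_ansatz_eq h w]
  exact reducesTo_L4_add h t x y ⟨hh', h0⟩ _ (hw.mul (contDiffAt_deriv_deriv_div hh' h0))

theorem solvesNear_L4_iff {h : ℝ → ℝ} {t : ℝ} (x y : ℝ) (hh : ContDiffAt ℝ ∞ h t) (h0 : h t ≠ 0)
    {w : ℝ → ℝ} (hw : ContDiffAt ℝ 2 w t) :
    SolvesNear (fun t₁ _ y₁ => (w t₁ - y₁ ^ 2) * deriv (deriv h) t₁ / (4 * h t₁)) t x y ↔
      ∀ᶠ t₁ in 𝓝 t, deriv (deriv h) t₁ = 0 := by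
  have hh' : ContDiffAt ℝ (4 : ℕ) h t := contDiffAt_infty.1 hh 4
  simp only [L4_ansatz_eq h w]
  exact solvesNear_L4_add x y hh' h0 (hw.mul (contDiffAt_deriv_deriv_div hh' h0))

theorem invariantNear_L4_and_solvesNear_iff {h : ℝ → ℝ} {t x y : ℝ} (hh : ContDiffAt ℝ ∞ h t)
    (h0 : h t ≠ 0) {u : ℝ → ℝ → ℝ → ℝ} (hu : C2At u t x y) :
    InvariantNear (L4 h) u t x y ∧ SolvesNear u t x y ↔
      (∀ᶠ t₁ in 𝓝 t, deriv (deriv h) t₁ = 0) ∧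
        ∃ w : ℝ → ℝ, ContDiffAt ℝ 2 w t ∧ Near t x y (fun t₁ x₁ y₁ => u t₁ x₁ y₁ = w t₁) := by
  have hh' : ContDiffAt ℝ (4 : ℕ) h t := contDiffAt_infty.1 hh 4
  have key : ∀ w : ℝ → ℝ, (∀ᶠ t₁ in 𝓝 t, deriv (deriv h) t₁ = 0) →
      (Near t x y (fun t₁ x₁ y₁ =>
          u t₁ x₁ y₁ = w t₁ - y₁ ^ 2 * (deriv (deriv h) t₁ / (4 * h t₁))) ↔
        Near t x y (fun t₁ x₁ y₁ => u t₁ x₁ y₁ = w t₁)) := fun w h2 => by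
    refine eventually_congr ?_
    filter_upwards [near_of_eventually_t x y h2] with p hp
    simp [hp]
  rw [isInvariantForm_L4_add h t x y ⟨hh', h0⟩ u hu]
  constructor
  · rintro ⟨⟨w, hw, huw⟩, hs⟩
    rw [solvesNear_congr huw, solvesNear_L4_add x y hh' h0 hw] at hs
    exact ⟨hs, w, hw, (key w hs).1 huw⟩
  · rintro ⟨h2, w, hw, huw⟩
    rw [← key w h2] at huw
    exact ⟨⟨w, hw, huw⟩, (solvesNear_congr huw).2 ((solvesNear_L4_add x y hh' h0 hw).2 h2)⟩

/-! ### The sixth algebra -/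

theorem contDiffAt_logDeriv {g : ℝ → ℝ} {t : ℝ} (hg : ContDiffAt ℝ 3 g t) (h0 : g t ≠ 0) :
    ContDiffAt ℝ 2 (fun s => deriv g s / g s) t :=
  (contDiffAt_deriv (n := 2) hg).div (hg.of_le (by norm_num)) h0

theorem deriv_logDeriv' {g : ℝ → ℝ} {t : ℝ} (hg : ContDiffAt ℝ 3 g t) (h0 : g t ≠ 0) :
    deriv (fun s => deriv g s / g s) t
      = (deriv (deriv g) t * g t - deriv g t * deriv g t) / g t ^ 2 :=
  (((contDiffAt_deriv (n := 2) hg).differentiableAt (by norm_num)).hasDerivAt.div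
    (hg.differentiableAt (by norm_num)).hasDerivAt h0).deriv

theorem L6_eq (g : ℝ → ℝ) (c₂ : ℝ) : L6 g c₂ = Submodule.span ℝ
    {AffField.toVField ⟨fun _ _ _ => 0, fun _ _ _ => 0, fun _ _ _ => 1, fun _ _ _ => 0,
      fun _ _ _ => 0⟩,
    AffField.toVField ⟨fun _ _ _ => 0, fun t _ _ => g t, fun _ _ _ => c₂,
      fun _ _ _ => 0, fun t _ _ => -deriv g t⟩} := by
  rw [L6, genY_const, genY_const]
  refine span_pair_congr ?_ ?_ <;> funext t x y u <;> simp [genX, AffField.toVField]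

theorem isInvariantForm_L6_add (g : ℝ → ℝ) (c₂ : ℝ) : IsInvariantForm (L6 g c₂)
    (fun t _ _ => ContDiffAt ℝ (3 : ℕ) g t ∧ g t ≠ 0)
    (fun t _ _ => t) (fun t x _ w => w - x * (deriv g t / g t)) := by
  rw [L6_eq]
  refine isInvariantForm_of valid_coordT (((valid_const (-1)).mul valid_coordX).mul
    (valid_coordT.compC2 fun hq => contDiffAt_logDeriv hq.1 hq.2)) (valid_const 1)
    (openDom_contDiffAt_and_ne 3 g) ?_ ?_ ?_ ?_ ?_ ?_ ?_
  · intro t x y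
    simp
  · intro t x y w
    simp
    ring
  · intro t x y hq
    simp
  · intro t x y hq
    simp
  · intro t x y hq
    exact Or.inr (Or.inr (by simpa using hq.2))
  · intro t x y hq
    simp [AffField.Fits, AffField.app]
  · intro t x y hq
    have h0 := hq.2
    simp [AffField.Fits, AffField.app]
    field_simp

/-- Here u_xt = -(g'/g)' and (u u_x)_x = (g'/g)²; the squares of g' cancel and -g''/g remains. -/
theorem reducesTo_L6_add (g : ℝ → ℝ) : ReducesTo
    (fun t _ _ => ContDiffAt ℝ (3 : ℕ) g t ∧ g t ≠ 0)
    (fun t _ _ => t) (fun t x _ w => w - x * (deriv g t / g t))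
    (fun z _ _ _ => deriv (deriv g) z) := by
  refine reducesTo_of valid_coordT (((valid_const (-1)).mul valid_coordX).mul
    (valid_coordT.compC2 fun hq => contDiffAt_logDeriv hq.1 hq.2)) (valid_const 1)
    (fun t _ _ => -1 / g t) (openDom_contDiffAt_and_ne 3 g) ?_ ?_ ?_ ?_
  · intro t x y
    simp
  · intro t x y w
    simp
    ring
  · intro t x y hq
    simpa using hq.2
  · intro t x y hq w w₁ w₂
    have h0 := hq.2
    simp [zkForm, deriv_logDeriv' hq.1 hq.2]
    field_simp
    ring

theorem solvesNear_L6_add {g : ℝ → ℝ} {t : ℝ} (x y : ℝ) (hg : ContDiffAt ℝ (3 : ℕ) g t)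
    (h0 : g t ≠ 0) {w : ℝ → ℝ} (hw : ContDiffAt ℝ 2 w t) :
    SolvesNear (fun t x _ => w t - x * (deriv g t / g t)) t x y ↔
      ∀ᶠ s in 𝓝 t, deriv (deriv g) s = 0 := by
  have key : Near t x y fun t x y =>
      zkOp (fun t x _ => w t - x * (deriv g t / g t)) t x y = 0 ↔ deriv (deriv g) t = 0 := by
    filter_upwards [near_of_eventually_t x y (eventually_contDiffAt_and_ne hg h0),
      near_of_eventually_t x y (hw.eventually (by simp))] with p h1 h2
    exact reducesTo_L6_add g _ _ _ h1 w h2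
  refine (eventually_congr key).trans ⟨fun h => ?_, fun h => ?_⟩
  · exact Near.t (P := fun t _ _ => deriv (deriv g) t = 0) h
  · exact near_of_eventually_t x y h

theorem L6_ansatz_eq (g w : ℝ → ℝ) (t x : ℝ) : deriv g t * (w t - x / g t) =
    w t * deriv g t - x * (deriv g t / g t) := by
  ring

theorem isInvariantForm_L6 (g : ℝ → ℝ) (c₂ : ℝ) : IsInvariantForm (L6 g c₂)
    (fun t _ _ => ContDiffAt ℝ ∞ g t ∧ g t ≠ 0 ∧ deriv g t ≠ 0)
    (fun t _ _ => t) (fun t x _ w => deriv g t * (w - x / g t)) := by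
  rintro t x y ⟨hg, h0, h1⟩ u hu
  have hg' : ContDiffAt ℝ (3 : ℕ) g t := contDiffAt_infty.1 hg 3
  have hq := contDiffAt_deriv (n := 2) hg'
  rw [isInvariantForm_L6_add g c₂ t x y ⟨hg', h0⟩ u hu]
  constructor
  · rintro ⟨w, hw, hu⟩
    refine ⟨fun s => w s / deriv g s, hw.div hq h1, ?_⟩
    filter_upwards [hu, near_of_eventually_t x y (hq.continuousAt.eventually_ne h1)] with p h1 h2
    rw [h1, L6_ansatz_eq g fun s => w s / deriv g s, div_mul_cancel₀ _ h2]
  · rintro ⟨w, hw, hu⟩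
    refine ⟨fun s => w s * deriv g s, hw.mul hq, ?_⟩
    filter_upwards [hu] with p h1
    rw [h1, L6_ansatz_eq]

theorem reducesTo_L6 (g : ℝ → ℝ) : ReducesTo (fun t _ _ => ContDiffAt ℝ ∞ g t ∧ g t ≠ 0)
    (fun t _ _ => t) (fun t x _ w => deriv g t * (w - x / g t))
    (fun z _ _ _ => deriv (deriv g) z) := by
  rintro t x y ⟨hg, h0⟩ w hw
  have hg' : ContDiffAt ℝ (3 : ℕ) g t := contDiffAt_infty.1 hg 3
  simp only [L6_ansatz_eq g w]
  exact reducesTo_L6_add g t x y ⟨hg', h0⟩ _ (hw.mul (contDiffAt_deriv (n := 2) hg'))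

theorem eventually_eq_of_deriv_eq_zero {f : ℝ → ℝ} {t : ℝ}
    (hf : ∀ᶠ s in 𝓝 t, DifferentiableAt ℝ f s) (h : ∀ᶠ s in 𝓝 t, deriv f s = 0) :
    ∀ᶠ s in 𝓝 t, f s = f t := by
  obtain ⟨r, hr, hball⟩ := Metric.eventually_nhds_iff_ball.1 (h.and hf)
  filter_upwards [Metric.ball_mem_nhds _ hr] with s hs
  refine eq_of_fderiv_apply_eq_zero (fun q hq => (hball q hq).2) (Metric.mem_ball_self hr) hs
    fun q hq => ?_
  rw [fderiv_eq_smul_deriv, (hball q hq).1, smul_zero]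

theorem eventually_deriv_eq_of_affine {g : ℝ → ℝ} {t α β : ℝ}
    (h : ∀ᶠ s in 𝓝 t, g s = α * s + β) : ∀ᶠ s in 𝓝 t, deriv g s = α := by
  filter_upwards [h.eventually_nhds] with s hs
  rw [EventuallyEq.deriv_eq hs]
  simp

theorem eventually_deriv_deriv_eq_zero_iff {g : ℝ → ℝ} {t : ℝ} (hg : ContDiffAt ℝ 2 g t) :
    (∀ᶠ s in 𝓝 t, deriv (deriv g) s = 0) ↔ ∃ α β : ℝ, ∀ᶠ s in 𝓝 t, g s = α * s + β := by
  constructor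
  · intro h
    have hev := hg.eventually (by simp)
    have h1 := eventually_eq_of_deriv_eq_zero (hev.mono fun s hs =>
      (contDiffAt_deriv (n := 1) hs).differentiableAt (by norm_num)) h
    have hd := hev.mono fun s hs => hs.differentiableAt (by norm_num)
    refine ⟨deriv g t, g t - deriv g t * t, ?_⟩
    have h2 := eventually_eq_of_deriv_eq_zero (f := fun s => g s - deriv g t * s)
      (hd.mono fun s hs => hs.sub (differentiableAt_id.const_mul _)) (by
        filter_upwards [h1, hd] with s hs hd
        rw [(hd.hasDerivAt.fun_sub ((hasDerivAt_id' s).const_mul (deriv g t))).deriv, hs]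
        ring)
    filter_upwards [h2] with s hs
    linear_combination hs
  · rintro ⟨α, β, h⟩
    exact eventually_deriv_eq_of_affine (β := α) (α := 0)
      ((eventually_deriv_eq_of_affine h).mono fun s hs => by rw [hs]; ring)

theorem invariantNear_L6_and_solvesNear_iff {g : ℝ → ℝ} (c₂ : ℝ) {t x y : ℝ}
    (hg : ContDiffAt ℝ ∞ g t) (h0 : g t ≠ 0) {u : ℝ → ℝ → ℝ → ℝ} (hu : C2At u t x y) :
    InvariantNear (L6 g c₂) u t x y ∧ SolvesNear u t x y ↔
      ∃ (α β : ℝ) (w : ℝ → ℝ), (∀ᶠ t₁ in 𝓝 t, g t₁ = α * t₁ + β) ∧ ContDiffAt ℝ 2 w t ∧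
        Near t x y (fun t₁ x₁ y₁ => u t₁ x₁ y₁ = w t₁ - α * x₁ / (α * t₁ + β)) := by
  have hg' : ContDiffAt ℝ (3 : ℕ) g t := contDiffAt_infty.1 hg 3
  have hg2 : ContDiffAt ℝ 2 g t := contDiffAt_infty.1 hg 2
  have key : ∀ (α β : ℝ) (w : ℝ → ℝ), (∀ᶠ t₁ in 𝓝 t, g t₁ = α * t₁ + β) →
      (Near t x y (fun t₁ x₁ y₁ => u t₁ x₁ y₁ = w t₁ - x₁ * (deriv g t₁ / g t₁)) ↔
        Near t x y (fun t₁ x₁ y₁ => u t₁ x₁ y₁ = w t₁ - α * x₁ / (α * t₁ + β))) :=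
    fun α β w h => by
      refine eventually_congr ?_
      filter_upwards [near_of_eventually_t x y h,
        near_of_eventually_t x y (eventually_deriv_eq_of_affine h)] with p h1 h2
      rw [h1, h2, mul_div_assoc', mul_comm α p.2.1]
  rw [isInvariantForm_L6_add g c₂ t x y ⟨hg', h0⟩ u hu]
  constructor
  · rintro ⟨⟨w, hw, huw⟩, hs⟩
    rw [solvesNear_congr huw, solvesNear_L6_add x y hg' h0 hw,
      eventually_deriv_deriv_eq_zero_iff hg2] at hs
    obtain ⟨α, β, h⟩ := hs
    exact ⟨α, β, w, h, hw, (key α β w h).1 huw⟩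
  · rintro ⟨α, β, w, h, hw, huw⟩
    rw [← key α β w h] at huw
    exact ⟨⟨w, hw, huw⟩, (solvesNear_congr huw).2 ((solvesNear_L6_add x y hg' h0 hw).2
      ((eventually_deriv_deriv_eq_zero_iff hg2).2 ⟨α, β, h⟩))⟩

theorem invariantNear_L6_and_solvesNear_iff_of_deriv_ne_zero {g : ℝ → ℝ} (c₂ : ℝ) {t x y : ℝ}
    (hg : ContDiffAt ℝ ∞ g t) (h0 : g t ≠ 0) (h1 : deriv g t ≠ 0) {u : ℝ → ℝ → ℝ → ℝ}
    (hu : C2At u t x y) :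
    InvariantNear (L6 g c₂) u t x y ∧ SolvesNear u t x y ↔
      ∃ (α β : ℝ) (w : ℝ → ℝ), (∀ᶠ t₁ in 𝓝 t, g t₁ = α * t₁ + β) ∧ ContDiffAt ℝ 2 w t ∧
        Near t x y (fun t₁ x₁ y₁ => u t₁ x₁ y₁ = α * (w t₁ - x₁ / (α * t₁ + β))) := by
  rw [invariantNear_L6_and_solvesNear_iff c₂ hg h0 hu]
  constructor
  · rintro ⟨α, β, w, h, hw, huw⟩
    have hα : α ≠ 0 := (eventually_deriv_eq_of_affine h).self_of_nhds ▸ h1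
    -- The slope α equals g'(t) ≠ 0, so it can be factored out of the profile w.
    refine ⟨α, β, fun s => w s / α, h, hw.div_const α, huw.mono fun p hp => ?_⟩
    simp only [hp, mul_sub, mul_div_cancel₀ _ hα, mul_div_assoc]
  · rintro ⟨α, β, w, h, hw, huw⟩
    refine ⟨α, β, fun s => α * w s, h, contDiffAt_const.mul hw, huw.mono fun p hp => ?_⟩
    simp only [hp, mul_sub, mul_div_assoc]

end ZK

/-! ### Assembly of the twelve cases. -/

theorem mainTheorem1 :
    -- first algebra
    (∀ k₀ : ℝ,
      IsInvariantForm (L1 k₀) (fun _ x y => x ≠ 0 ∧ y ≠ 0)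
        (fun _ x y => y ^ 2 / x) (fun _ x _ w => x * w) ∧
      ReducesTo (fun _ x _ => x ≠ 0) (fun _ x y => y ^ 2 / x) (fun _ x _ w => x * w) red1 ∧
      HasForm red1 ∧ InFamily red1) ∧
    -- second algebra, generic case, in the two regions where `num2` has a constant sign
    (∀ k₀ k₁ c₁ c₂ c₃ κ ε : ℝ, κ = k₀ - c₃ * k₁ → c₂ ≠ 0 → (ε = 1 ∨ ε = -1) →
      IsReduction (L2 k₀ k₁ c₁ c₂ c₃)
        (fun t x y => den2 κ k₁ c₂ t y ≠ 0 ∧ 0 < ε * (-num2 κ k₁ c₁ c₂ t x y))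
        (fun t x y => Real.sqrt (ε * (-num2 κ k₁ c₁ c₂ t x y)) / (2 * den2 κ k₁ c₂ t y))
        (U2 κ k₁ c₁ c₂) (red2 ε κ k₁ c₁ c₂) ∧
      InFamily (red2 ε κ k₁ c₁ c₂)) ∧
    -- second algebra, the two degenerate cases with `c₂ = 0`
    (∀ k₀ k₁ c₁ c₃ κ : ℝ, κ = k₀ - c₃ * k₁ → κ ≠ 0 →
      IsInvariantForm (L2 k₀ k₁ c₁ 0 c₃)
        (fun t x y => x + c₁ * Real.exp (2 * k₁ * t) / (2 * κ) ≠ 0 ∧ y ≠ 0)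
        (fun t x y => y ^ 2 / (x + c₁ * Real.exp (2 * k₁ * t) / (2 * κ)))
        (fun t x _ w => c₁ * k₁ * Real.exp (2 * k₁ * t) / κ
          + (x + c₁ * Real.exp (2 * k₁ * t) / (2 * κ)) * w) ∧
      ReducesTo
        (fun t x _ => x + c₁ * Real.exp (2 * k₁ * t) / (2 * κ) ≠ 0)
        (fun t x y => y ^ 2 / (x + c₁ * Real.exp (2 * k₁ * t) / (2 * κ)))
        (fun t x _ w => c₁ * k₁ * Real.exp (2 * k₁ * t) / κ
          + (x + c₁ * Real.exp (2 * k₁ * t) / (2 * κ)) * w) red1) ∧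
    (∀ k₀ k₁ c₁ c₃ : ℝ, k₀ - c₃ * k₁ = 0 → c₁ ≠ 0 →
      IsReduction (L2 k₀ k₁ c₁ 0 c₃) (fun _ _ _ => True)
        (fun t _ y => Real.exp (-(k₁ * t)) * y)
        (fun t x _ w => -2 * k₁ * x + Real.exp (2 * k₁ * t) * w)
        (fun _ _ _ w₂ => w₂ + 4 * k₁ ^ 2)) ∧
    -- third algebra: the invariants are the functions of `t` and `y`; no reduction
    (∀ (g : ℝ → ℝ) (t x y : ℝ), ContDiffAt ℝ ∞ g t → deriv g t ≠ 0 →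
      (∀ u₀ : ℝ, ∀ F : ℝ × ℝ × ℝ × ℝ → ℝ, ContDiffAt ℝ 1 F (t, x, y, u₀) →
        (IsInvariantFunNear (L3 g) F (t, x, y, u₀) ↔
          ∃ Φ : ℝ → ℝ → ℝ, ∀ᶠ p in 𝓝 ((t, x, y, u₀) : ℝ × ℝ × ℝ × ℝ),
            F p = Φ p.1 p.2.2.1)) ∧
      ∀ u : ℝ → ℝ → ℝ → ℝ, C2At u t x y → ¬ InvariantNear (L3 g) u t x y) ∧
    -- fourth algebra
    (∀ h : ℝ → ℝ,
      IsInvariantForm (L4 h)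
        (fun t _ _ => ContDiffAt ℝ ∞ h t ∧ h t ≠ 0 ∧ deriv (deriv h) t ≠ 0)
        (fun t _ _ => t) (fun t _ y w => (w - y ^ 2) * deriv (deriv h) t / (4 * h t)) ∧
      ReducesTo (fun t _ _ => ContDiffAt ℝ ∞ h t ∧ h t ≠ 0)
        (fun t _ _ => t) (fun t _ y w => (w - y ^ 2) * deriv (deriv h) t / (4 * h t))
        (fun z _ _ _ => deriv (deriv h) z) ∧
      (∀ t x y : ℝ, ContDiffAt ℝ ∞ h t → h t ≠ 0 → ∀ w : ℝ → ℝ, ContDiffAt ℝ 2 w t →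
        (SolvesNear
            (fun t₁ _ y₁ => (w t₁ - y₁ ^ 2) * deriv (deriv h) t₁ / (4 * h t₁)) t x y ↔
          ∀ᶠ t₁ in 𝓝 t, deriv (deriv h) t₁ = 0) ∧
        (SolvesNear
            (fun t₁ _ y₁ => (w t₁ - y₁ ^ 2) * deriv (deriv h) t₁ / (4 * h t₁)) t x y →
          Near t x y
            (fun t₁ _ y₁ => (w t₁ - y₁ ^ 2) * deriv (deriv h) t₁ / (4 * h t₁) = 0))) ∧
      (∀ t x y : ℝ, ContDiffAt ℝ ∞ h t → h t ≠ 0 →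
        ∀ u : ℝ → ℝ → ℝ → ℝ, C2At u t x y →
          (InvariantNear (L4 h) u t x y ∧ SolvesNear u t x y ↔
            (∀ᶠ t₁ in 𝓝 t, deriv (deriv h) t₁ = 0) ∧
              ∃ w : ℝ → ℝ, ContDiffAt ℝ 2 w t ∧
                Near t x y (fun t₁ x₁ y₁ => u t₁ x₁ y₁ = w t₁)))) ∧
    -- fifth algebra
    (∀ k₀ c₃ : ℝ, k₀ ≠ 0 →
      IsReduction (L5 k₀ c₃) (fun t _ y => c₃ + 6 * k₀ * t ≠ 0 ∧ y ≠ 0)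
        (fun t _ y => (c₃ + 6 * k₀ * t) ^ 5 / y ^ 6)
        (fun t _ _ w => w / |c₃ + 6 * k₀ * t| ^ (1 / 3 : ℝ)) red5 ∧
      InFamily red5) ∧
    (∀ c₃ : ℝ, c₃ ≠ 0 →
      IsReduction (L5 0 c₃) (fun _ _ _ => True)
        (fun _ _ y => y) (fun _ _ _ w => w) redLin ∧
      InFamily redLin) ∧
    -- sixth algebra
    (∀ (g : ℝ → ℝ) (c₂ : ℝ),
      IsInvariantForm (L6 g c₂)
        (fun t _ _ => ContDiffAt ℝ ∞ g t ∧ g t ≠ 0 ∧ deriv g t ≠ 0)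
        (fun t _ _ => t) (fun t x _ w => deriv g t * (w - x / g t)) ∧
      ReducesTo (fun t _ _ => ContDiffAt ℝ ∞ g t ∧ g t ≠ 0)
        (fun t _ _ => t) (fun t x _ w => deriv g t * (w - x / g t))
        (fun z _ _ _ => deriv (deriv g) z) ∧
      (∀ t x y : ℝ, ContDiffAt ℝ ∞ g t → g t ≠ 0 →
        ∀ u : ℝ → ℝ → ℝ → ℝ, C2At u t x y →
          (deriv g t ≠ 0 →
            (InvariantNear (L6 g c₂) u t x y ∧ SolvesNear u t x y ↔
              ∃ (α β : ℝ) (w : ℝ → ℝ), (∀ᶠ t₁ in 𝓝 t, g t₁ = α * t₁ + β) ∧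
                ContDiffAt ℝ 2 w t ∧
                Near t x y
                  (fun t₁ x₁ y₁ => u t₁ x₁ y₁ = α * (w t₁ - x₁ / (α * t₁ + β))))) ∧
          (InvariantNear (L6 g c₂) u t x y ∧ SolvesNear u t x y ↔
            ∃ (α β : ℝ) (w : ℝ → ℝ), (∀ᶠ t₁ in 𝓝 t, g t₁ = α * t₁ + β) ∧
              ContDiffAt ℝ 2 w t ∧
              Near t x y
                (fun t₁ x₁ y₁ => u t₁ x₁ y₁ = w t₁ - α * x₁ / (α * t₁ + β))))) ∧
    -- seventh algebra
    (∀ k₀ c₂ c₃ : ℝ, k₀ ^ 2 + c₃ ^ 2 ≠ 0 →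
      IsReduction (L7 k₀ c₂ c₃) (fun t _ _ => c₃ + k₀ * t ≠ 0)
        (fun t x _ => x * (c₃ + k₀ * t))
        (fun t _ _ w => w / (c₃ + k₀ * t) ^ 2) (red7 k₀) ∧
      InFamily (red7 k₀)) ∧
    -- eighth algebra
    (∀ k₀ c₁ c₂ c₃ r s : ℝ, k₀ ≠ -1 / 6 → k₀ ≠ -2 / 3 →
      s = (6 * k₀ + 1) / (3 * k₀ + 2) → r = (6 * k₀ - 2) / (6 * k₀ + 1) →
      IsReduction (L8 k₀ c₁ c₂ c₃)
        (fun _ x y => (6 * k₀ + 1) * x + 3 * c₁ ≠ 0 ∧ (3 * k₀ + 2) * y + 3 * c₂ ≠ 0)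
        (fun _ x y => |(6 * k₀ + 1) * x + 3 * c₁| / |(3 * k₀ + 2) * y + 3 * c₂| ^ s)
        (fun _ x _ w => |(6 * k₀ + 1) * x + 3 * c₁| ^ r * w) (red8 k₀ r s) ∧
      InFamily (red8 k₀ r s)) ∧
    (∀ c₁ c₂ c₃ : ℝ, c₁ ≠ 0 →
      IsReduction (L8 (-1 / 6) c₁ c₂ c₃) (fun _ _ y => y + 2 * c₂ ≠ 0)
        (fun _ x y => Real.exp (x / c₁) / (y + 2 * c₂) ^ 2)
        (fun _ x _ w => w / Real.exp (x / c₁)) (red8b c₁) ∧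
      InFamily (red8b c₁)) ∧
    (∀ c₂ c₃ : ℝ,
      IsReduction (L8 (-1 / 6) 0 c₂ c₃) (fun _ _ y => y + 2 * c₂ ≠ 0)
        (fun _ x _ => x) (fun _ _ y w => w / (y + 2 * c₂) ^ 2)
        (fun _ w w₁ w₂ => 6 * w + w₁ ^ 2 + w * w₂)) ∧
    (∀ c₁ c₂ c₃ : ℝ, c₂ ≠ 0 →
      IsReduction (L8 (-2 / 3) c₁ c₂ c₃) (fun _ x _ => c₁ - x ≠ 0)
        (fun _ x y => (c₁ - x) * Real.exp (y / c₂))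
        (fun _ x _ w => (c₁ - x) ^ 2 * w) (red8c c₂) ∧
      InFamily (red8c c₂)) ∧
    (∀ c₁ c₃ : ℝ,
      IsReduction (L8 (-2 / 3) c₁ 0 c₃) (fun _ x _ => c₁ - x ≠ 0)
        (fun _ _ y => y) (fun _ x _ w => (c₁ - x) ^ 2 * w)
        (fun _ w _ w₂ => 6 * w ^ 2 + w₂) ∧
      InFamily (fun _ w _ w₂ => 6 * w ^ 2 + w₂)) ∧
    -- ninth algebra
    (IsInvariantForm L9 (fun _ _ y => y ≠ 0) (fun t _ _ => t) (fun _ _ y w => y ^ 2 * w) ∧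
      ReducesTo (fun _ _ _ => True) (fun t _ _ => t) (fun _ _ y w => y ^ 2 * w)
        (fun _ w _ _ => w) ∧
      (∀ t x y : ℝ, y ≠ 0 → ∀ u : ℝ → ℝ → ℝ → ℝ, C2At u t x y →
        (InvariantNear L9 u t x y ∧ SolvesNear u t x y ↔
          Near t x y (fun t₁ x₁ y₁ => u t₁ x₁ y₁ = 0)))) ∧
    -- tenth algebra
    (∀ k₀ c₃ r s : ℝ, k₀ ≠ 1 / 2 → k₀ ≠ 2 / 3 →
      r = (3 - 6 * k₀) / (2 - 3 * k₀) → s = (6 * k₀ - 2) / (3 - 6 * k₀) →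
      IsReduction (L10 k₀ c₃) (fun t _ y => c₃ + (3 - 6 * k₀) * t ≠ 0 ∧ y ≠ 0)
        (fun t _ y => |c₃ + (3 - 6 * k₀) * t| / |y| ^ r)
        (fun t _ _ w => |c₃ + (3 - 6 * k₀) * t| ^ s * w) (red10 k₀) ∧
      InFamily (red10 k₀)) ∧
    (∀ c₃ : ℝ,
      IsReduction (L10 (2 / 3) c₃) (fun t _ _ => c₃ - t ≠ 0)
        (fun _ _ y => y) (fun t _ _ w => w / (c₃ - t) ^ 2) redLin) ∧
    (∀ c₃ : ℝ, c₃ ≠ 0 →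
      IsReduction (L10 (1 / 2) c₃) (fun _ _ _ => True)
        (fun t _ y => Real.exp (-t / (2 * c₃)) * y)
        (fun t _ _ w => Real.exp (t / c₃) * w) redLin) ∧
    -- eleventh algebra
    (∀ c₂ : ℝ,
      IsReduction (L11 c₂) (fun _ x _ => x ≠ 0) (fun t _ _ => t) (fun _ x _ w => x * w) red11 ∧
      InFamily red11) ∧
    -- twelfth algebra
    (∀ k₀ c₂ c₃ r s : ℝ, k₀ ≠ 1 → k₀ ≠ -1 / 3 →
      s = 3 * (1 - k₀) / (1 + 3 * k₀) → r = 2 * (3 * k₀ - 1) / (3 * (1 - k₀)) →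
      IsReduction (L12 k₀ c₂ c₃) (fun t x _ => 3 * (1 - k₀) * t + 2 * c₃ ≠ 0 ∧ x ≠ 0)
        (fun t x _ => |3 * (1 - k₀) * t + 2 * c₃| / |x| ^ s)
        (fun t x _ w => Real.sign ((3 * (1 - k₀) * t + 2 * c₃) * x)
          * |3 * (1 - k₀) * t + 2 * c₃| ^ r * w) (red12 k₀ r s) ∧
      InFamily (red12 k₀ r s)) ∧
    (∀ c₂ c₃ : ℝ, c₃ ≠ 0 →
      IsReduction (L12 1 c₂ c₃) (fun _ x _ => x ≠ 0)
        (fun t x _ => Real.exp (2 * t / c₃) / x)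
        (fun t _ _ w => Real.exp (2 * t / c₃) * w) (red12b c₃) ∧
      InFamily (red12b c₃)) ∧
    (∀ c₂ c₃ : ℝ,
      IsReduction (L12 (-1 / 3) c₂ c₃) (fun t _ _ => c₃ + 2 * t ≠ 0)
        (fun _ x _ => x) (fun t _ _ w => w / (c₃ + 2 * t)) red12c ∧
      InFamily red12c) := by
  refine ⟨fun k₀ => ⟨isInvariantForm_L1 k₀, reducesTo_L1, inFamily_red1.hasForm, inFamily_red1⟩,
    fun k₀ k₁ c₁ c₂ c₃ κ ε hκ hc hε => ⟨isReduction_L2 hκ hc hε, inFamily_red2 ε κ k₁ c₁ c₂⟩,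
    fun k₀ k₁ c₁ c₃ κ hκ hκ0 => ⟨isInvariantForm_L2_zero hκ hκ0, reducesTo_L2_zero k₁ c₁ κ⟩,
    fun k₀ k₁ c₁ c₃ hκ hc => isReduction_L2_degenerate hκ hc,
    fun g t x y hg hg' => ⟨fun u₀ F hF =>
      isInvariantFunNear_L3_iff (contDiffAt_infty.1 hg 2) hg' hF,
      fun u _ => not_invariantNear_L3 hg' u⟩,
    fun h => ⟨isInvariantForm_L4 h, reducesTo_L4 h, fun t x y hh h0 w hw =>
      ⟨solvesNear_L4_iff x y hh h0 hw, fun hs => ?_⟩,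
      fun t x y hh h0 u hu => invariantNear_L4_and_solvesNear_iff hh h0 hu⟩,
    fun k₀ c₃ hk => ⟨isReduction_L5 hk, inFamily_red5⟩,
    fun c₃ hc => ⟨isReduction_L5_zero hc, inFamily_redLin⟩,
    fun g c₂ => ⟨isInvariantForm_L6 g c₂, reducesTo_L6 g, fun t x y hg h0 u hu =>
      ⟨fun h1 => invariantNear_L6_and_solvesNear_iff_of_deriv_ne_zero c₂ hg h0 h1 hu,
        invariantNear_L6_and_solvesNear_iff c₂ hg h0 hu⟩⟩,
    fun k₀ c₂ c₃ _ => ⟨isReduction_L7 k₀ c₂ c₃, inFamily_red7 k₀⟩,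
    fun k₀ c₁ c₂ c₃ r s h1 h2 hs hr =>
      ⟨isReduction_L8 c₁ c₂ c₃ h1 h2 hs hr, inFamily_red8 k₀ r s⟩,
    fun c₁ c₂ c₃ hc => ⟨isReduction_L8b c₂ c₃ hc, inFamily_red8b c₁⟩,
    isReduction_L8b_zero,
    fun c₁ c₂ c₃ hc => ⟨isReduction_L8c c₁ c₃ hc, inFamily_red8c c₂⟩,
    fun c₁ c₃ => ⟨isReduction_L8c_zero c₁ c₃, inFamily_red8c_zero⟩,
    ⟨isInvariantForm_L9, reducesTo_L9, fun t x y hy u hu =>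
      invariantNear_L9_and_solvesNear_iff hy hu⟩,
    fun k₀ c₃ r s h1 h2 hr hs => ⟨isReduction_L10 c₃ h1 h2 hr hs, inFamily_red10 k₀⟩,
    isReduction_L10_two_thirds,
    fun c₃ hc => isReduction_L10_half hc,
    fun c₂ => ⟨isReduction_L11 c₂, inFamily_red11⟩,
    fun k₀ c₂ c₃ r s h1 h2 hs hr => ⟨isReduction_L12 c₂ c₃ h1 h2 hs hr, inFamily_red12 k₀ r s⟩,
    fun c₂ c₃ hc => ⟨isReduction_L12_one c₂ hc, inFamily_red12b c₃⟩,
    fun c₂ c₃ => ⟨isReduction_L12_neg_third c₂ c₃, inFamily_red12c⟩⟩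
  -- For the fourth algebra, a solution forces h'' = 0 near t, and h'' is a factor of the ansatz.
  filter_upwards [near_of_eventually_t x y ((solvesNear_L4_iff x y hh h0 hw).1 hs)] with p hp
  rw [hp, mul_zero, zero_div]
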